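/- **Conventions.** $D=-i\partial$; points of $\mathbb R^2$ are $(x,y)$. $S(1)$ is the set of $C^\infty$ functions $\mathbb R^2\to\mathbb C$ all of whose derivatives are bounded. A semiclassical symbol is a family $a(\cdot,h)$, $h\in(0,h_1]$ $(h_1>0)$, of $C^\infty$ functions on $\mathbb R^2$ with an expansion $a(\cdot,h)\sim\sum_{j\ge0}h^ja_j$, where $a_j\in S(1)$ do not depend on $h$ and, for every $M$, every derivative of $a(\cdot,h)-\sum_{j\le M}h^ja_j$ is bounded by a constant times $h^{M+1}$, uniformly on $\mathbb R^2\times(0,h_1]$. The operator $a(h^{1/2}x+y,\,hD_y-h^{1/2}D_x,\,h)$ is the function $a(\cdot,h)$ of the two commuting self-adjoint operators $h^{1/2}x+y$ and $hD_y-h^{1/2}D_x$ in $L^2(\mathbb R^2)$, in the sense of the spectral theorem. For $c\in S(1)$, $c(y,hD_y)$ is the semiclassical Weyl quantization in the variable $y$, $$c(y,hD_y)\varphi(x,y)=\frac1{2\pi h}\int\!\!\int e^{\frac ih(y-y')\eta}\,c\Big(\frac{y+y'}2,\eta\Big)\varphi(x,y')\,dy'\,d\eta ,$$ extended to a bounded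 operator in $L^2(\mathbb R^2)$. For an integer $k\ge 0$, $B^k(\mathbb R)=\{v\in L^2(\mathbb R): x^\alpha D_x^\beta v\in L^2(\mathbb R),\ \alpha+\beta\le k\}$, and the Hilbert tensor product $B^k(\mathbb R_x)\otimes L^2(\mathbb R_y)$ is the space of $u\in L^2(\mathbb R^2)$ with $x^\alpha D_x^\beta u\in L^2(\mathbb R^2)$ for $\alpha+\beta\le k$, with norm $\big(\sum_{\alpha+\beta\le k}\|x^\alpha D_x^\beta u\|^2\big)^{1/2}$. **Proposition 3.1.** Let $a\sim\sum_{j\ge0} h^ja_j$ be a semiclassical symbol in $\mathbb R^2$, $0<h\le h_1$. Then $a(h^{1/2}x+y,hD_y-h^{1/2}D_x,h)$ is a well-defined bounded operator in $L^2(\mathbb R^2)$ for every $h\in(0,h_1]$, and there are symbols $a_{k_1,k_2,j}\in S(1)$ $(k_1,k_2,j\in\mathbb N)$, independent of $h$, with $a_{0,0,0}=a_0$ (so $a_{0,0,0}=a$ if $a$ does not depend on $h$), whose quantizations $a_{k_1,k_2,j}(y,hD_y)$ are bounded in $L^2(\mathbb R^2)$ for every $h>0$, such that $$a(h^{1/2}x+y,hD_y-h^{1/2}D_x,h)\sim\sum_{j\ge0}h^{\frac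 j2}\Big(\sum_{k_1+k_2\le j}a_{k_1,k_2,j}(y,hD_y)\,x^{k_1}D_x^{k_2}\Big)$$ in the following sense. For $N\in\mathbb N$ put $$R_N(h)=a(h^{1/2}x+y,hD_y-h^{1/2}D_x,h)-\sum_{j=0}^Nh^{\frac j2}\Big(\sum_{k_1+k_2\le j}a_{k_1,k_2,j}(y,hD_y)\,x^{k_1}D_x^{k_2}\Big).$$ For every $N\in\mathbb N$ there is $h_0\in(0,h_1]$ such that for every integer $s\ge0$ there is a constant $C_s$ (which may depend on $N$) with the property that, for all $h\in(0,h_0]$, $R_N(h)$ maps $B^{s+N+1}(\mathbb R_x)\otimes L^2(\mathbb R_y)$ into $B^s(\mathbb R_x)\otimes L^2(\mathbb R_y)$ and $$\big\|R_N(h): B^{s+N+1}(\mathbb R_x)\otimes L^2(\mathbb R_y)\to B^{s}(\mathbb R_x)\otimes L^2(\mathbb R_y)\big\|\le C_s\,h^{\frac{N+1}2}.$$ -/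

import Mathlib

open MeasureTheory Set Filter Topology
open scoped SchwartzMap LineDeriv ContDiff InnerProductSpace

noncomputable section

/-! ### Symbols -/

/-- The symbol class `S(1)` on `ℝ²`: smooth functions all of whose derivatives are bounded. -/
def IsSymbol (a : ℝ × ℝ → ℂ) : Prop :=
  ContDiff ℝ ∞ a ∧ ∀ n : ℕ, ∃ C : ℝ, ∀ z, ‖iteratedFDeriv ℝ n a z‖ ≤ C

/-- `a(·, h)`, `0 < h ≤ h₁`, is a semiclassical symbol with `a(·, h) ∼ ∑ h ^ j a' j`: the
functions `a' j` belong to `S(1)` and, for each `M`, the family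
`h ^ (-(M + 1)) (a(·, h) - ∑_{j ≤ M} h ^ j a' j)`, `0 < h ≤ h₁`, is bounded in `S(1)`. -/
structure IsSemiclassicalSymbol (h₁ : ℝ) (a : ℝ → ℝ × ℝ → ℂ) (a' : ℕ → ℝ × ℝ → ℂ) : Prop where
  pos : 0 < h₁
  contDiff : ∀ h ∈ Ioc 0 h₁, ContDiff ℝ ∞ (a h)
  coeff : ∀ j, IsSymbol (a' j)
  asymp : ∀ M n : ℕ, ∃ C : ℝ, ∀ h ∈ Ioc 0 h₁, ∀ z,
    ‖iteratedFDeriv ℝ n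
      (fun w => a h w - ∑ j ∈ Finset.range (M + 1), (h : ℂ) ^ j * a' j w) z‖ ≤ C * h ^ (M + 1)

/-! ### Functions of a pair of commuting self-adjoint operators -/

section JointFunction

variable {H : Type*} [NormedAddCommGroup H] [InnerProductSpace ℂ H]

/-- Spectral theorem, multiplication form: `T = f(P, Q)`. Here the unbounded operators `P` and `Q`
are given by their graphs. A unitary map onto some `L²(X, μ)` turns `P` and `Q`, with their
domains, into the maximal operators of multiplication by real functions `p` and `q`, and turns `T`
into multiplication by `f(p, q)`. For bounded measurable `f` there is at most one such `T`, see
`IsJointFunction.unique`. -/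
def IsJointFunction (P Q : Set (H × H)) (f : ℝ × ℝ → ℂ) (T : H →L[ℂ] H) : Prop :=
  ∃ (X : Type) (_ : MeasurableSpace X) (μ : Measure X) (U : H ≃ₗᵢ[ℂ] Lp ℂ 2 μ) (p q : X → ℝ),
    Measurable p ∧ Measurable q ∧
    (∀ u w : H, (u, w) ∈ P ↔ U w =ᵐ[μ] fun t => (p t : ℂ) * U u t) ∧
    (∀ u w : H, (u, w) ∈ Q ↔ U w =ᵐ[μ] fun t => (q t : ℂ) * U u t) ∧
    ∀ u : H, U (T u) =ᵐ[μ] fun t => f (p t, q t) * U u t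

lemma exists_Lp_mul {X : Type*} [MeasurableSpace X] {μ : Measure X} {g : X → ℂ}
    (hg : Measurable g) {C : ℝ} (hC : ∀ t, ‖g t‖ ≤ C) (v : Lp ℂ 2 μ) :
    ∃ w : Lp ℂ 2 μ, w =ᵐ[μ] fun t => g t * v t := by
  have hm : MemLp (fun t => g t * v t) 2 μ := by
    refine MemLp.of_le_mul (c := C) (Lp.memLp v)
      (hg.aestronglyMeasurable.mul (Lp.aestronglyMeasurable v)) (Eventually.of_forall fun t => ?_)
    rw [norm_mul]
    exact mul_le_mul_of_nonneg_right (hC t) (norm_nonneg _)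
  exact ⟨hm.toLp _, hm.coeFn_toLp⟩

lemma one_sub_mul_I_ne_zero (τ : ℝ) : (1 - (τ : ℂ) * Complex.I) ≠ 0 := by
  intro h
  have := congrArg Complex.re h
  simp at this

lemma norm_resolvent_le (τ : ℝ) : ‖(1 - (τ : ℂ) * Complex.I)⁻¹‖ ≤ 1 := by
  rw [norm_inv]
  apply inv_le_one_of_one_le₀
  have := Complex.abs_re_le_norm (1 - (τ : ℂ) * Complex.I)
  simpa using this

/-- The measure `B ↦ ‖1_B(p, q) v‖²` on `ℝ²`. -/
def scalarMeasure {X : Type*} [MeasurableSpace X] (μ : Measure X) (p q : X → ℝ) (v : Lp ℂ 2 μ) :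
    Measure (ℝ × ℝ) :=
  (μ.withDensity fun t => ((‖v t‖₊ ^ 2 : NNReal) : ENNReal)).map fun t => (p t, q t)

lemma isFiniteMeasure_scalarMeasure {X : Type*} [MeasurableSpace X] (μ : Measure X) (p q : X → ℝ)
    (v : Lp ℂ 2 μ) : IsFiniteMeasure (scalarMeasure μ p q v) := by
  have h := (eLpNorm_lt_top_iff_lintegral_rpow_enorm_lt_top (p := 2) (by norm_num) (by norm_num)).1
    (Lp.memLp v).2
  have : IsFiniteMeasure (μ.withDensity fun t => ((‖v t‖₊ ^ 2 : NNReal) : ENNReal)) := by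
    apply isFiniteMeasure_withDensity
    refine ne_of_lt (lt_of_le_of_lt (le_of_eq ?_) h)
    refine lintegral_congr fun t => ?_
    simp [enorm_eq_nnnorm]
  unfold scalarMeasure
  infer_instance

lemma inner_mul_eq_integral {X : Type*} [MeasurableSpace X] {μ : Measure X} {p q : X → ℝ}
    (hp : Measurable p) (hq : Measurable q) {g : ℝ × ℝ → ℂ} (hg : Measurable g)
    (v w : Lp ℂ 2 μ) (hw : w =ᵐ[μ] fun t => g (p t, q t) * v t) :
    ⟪v, w⟫_ℂ = ∫ z, g z ∂(scalarMeasure μ p q v) := by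
  unfold scalarMeasure
  rw [integral_map (hp.prodMk hq).aemeasurable hg.aestronglyMeasurable]
  rw [integral_withDensity_eq_integral_smul₀
    ((Lp.aestronglyMeasurable v).nnnorm.aemeasurable.pow_const 2)]
  rw [MeasureTheory.L2.inner_def]
  refine integral_congr_ae ?_
  filter_upwards [hw] with t ht
  rw [ht, RCLike.inner_apply', NNReal.smul_def]
  have h1 : (starRingEnd ℂ) (v t) * v t = ((‖v t‖ ^ 2 : ℝ) : ℂ) := by
    rw [mul_comm, Complex.mul_conj, Complex.normSq_eq_norm_sq]
  have h2 : (starRingEnd ℂ) (v t) * (g (p t, q t) * v t)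
      = ((starRingEnd ℂ) (v t) * v t) * g (p t, q t) := by ring
  rw [h2, h1]
  simp

/-- `f(P, Q)` is unique. -/
theorem IsJointFunction.unique {P Q : Set (H × H)} {f : ℝ × ℝ → ℂ} {T T' : H →L[ℂ] H}
    (hf : Measurable f) (hT : IsJointFunction P Q f T) (hT' : IsJointFunction P Q f T') :
    T = T' := by
  obtain ⟨X, mX, μ, U, p, q, hp, hq, hP, hQ, hU⟩ := hT
  obtain ⟨X', mX', μ', U', p', q', hp', hq', hP', hQ', hU'⟩ := hT'
  -- the functions `g` such that `g(P, Q)` does not depend on the representation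
  let Good : (ℝ × ℝ → ℂ) → Prop := fun g => Measurable g ∧ ∀ u : H, ∃ w : H,
    (U w =ᵐ[μ] fun t => g (p t, q t) * U u t) ∧ (U' w =ᵐ[μ'] fun t => g (p' t, q' t) * U' u t)
  have good_one : Good fun _ => 1 :=
    ⟨measurable_const, fun u => ⟨u, by simp, by simp⟩⟩
  have good_mul : ∀ g g', Good g → Good g' → Good fun z => g z * g' z := by
    rintro g g' ⟨mg, hg⟩ ⟨mg', hg'⟩
    refine ⟨mg.mul mg', fun u => ?_⟩
    obtain ⟨w, h1, h2⟩ := hg' u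
    obtain ⟨x, h3, h4⟩ := hg w
    refine ⟨x, ?_, ?_⟩
    · filter_upwards [h1, h3] with t e1 e3
      rw [e3, e1, mul_assoc]
    · filter_upwards [h2, h4] with t e2 e4
      rw [e4, e2, mul_assoc]
  have good_pow : ∀ g, Good g → ∀ n : ℕ, Good fun z => g z ^ n := by
    intro g hg n
    induction n with
    | zero => simpa using good_one
    | succ n ih => simpa [pow_succ] using good_mul _ _ ih hg
  -- resolvents, treated for both operators at once
  have key : ∀ (R : Set (H × H)) (r : X → ℝ) (r' : X' → ℝ), Measurable r →
      (∀ u w : H, (u, w) ∈ R ↔ U w =ᵐ[μ] fun t => (r t : ℂ) * U u t) →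
      (∀ u w : H, (u, w) ∈ R ↔ U' w =ᵐ[μ'] fun t => (r' t : ℂ) * U' u t) →
      ∀ (τ : ℝ) (u : H), ∃ w : H,
        (U w =ᵐ[μ] fun t => (1 - ((τ * r t : ℝ) : ℂ) * Complex.I)⁻¹ * U u t) ∧
        (U' w =ᵐ[μ'] fun t => (1 - ((τ * r' t : ℝ) : ℂ) * Complex.I)⁻¹ * U' u t) := by
    intro R r r' hr hR hR' τ u
    rcases eq_or_ne τ 0 with rfl | hτ
    · exact ⟨u, by simp, by simp⟩
    have hτ' : (τ : ℂ) ≠ 0 := by exact_mod_cast hτ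
    obtain ⟨w₀, hw₀⟩ := exists_Lp_mul (μ := μ)
      (g := fun t => (1 - ((τ * r t : ℝ) : ℂ) * Complex.I)⁻¹) (by fun_prop)
      (fun t => norm_resolvent_le _) (U u)
    obtain ⟨w, rfl⟩ := U.surjective w₀
    have hmem : (w, (-Complex.I / (τ : ℂ)) • (w - u)) ∈ R := by
      rw [hR]
      have e := Lp.coeFn_smul (-Complex.I / (τ : ℂ)) (U w - U u)
      have e' := Lp.coeFn_sub (U w) (U u)
      rw [map_smul, map_sub]
      filter_upwards [hw₀, e, e'] with t h1 h2 h3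
      have hz := inv_mul_cancel₀ (one_sub_mul_I_ne_zero (τ * r t))
      rw [h2, Pi.smul_apply, h3, Pi.sub_apply, h1, smul_eq_mul]
      generalize (1 - ((τ * r t : ℝ) : ℂ) * Complex.I)⁻¹ = ζ at hz
      have hz1 : ζ * U u t - U u t = ζ * τ * r t * Complex.I * U u t := by
        push_cast at hz
        linear_combination (U u t) * hz
      rw [hz1]
      field_simp
      simp only [Complex.I_sq]
      ring
    rw [hR'] at hmem
    refine ⟨w, hw₀, ?_⟩
    have e := Lp.coeFn_smul (-Complex.I / (τ : ℂ)) (U' w - U' u)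
    have e' := Lp.coeFn_sub (U' w) (U' u)
    rw [map_smul, map_sub] at hmem
    filter_upwards [hmem, e, e'] with t h1 h2 h3
    have hne := one_sub_mul_I_ne_zero (τ * r' t)
    rw [h2, Pi.smul_apply, h3, Pi.sub_apply, smul_eq_mul] at h1
    rw [eq_inv_mul_iff_mul_eq₀ hne]
    have h4 : -Complex.I * (U' w t - U' u t) = (τ : ℂ) * ((r' t : ℂ) * U' w t) := by
      rw [← h1]; field_simp
    have h5 : U' w t - U' u t = Complex.I * ((τ : ℂ) * ((r' t : ℂ) * U' w t)) := by
      rw [← h4, ← mul_assoc]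
      simp
    push_cast
    linear_combination h5
  have good_fst : ∀ τ : ℝ, Good fun z => (1 - ((τ * z.1 : ℝ) : ℂ) * Complex.I)⁻¹ :=
    fun τ => ⟨by fun_prop, fun u => key P p p' hp hP hP' τ u⟩
  have good_snd : ∀ τ : ℝ, Good fun z => (1 - ((τ * z.2 : ℝ) : ℂ) * Complex.I)⁻¹ :=
    fun τ => ⟨by fun_prop, fun u => key Q q q' hq hQ hQ' τ u⟩
  -- equality of the scalar spectral measures
  have good_int : ∀ g, Good g → ∀ u,
      ∫ z, g z ∂(scalarMeasure μ p q (U u)) = ∫ z, g z ∂(scalarMeasure μ' p' q' (U' u)) := by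
    rintro g ⟨mg, hg⟩ u
    obtain ⟨w, h1, h2⟩ := hg u
    rw [← inner_mul_eq_integral hp hq mg _ _ h1, ← inner_mul_eq_integral hp' hq' mg _ _ h2,
      LinearIsometryEquiv.inner_map_map, LinearIsometryEquiv.inner_map_map]
  have meas_eq : ∀ u, scalarMeasure μ p q (U u) = scalarMeasure μ' p' q' (U' u) := by
    intro u
    have := isFiniteMeasure_scalarMeasure μ p q (U u)
    have := isFiniteMeasure_scalarMeasure μ' p' q' (U' u)
    refine Measure.ext_of_charFunDual ?_
    funext L
    rw [charFunDual_apply, charFunDual_apply]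
    let s := L (1, 0)
    let t := L (0, 1)
    have hL : ∀ z : ℝ × ℝ, L z = s * z.1 + t * z.2 := by
      intro z
      have : z = z.1 • ((1, 0) : ℝ × ℝ) + z.2 • ((0, 1) : ℝ × ℝ) := by ext <;> simp
      conv_lhs => rw [this]
      rw [map_add, map_smul, map_smul, smul_eq_mul, smul_eq_mul, mul_comm, mul_comm z.2]
    let F : ℕ → ℝ × ℝ → ℂ := fun n z =>
      ((1 - (((s / n) * z.1 : ℝ) : ℂ) * Complex.I)⁻¹) ^ n *
        ((1 - (((t / n) * z.2 : ℝ) : ℂ) * Complex.I)⁻¹) ^ n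
    have F_good : ∀ n, Good (F n) := fun n =>
      good_mul _ _ (good_pow _ (good_fst _) n) (good_pow _ (good_snd _) n)
    have F_bound : ∀ n z, ‖F n z‖ ≤ 1 := by
      intro n z
      simp only [F, norm_mul, norm_pow]
      exact mul_le_one₀ (pow_le_one₀ (norm_nonneg _) (norm_resolvent_le _)) (by positivity)
        (pow_le_one₀ (norm_nonneg _) (norm_resolvent_le _))
    have aux : ∀ c : ℝ, Tendsto
        (fun n : ℕ => ((1 - ((c / n : ℝ) : ℂ) * Complex.I)⁻¹) ^ n) atTop
        (𝓝 (Complex.exp (c * Complex.I))) := by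
      intro c
      have h := Complex.tendsto_one_add_div_pow_exp (-(c * Complex.I))
      have h' := h.inv₀ (Complex.exp_ne_zero _)
      rw [← Complex.exp_neg, neg_neg] at h'
      refine h'.congr fun n => ?_
      rw [inv_pow]
      congr 2
      push_cast
      ring
    have F_lim : ∀ z, Tendsto (fun n => F n z) atTop (𝓝 (Complex.exp (L z * Complex.I))) := by
      intro z
      have h := (aux (s * z.1)).mul (aux (t * z.2))
      rw [← Complex.exp_add] at h
      have e : ((s * z.1 : ℝ) : ℂ) * Complex.I + ((t * z.2 : ℝ) : ℂ) * Complex.I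
          = (L z : ℂ) * Complex.I := by
        rw [hL z]; push_cast; ring
      rw [e] at h
      refine h.congr fun n => ?_
      simp only [F]
      rw [div_mul_eq_mul_div, div_mul_eq_mul_div]
    have lim : ∀ ν : Measure (ℝ × ℝ), IsFiniteMeasure ν →
        Tendsto (fun n => ∫ z, F n z ∂ν) atTop (𝓝 (∫ z, Complex.exp (L z * Complex.I) ∂ν)) := by
      intro ν hν
      exact tendsto_integral_of_dominated_convergence (fun _ => (1 : ℝ))
        (fun n => (F_good n).1.aestronglyMeasurable) (integrable_const _)
        (fun n => Eventually.of_forall fun z => F_bound n z) (Eventually.of_forall F_lim)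
    refine tendsto_nhds_unique (lim _ inferInstance) ?_
    refine (lim _ inferInstance).congr fun n => ?_
    exact (good_int _ (F_good n) u).symm
  have hlin : (T : H →ₗ[ℂ] H) = T' := by
    rw [← ext_inner_map]
    intro u
    have h1 : ⟪u, T u⟫_ℂ = ⟪u, T' u⟫_ℂ := by
      rw [← U.inner_map_map, ← U'.inner_map_map u (T' u),
        inner_mul_eq_integral hp hq hf _ _ (hU u), inner_mul_eq_integral hp' hq' hf _ _ (hU' u),
        meas_eq u]
    have h2 := congrArg (starRingEnd ℂ) h1
    rwa [inner_conj_symm, inner_conj_symm] at h2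
  ext u
  exact congrArg (fun S : H →ₗ[ℂ] H => S u) hlin

open Classical in
/-- The bounded operator `f(P, Q)` (and `0` if it does not exist). -/
def jointFunction (P Q : Set (H × H)) (f : ℝ × ℝ → ℂ) : H →L[ℂ] H :=
  if hT : ∃ T, IsJointFunction P Q f T then hT.choose else 0

end JointFunction

/-! ### Operators in `L²(ℝ²)`

Points of `ℝ²` are written `z = (x, y)`. -/

/-- The Hilbert space `L²(ℝ², dx dy)`. -/
abbrev L2Plane : Type := Lp ℂ 2 (volume : Measure (ℝ × ℝ))

/-- `D_x = -i ∂_x` on tempered distributions on `ℝ²`. -/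
def distDx (T : 𝓢'(ℝ × ℝ, ℂ)) : 𝓢'(ℝ × ℝ, ℂ) := (-Complex.I) • ∂_{((1, 0) : ℝ × ℝ)} T

/-- `D_y = -i ∂_y` on tempered distributions on `ℝ²`. -/
def distDy (T : 𝓢'(ℝ × ℝ, ℂ)) : 𝓢'(ℝ × ℝ, ℂ) := (-Complex.I) • ∂_{((0, 1) : ℝ × ℝ)} T

/-- The graph of the operator `h^{1/2} x + y` in `L²(ℝ²)`, with its maximal domain. -/
def opP (h : ℝ) : Set (L2Plane × L2Plane) :=
  {uw | uw.2 =ᵐ[volume] fun z => ((√h * z.1 + z.2 : ℝ) : ℂ) * uw.1 z}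

/-- The graph of the operator `h D_y - h^{1/2} D_x` in `L²(ℝ²)`, with its maximal domain
(derivatives in the sense of distributions). -/
def opQ (h : ℝ) : Set (L2Plane × L2Plane) :=
  {uw | (uw.2 : 𝓢'(ℝ × ℝ, ℂ)) = (h : ℂ) • distDy (uw.1 : 𝓢'(ℝ × ℝ, ℂ))
    - ((√h : ℝ) : ℂ) • distDx (uw.1 : 𝓢'(ℝ × ℝ, ℂ))}

/-- The operator `a(h^{1/2} x + y, h D_y - h^{1/2} D_x)` in `L²(ℝ²)`. -/
def opA (h : ℝ) (a : ℝ × ℝ → ℂ) : L2Plane →L[ℂ] L2Plane := jointFunction (opP h) (opQ h) a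

/-- The semiclassical Weyl quantization in the variable `y`, as an iterated integral:
`(2πh)⁻¹ ∫ (∫ exp(i (y - y') η / h) c((y + y')/2, η) φ(x, y') dy') dη`. -/
def weylIntegral (h : ℝ) (c : ℝ × ℝ → ℂ) (φ : ℝ × ℝ → ℂ) (z : ℝ × ℝ) : ℂ :=
  ((2 * Real.pi * h : ℝ) : ℂ)⁻¹ * ∫ η : ℝ, ∫ y' : ℝ,
    Complex.exp (Complex.I * (((z.2 - y') * η / h : ℝ) : ℂ)) * c ((z.2 + y') / 2, η) * φ (z.1, y')

/-- `A` is the operator `c(y, h D_y)` (that is, `I ⊗ c(y, h D_y)`) in `L²(ℝ²)`: it is bounded and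
is given on Schwartz functions by the Weyl quantization formula. -/
def IsWeyl (h : ℝ) (c : ℝ × ℝ → ℂ) (A : L2Plane →L[ℂ] L2Plane) : Prop :=
  ∀ φ : 𝓢(ℝ × ℝ, ℂ), A (φ.toLp 2 volume) =ᵐ[volume] weylIntegral h c φ

/-- `c(y, h D_y)` is unique. -/
theorem IsWeyl.unique {h : ℝ} {c : ℝ × ℝ → ℂ} {A A' : L2Plane →L[ℂ] L2Plane}
    (hA : IsWeyl h c A) (hA' : IsWeyl h c A') : A = A' := by
  have hd : DenseRange (SchwartzMap.toLpCLM ℝ (E := ℝ × ℝ) ℂ 2 volume) :=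
    SchwartzMap.denseRange_toLpCLM (by norm_num)
  have := hd.equalizer A.continuous A'.continuous (by
    funext φ
    exact Lp.ext ((hA φ).trans (hA' φ).symm))
  exact ContinuousLinearMap.coeFn_injective this

open Classical in
/-- The bounded operator `c(y, h D_y)` in `L²(ℝ²)` (and `0` if it does not exist). -/
def opWeyl (h : ℝ) (c : ℝ × ℝ → ℂ) : L2Plane →L[ℂ] L2Plane :=
  if hA : ∃ A, IsWeyl h c A then hA.choose else 0

/-! ### The spaces `B^k(ℝ_x) ⊗ L²(ℝ_y)` -/

/-- `w = x^α D_x^β u` in the sense of distributions, with `u` and `w` in `L²(ℝ²)`. -/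
def IsXD (α β : ℕ) (u w : L2Plane) : Prop :=
  (w : 𝓢'(ℝ × ℝ, ℂ)) = TemperedDistribution.smulLeftCLM ℂ
    (fun z : ℝ × ℝ => (z.1 : ℂ) ^ α) (distDx^[β] (u : 𝓢'(ℝ × ℝ, ℂ)))

/-- `x^α D_x^β u` is unique. -/
theorem IsXD.unique {α β : ℕ} {u w w' : L2Plane} (hw : IsXD α β u w) (hw' : IsXD α β u w') :
    w = w' :=
  LinearMap.ker_eq_bot.1
    (Lp.ker_toTemperedDistributionCLM_eq_bot (F := ℂ) (μ := (volume : Measure (ℝ × ℝ))) (p := 2))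
    (hw.trans hw'.symm)

open Classical in
/-- `x^α D_x^β u` (and `0` if it does not belong to `L²(ℝ²)`). -/
def opXD (α β : ℕ) (u : L2Plane) : L2Plane :=
  if hw : ∃ w, IsXD α β u w then hw.choose else 0

/-- The pairs `(α, β)` with `α + β ≤ k`. -/
def pairsLE (k : ℕ) : Finset (ℕ × ℕ) :=
  (Finset.range (k + 1) ×ˢ Finset.range (k + 1)).filter fun p => p.1 + p.2 ≤ k

/-- `u` belongs to the Hilbert tensor product of `B^k(ℝ_x)` and `L²(ℝ_y)`, where
`B^k(ℝ) = {v ∈ L²(ℝ) : x^α D_x^β v ∈ L²(ℝ) for α + β ≤ k}`. As a subspace of `L²(ℝ²)`, it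
consists of those `u` with `x^α D_x^β u ∈ L²(ℝ²)` for `α + β ≤ k`. -/
def MemB (k : ℕ) (u : L2Plane) : Prop :=
  ∀ α β : ℕ, α + β ≤ k → ∃ w, IsXD α β u w

/-- The norm of the Hilbert tensor product of `B^k(ℝ_x)` and `L²(ℝ_y)`. -/
def normB (k : ℕ) (u : L2Plane) : ℝ :=
  √(∑ p ∈ pairsLE k, ‖opXD p.1 p.2 u‖ ^ 2)

/-- The remainder after the terms `j ≤ N`, applied to `u`:
`a(h^{1/2} x + y, h D_y - h^{1/2} D_x) u
  - ∑_{j ≤ N} h^{j/2} ∑_{k₁ + k₂ ≤ j} c_{k₁ k₂ j}(y, h D_y) x^{k₁} D_x^{k₂} u`. -/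
def remainder (h : ℝ) (a : ℝ × ℝ → ℂ) (c : ℕ → ℕ → ℕ → ℝ × ℝ → ℂ) (N : ℕ) (u : L2Plane) :
    L2Plane :=
  opA h a u - ∑ j ∈ Finset.range (N + 1), ((h ^ ((j : ℝ) / 2) : ℝ) : ℂ) •
    ∑ k ∈ pairsLE j, opWeyl h (c k.1 k.2 j) (opXD k.1 k.2 u)

end

/-! Put ε = √h and, for 0 ≤ t ≤ 1, P_t = y + tεx and Q_t = ε²D_y − tεD_x. Then [P_t, Q_t] = iε²(1 −
t²), so the unitaries exp(2πi(σP_t + τQ_t)), ζ = σ + iτ, form a Weyl system with Planck constant κ =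
ε²(1 − t²). For Schwartz b the operator Op_t(b) = ∫ b̂(ζ) exp(2πi(σP_t + τQ_t)) dζ (`opS`) is b(y,
hD_y) at t = 0. At t = 1 it is the function b of the commuting pair P_1, Q_1. The t-derivative of
σP_t + τQ_t is ε(σx − τD_x), which commutes with σP_t + τQ_t; hence d/dt Op_t(b) = ε(Op_t(∂₁b) x −
Op_t(∂₂b) D_x). Taylor's formula in t at 0, evaluated at t = 1, is the asserted expansion: every
order gains ε = h^{1/2} and costs one factor x or D_x, and the factors are normally ordered into
x^{k₁}D_x^{k₂} (`taylorS_succ`, `inner_taylorRem_succ`).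

The remainder is controlled by a Calderón–Vaillancourt bound which is uniform in κ down to κ = 0
(`exists_norm_weyl_form_le`). Commutators of x and D_x with Op_t(b) are tε times quantizations of
first derivatives of b, so the bound carries over to the weighted spaces (`exists_Bd_opS`,
`exists_Bd_taylorRem`). These spaces are handled through `Bd`, where words in x and D_x are moved
onto Schwartz test functions; its equivalence with the norm of the statement is `MemB.exists_Bd` and
`Bd.normB_le`.

Symbols in S(1) are reached by cutoffs that stay bounded in S(1) and are eventually stationary near
each point (`exists_cutoff`). All estimates depend only on symbol bounds and `Bd` is closed under
weak limits, so it remains to identify the limits. At t = 0 this is the Weyl integral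
(`exists_isWeyl_tendsto`); at t = 1 an explicit unitary diagonalizes P_1 and Q_1 jointly
(`exists_jointFunction`, `tendsto_inner_opS_opA`). Finally h^l = ε^{2l}, so the l-th term of the
semiclassical symbol is Taylor expanded only to order N + 1 − 2l (`remS_eq`). -/

/-! ### Weyl systems and the Calderón–Vaillancourt bound -/

/-! ### Gaussian-weighted matrix coefficients of a Weyl system. -/

section WeylSystem

open scoped FourierTransform

variable {H : Type*} [NormedAddCommGroup H] [InnerProductSpace ℂ H]

/-- The standard symplectic form on `ℂ = ℝ²`. -/
def sympl (ζ ζ' : ℂ) : ℝ := ζ.re * ζ'.im - ζ.im * ζ'.re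

/-- A unitary, strongly continuous projective representation of `ℂ = ℝ²` with the canonical
multiplier `exp (-2 π² i κ ω)`. -/
structure IsWeylSystem (κ : ℝ) (W : ℂ → H →L[ℂ] H) : Prop where
  norm_map : ∀ ζ u, ‖W ζ u‖ = ‖u‖
  inner_left : ∀ ζ v u, ⟪W ζ v, u⟫_ℂ = ⟪v, W (-ζ) u⟫_ℂ
  mul : ∀ ζ ζ' u, W ζ (W ζ' u) =
    Complex.exp (((-(2 * Real.pi ^ 2 * κ * sympl ζ ζ') : ℝ) : ℂ) * Complex.I) • W (ζ + ζ') u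
  cont : ∀ u, Continuous fun ζ => W ζ u

/-- The Gaussian `exp (-a |ζ|²)`. -/
noncomputable def gaussC (a : ℝ) (ζ : ℂ) : ℂ := Complex.exp (-(a : ℂ) * (‖ζ‖ : ℂ) ^ 2)

lemma continuous_gaussC (a : ℝ) : Continuous (gaussC a) := by
  unfold gaussC; fun_prop

lemma integrable_gaussC {a : ℝ} (ha : 0 < a) : Integrable (gaussC a) := by
  have := GaussianFourier.integrable_cexp_neg_mul_sq_norm_add (V := ℂ) (b := (a : ℂ))
    (by simpa using ha) 0 0
  exact this.congr (Eventually.of_forall fun ζ => by simp [gaussC])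

lemma norm_gaussC (a : ℝ) (ζ : ℂ) : ‖gaussC a ζ‖ = Real.exp (-a * ‖ζ‖ ^ 2) := by
  rw [gaussC, Complex.norm_exp]
  congr 1
  norm_cast

lemma norm_gaussC_le {a : ℝ} (ha : 0 ≤ a) (ζ : ℂ) : ‖gaussC a ζ‖ ≤ 1 := by
  rw [norm_gaussC, Real.exp_le_one_iff]
  nlinarith [sq_nonneg ‖ζ‖]

lemma conj_gaussC (a : ℝ) (ζ : ℂ) : (starRingEnd ℂ) (gaussC a ζ) = gaussC a ζ := by
  rw [gaussC, ← Complex.exp_conj]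
  simp

lemma integral_norm_gaussC {a : ℝ} (ha : 0 < a) : ∫ ζ : ℂ, ‖gaussC a ζ‖ = Real.pi / a := by
  simp_rw [norm_gaussC]
  rw [GaussianFourier.integral_rexp_neg_mul_sq_norm ha, Complex.finrank_real_complex]
  simp

/-- The symplectic form is the inner product with the rotated vector −iη, so this is the Fourier
transform of a Gaussian. The decay it produces in η is proportional to κ² and disappears at κ = 0.
-/
lemma integral_gaussC_mul_phase {l κ : ℝ} (hl : 0 < l) (η : ℂ) :
    ∫ v : ℂ, gaussC (2 * l) v *
      Complex.exp (((2 * Real.pi ^ 2 * κ * sympl v η : ℝ) : ℂ) * Complex.I)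
      = ((Real.pi / (2 * l) : ℝ) : ℂ) * gaussC (Real.pi ^ 4 * κ ^ 2 / (2 * l)) η := by
  have h := GaussianFourier.integral_cexp_neg_mul_sq_norm_add (V := ℂ) (b := ((2 * l : ℝ) : ℂ))
    (by simpa using hl) (((2 * Real.pi ^ 2 * κ : ℝ) : ℂ) * Complex.I) (-(Complex.I * η))
  rw [Complex.finrank_real_complex] at h
  convert h using 1
  · refine integral_congr_ae (Eventually.of_forall fun v => ?_)
    simp only [gaussC]
    rw [← Complex.exp_add]
    congr 1
    have : inner ℝ (-(Complex.I * η)) v = sympl v η := by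
      rw [Complex.inner, sympl]; simp
    rw [this]; push_cast; ring
  · simp only [gaussC, norm_neg, norm_mul, Complex.norm_I, one_mul]
    have hl' : (l : ℂ) ≠ 0 := by exact_mod_cast hl.ne'
    push_cast
    rw [div_self two_ne_zero, Complex.cpow_one]
    congr 2
    rw [mul_pow, Complex.I_sq]
    field_simp
    ring

/-- Parallelogram law for v − η/2 and v + η/2. -/
lemma gaussC_mul_gaussC_shift (l : ℝ) (v η : ℂ) :
    gaussC l (v + -(η / 2)) * gaussC l (v + -(η / 2) + η) = gaussC (2 * l) v * gaussC (l / 2) η := by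
  simp only [gaussC]
  rw [← Complex.exp_add, ← Complex.exp_add]
  congr 1
  have h1 : ‖v + -(η / 2)‖ ^ 2 + ‖v + -(η / 2) + η‖ ^ 2 = 2 * ‖v‖ ^ 2 + ‖η‖ ^ 2 / 2 := by
    simp only [← Complex.normSq_eq_norm_sq, Complex.normSq_apply]
    simp
    ring
  have h2 : ((‖v + -(η / 2)‖ : ℂ)) ^ 2 + (‖v + -(η / 2) + η‖ : ℂ) ^ 2
      = 2 * (‖v‖ : ℂ) ^ 2 + (‖η‖ : ℂ) ^ 2 / 2 := by exact_mod_cast h1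
  push_cast
  linear_combination (-(l : ℂ)) * h2

namespace IsWeylSystem

variable {κ : ℝ} {W : ℂ → H →L[ℂ] H} (hW : IsWeylSystem κ W)
include hW

lemma norm_inner_le (v u : H) (ζ : ℂ) : ‖⟪v, W ζ u⟫_ℂ‖ ≤ ‖v‖ * ‖u‖ := by
  simpa [hW.norm_map] using norm_inner_le_norm (𝕜 := ℂ) v (W ζ u)

lemma continuous_inner (v u : H) : Continuous fun ζ => ⟪v, W ζ u⟫_ℂ :=
  continuous_const.inner (hW.cont u)

lemma integrable_inner {g : ℂ → ℂ} (hg : Integrable g) (v u : H) :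
    Integrable fun ζ => g ζ * ⟪v, W ζ u⟫_ℂ := by
  refine hg.mul_bdd (c := ‖v‖ * ‖u‖) (hW.continuous_inner v u).aestronglyMeasurable ?_
  exact Eventually.of_forall fun ζ => hW.norm_inner_le v u ζ

lemma integrable_smul {g : ℂ → ℂ} (hg : Integrable g) (u : H) :
    Integrable fun ζ => g ζ • W ζ u := by
  refine Integrable.mono' (hg.norm.mul_const ‖u‖)
    (hg.1.smul (hW.cont u).aestronglyMeasurable) (Eventually.of_forall fun ζ => ?_)
  rw [norm_smul, hW.norm_map]


variable [CompleteSpace H]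

/-- The product of W(ζ)* and W(ζ') is W(ζ' − ζ) up to a phase, so the double integral on the left
depends on the vectors only through ⟨v, W(η)u⟩ with η = ζ' − ζ, and the remaining integral is
Gaussian. For v = u it shows that a Gaussian times ⟨u, W(·)u⟩ has a nonnegative Fourier transform;
this positivity is the source of the Calderón–Vaillancourt bound. -/
lemma inner_fourier_gauss {l : ℝ} (hl : 0 < l) (v u : H) (w : ℂ) :
    ⟪𝓕 (fun ζ => gaussC l ζ • W ζ v) w, 𝓕 (fun ζ => gaussC l ζ • W ζ u) w⟫_ℂ =
      ((Real.pi / (2 * l) : ℝ) : ℂ) *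
        𝓕 (fun η => gaussC (l / 2 + Real.pi ^ 4 * κ ^ 2 / (2 * l)) η * ⟪v, W η u⟫_ℂ) w := by
  set e : ℂ → ℂ := fun ζ => Complex.exp (((-2 * Real.pi * inner ℝ ζ w : ℝ) : ℂ) * Complex.I) with he
  have hecont : Continuous e := by
    simp only [he]; fun_prop
  have henorm : ∀ ζ, ‖e ζ‖ = 1 := fun ζ => by simp only [he]; rw [Complex.norm_exp_ofReal_mul_I]
  have hgc := continuous_gaussC l
  have hgi := integrable_gaussC hl
  let f : H → ℂ → H := fun v ζ => e ζ • gaussC l ζ • W ζ v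
  have hfc : ∀ v, Continuous (f v) := fun v => hecont.smul (hgc.smul (hW.cont v))
  have hfn : ∀ v ζ, ‖f v ζ‖ = ‖gaussC l ζ‖ * ‖v‖ := fun v ζ => by
    simp only [f, norm_smul, henorm, one_mul, hW.norm_map]
  have hfi : ∀ v, Integrable (f v) := fun v =>
    Integrable.mono' (hgi.norm.mul_const ‖v‖) (hfc v).aestronglyMeasurable
      (Eventually.of_forall fun ζ => (hfn v ζ).le)
  have hKi : Integrable (fun z : ℂ × ℂ => ⟪f v z.1, f u z.2⟫_ℂ) (volume.prod volume) := by
    refine Integrable.mono' ((hgi.norm.mul_const ‖v‖).mul_prod (hgi.norm.mul_const ‖u‖))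
      (((hfc v).comp continuous_fst).inner ((hfc u).comp continuous_snd)).aestronglyMeasurable
      (Eventually.of_forall fun z => ?_)
    refine (norm_inner_le_norm _ _).trans (le_of_eq ?_)
    rw [hfn, hfn]
  rw [Real.fourier_eq', Real.fourier_eq', Real.fourier_eq']
  change ⟪∫ ζ, f v ζ, ∫ ζ, f u ζ⟫_ℂ = _
  have step1 : ⟪∫ ζ, f v ζ, ∫ ζ, f u ζ⟫_ℂ = ∫ z : ℂ × ℂ, ⟪f v z.1, f u z.2⟫_ℂ ∂(volume.prod volume) := by
    rw [integral_prod _ hKi, ← inner_conj_symm, ← integral_inner (hfi v), ← integral_conj]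
    refine integral_congr_ae (Eventually.of_forall fun ζ => ?_)
    simp only
    rw [inner_conj_symm, integral_inner (hfi u)]
  -- The measure-preserving substitution ζ' = ζ + η; the characters then combine to the single
  -- factor e(η).
  have hshear := measurePreserving_prod_add (volume : Measure ℂ) (volume : Measure ℂ)
  have hemb : MeasurableEmbedding (fun z : ℂ × ℂ => (z.1, z.1 + z.2)) :=
    (MeasurableEquiv.shearAddRight ℂ).measurableEmbedding
  have hKi' := (hshear.integrable_comp_emb hemb).2 hKi
  rw [step1, ← hshear.integral_comp hemb]
  refine (integral_prod_symm _ hKi').trans ?_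
  rw [← integral_const_mul]
  refine integral_congr_ae (Eventually.of_forall fun η => ?_)
  simp only
  have hK : ∀ ζ' : ℂ, ⟪f v ζ', f u (ζ' + η)⟫_ℂ = e η * ⟪v, W η u⟫_ℂ *
      (gaussC l ζ' * gaussC l (ζ' + η) *
        Complex.exp (((2 * Real.pi ^ 2 * κ * sympl ζ' η : ℝ) : ℂ) * Complex.I)) := by
    intro ζ'
    simp only [f, inner_smul_left, inner_smul_right, hW.inner_left, hW.mul, conj_gaussC]
    have h1 : (starRingEnd ℂ) (e ζ') * e (ζ' + η) = e η := by
      simp only [he]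
      rw [← Complex.exp_conj, ← Complex.exp_add]
      congr 1
      rw [map_mul, Complex.conj_ofReal, Complex.conj_I, inner_add_left]
      push_cast
      ring
    have h2 : -(2 * Real.pi ^ 2 * κ * sympl (-ζ') (ζ' + η)) = 2 * Real.pi ^ 2 * κ * sympl ζ' η := by
      simp [sympl]; ring
    rw [h2, neg_add_cancel_left, ← h1]
    ring
  refine (integral_congr_ae (Eventually.of_forall hK)).trans ?_
  -- Recentring at the midpoint of ζ and ζ + η splits the product of Gaussians; the symplectic phase
  -- does not change, since sympl(η, η) = 0.
  rw [integral_const_mul, ← integral_add_right_eq_self (fun ζ' : ℂ => gaussC l ζ' *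
    gaussC l (ζ' + η) * Complex.exp (((2 * Real.pi ^ 2 * κ * sympl ζ' η : ℝ) : ℂ) * Complex.I))
    (-(η / 2))]
  have h3 : ∀ v : ℂ, sympl (v + -(η / 2)) η = sympl v η := by
    intro v; simp [sympl]; ring
  simp_rw [gaussC_mul_gaussC_shift, h3]
  have h4 : ∀ v : ℂ, gaussC (2 * l) v * gaussC (l / 2) η *
      Complex.exp (((2 * Real.pi ^ 2 * κ * sympl v η : ℝ) : ℂ) * Complex.I)
      = gaussC (l / 2) η * (gaussC (2 * l) v *
        Complex.exp (((2 * Real.pi ^ 2 * κ * sympl v η : ℝ) : ℂ) * Complex.I)) := fun v => by ring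
  simp_rw [h4]
  rw [integral_const_mul, integral_gaussC_mul_phase hl, smul_eq_mul]
  have h5 : gaussC (l / 2 + Real.pi ^ 4 * κ ^ 2 / (2 * l)) η
      = gaussC (l / 2) η * gaussC (Real.pi ^ 4 * κ ^ 2 / (2 * l)) η := by
    simp only [gaussC]
    rw [← Complex.exp_add]
    congr 1
    push_cast
    ring
  rw [h5]
  ring

end IsWeylSystem

end WeylSystem

/-! ### Positivity of Fourier transforms and the basic form bound. -/

section PositiveFourier

open scoped FourierTransform

lemma fourier_gaussC {a : ℝ} (ha : 0 < a) (w : ℂ) :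
    𝓕 (gaussC a) w = ((Real.pi / a : ℝ) : ℂ) * gaussC (Real.pi ^ 2 / a) w := by
  have h := fourier_gaussian_innerProductSpace (V := ℂ) (b := (a : ℂ)) (by simpa using ha) w
  rw [Complex.finrank_real_complex] at h
  have h2 : (fun v : ℂ => Complex.exp (-(a : ℂ) * (‖v‖ : ℂ) ^ 2)) = gaussC a := rfl
  rw [h2] at h
  rw [h, gaussC]
  push_cast
  rw [div_self two_ne_zero, Complex.cpow_one]
  congr 2
  ring

lemma continuous_fourier_of_integrable {F : ℂ → ℂ} (hF : Integrable F) : Continuous (𝓕 F) :=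
  VectorFourier.fourierIntegral_continuous Real.continuous_fourierChar
    (by exact continuous_inner) hF

lemma integral_fourier_mul_eq_flip {f g : ℂ → ℂ} (hf : Integrable f) (hg : Integrable g) :
    ∫ w, 𝓕 f w * g w = ∫ w, f w * 𝓕 g w := by
  simpa using! VectorFourier.integral_fourierIntegral_smul_eq_flip (L := innerₗ ℂ)
    Real.continuous_fourierChar continuous_inner hf hg

/-- A bounded integrable function with nonnegative Fourier transform has an integrable Fourier
transform. -/
lemma integrable_fourier_of_nonneg {F : ℂ → ℂ} (hF : Integrable F) {B : ℝ}
    (hB : ∀ ζ, ‖F ζ‖ ≤ B) {p : ℂ → ℝ} (hp : ∀ w, 0 ≤ p w) (hFp : ∀ w, 𝓕 F w = p w) :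
    Integrable p ∧ ∫ w, p w ≤ B := by
  have hB0 : 0 ≤ B := (norm_nonneg _).trans (hB 0)
  have hpc : Continuous p := by
    have h1 : p = fun w => (𝓕 F w).re := by funext w; rw [hFp, Complex.ofReal_re]
    rw [h1]
    exact Complex.continuous_re.comp (continuous_fourier_of_integrable hF)
  have hpb : ∀ w, ‖p w‖ ≤ ∫ ζ, ‖F ζ‖ := by
    intro w
    have h1 : ‖p w‖ = ‖𝓕 F w‖ := by rw [hFp]; simp
    rw [h1, Real.fourier_eq]
    refine (norm_integral_le_integral_norm _).trans (le_of_eq ?_)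
    simp
  -- Gaussian regularization: exp(−a_n|w|²) tends to 1, while its Fourier transform has L¹ norm 1
  -- for every n.
  let a : ℕ → ℝ := fun n => ((n : ℝ) + 1)⁻¹
  have ha : ∀ n, 0 < a n := fun n => by positivity
  let E : ℕ → ℂ → ℝ := fun n w => Real.exp (-a n * ‖w‖ ^ 2)
  have hE : ∀ n w, ((E n w : ℝ) : ℂ) = gaussC (a n) w := fun n w => by
    simp [E, gaussC]
  have hEint : ∀ n, Integrable (fun w => E n w * p w) := by
    intro n
    have h1 : Integrable (E n) := by
      have := (integrable_gaussC (ha n)).norm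
      simp_rw [norm_gaussC] at this
      exact this
    exact h1.mul_bdd (c := ∫ ζ, ‖F ζ‖) hpc.aestronglyMeasurable (Eventually.of_forall hpb)
  have hEle : ∀ n, ∫ w, E n w * p w ≤ B := by
    intro n
    -- The transform is moved from F onto the Gaussian, where the sup bound B on F can be used.
    have h1 : ((∫ w, E n w * p w : ℝ) : ℂ) = ∫ w, 𝓕 (gaussC (a n)) w * F w := by
      rw [integral_fourier_mul_eq_flip (integrable_gaussC (ha n)) hF, ← integral_complex_ofReal]
      refine integral_congr_ae (Eventually.of_forall fun w => ?_)
      simp only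
      rw [hFp, ← hE]
      push_cast
      rfl
    have h2 : ‖∫ w, 𝓕 (gaussC (a n)) w * F w‖ ≤ ∫ w, ‖((Real.pi / a n : ℝ) : ℂ) *
        gaussC (Real.pi ^ 2 / a n) w‖ * B := by
      refine norm_integral_le_of_norm_le ?_ (Eventually.of_forall fun w => ?_)
      · exact (((integrable_gaussC (div_pos (by positivity) (ha n))).const_mul _).norm).mul_const B
      · rw [norm_mul, fourier_gaussC (ha n)]
        exact mul_le_mul_of_nonneg_left (hB w) (norm_nonneg _)
    have h3 : ∫ w, ‖((Real.pi / a n : ℝ) : ℂ) * gaussC (Real.pi ^ 2 / a n) w‖ * B = B := by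
      rw [integral_mul_const]
      simp_rw [norm_mul]
      rw [integral_const_mul, integral_norm_gaussC (div_pos (by positivity) (ha n))]
      have := (ha n).ne'
      have hpi := Real.pi_pos
      rw [Complex.norm_real, Real.norm_of_nonneg (div_pos hpi (ha n)).le]
      field_simp
    have h4 : ‖((∫ w, E n w * p w : ℝ) : ℂ)‖ ≤ B := by rw [h1]; exact h2.trans h3.le
    rw [Complex.norm_real] at h4
    exact (le_abs_self _).trans h4
  have ha0 : Tendsto a atTop (𝓝 0) := by
    simpa [a, one_div] using tendsto_one_div_add_atTop_nhds_zero_nat (𝕜 := ℝ)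
  have hlim : ∀ w, Tendsto (fun n => ENNReal.ofReal (E n w * p w)) atTop
      (𝓝 (ENNReal.ofReal (p w))) := by
    intro w
    refine ENNReal.tendsto_ofReal ?_
    have h1 : Tendsto (fun n => E n w) atTop (𝓝 (Real.exp (-0 * ‖w‖ ^ 2))) :=
      (Real.continuous_exp.tendsto _).comp ((ha0.neg).mul_const _)
    simpa using h1.mul_const (p w)
  -- Fatou's lemma applies because p ≥ 0; integrability of p is a conclusion here and could not be
  -- used for dominated convergence.
  have hfatou : ∫⁻ w, ENNReal.ofReal (p w) ≤ ENNReal.ofReal B := by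
    calc ∫⁻ w, ENNReal.ofReal (p w)
        = ∫⁻ w, liminf (fun n => ENNReal.ofReal (E n w * p w)) atTop :=
          lintegral_congr fun w => (hlim w).liminf_eq.symm
      _ ≤ liminf (fun n => ∫⁻ w, ENNReal.ofReal (E n w * p w)) atTop :=
          lintegral_liminf_le fun n => ENNReal.measurable_ofReal.comp
            (Measurable.mul (by simp only [E]; fun_prop) hpc.measurable)
      _ ≤ ENNReal.ofReal B := by
          refine liminf_le_of_le (by isBoundedDefault) fun b hb => ?_
          obtain ⟨n, hn⟩ := hb.exists
          refine hn.trans ?_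
          rw [← ofReal_integral_eq_lintegral_ofReal (hEint n)
            (Eventually.of_forall fun w => mul_nonneg (Real.exp_pos _).le (hp w))]
          exact ENNReal.ofReal_le_ofReal (hEle n)
  have hint : Integrable p := by
    refine ⟨hpc.aestronglyMeasurable, ?_⟩
    rw [hasFiniteIntegral_iff_ofReal (Eventually.of_forall hp)]
    exact hfatou.trans_lt ENNReal.ofReal_lt_top
  refine ⟨hint, ?_⟩
  rw [← ofReal_integral_eq_lintegral_ofReal hint (Eventually.of_forall hp)] at hfatou
  exact (ENNReal.ofReal_le_ofReal_iff hB0).1 hfatou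

namespace IsWeylSystem

variable {H : Type*} [NormedAddCommGroup H] [InnerProductSpace ℂ H] [CompleteSpace H]
variable {κ : ℝ} {W : ℂ → H →L[ℂ] H} (hW : IsWeylSystem κ W)
include hW

/-- Symbols of the form `k * Gaussian` on the Fourier side are bounded by the supremum of the
inverse Fourier transform of `k`. -/
lemma norm_integral_gauss_le {l μ : ℝ} (hl : 0 < l)
    (hμ : μ = l / 2 + Real.pi ^ 4 * κ ^ 2 / (2 * l)) {k : ℂ → ℂ} (hk : Integrable k) {B : ℝ}
    (hB : ∀ w, ‖𝓕⁻ k w‖ ≤ B) (v u : H) :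
    ‖∫ ζ, k ζ * (gaussC μ ζ * ⟪v, W ζ u⟫_ℂ)‖ ≤ B * ((‖v‖ ^ 2 + ‖u‖ ^ 2) / 2) := by
  have hB0 : 0 ≤ B := (norm_nonneg _).trans (hB 0)
  have hμ0 : 0 < μ := by rw [hμ]; positivity
  have hpi := Real.pi_pos
  let X : H → ℂ → H := fun u w => 𝓕 (fun ζ => gaussC l ζ • W ζ u) w
  let F : H → H → ℂ → ℂ := fun v u ζ => gaussC μ ζ * ⟪v, W ζ u⟫_ℂ
  have hX : ∀ v u w, 𝓕 (F v u) w = ((2 * l / Real.pi : ℝ) : ℂ) * ⟪X v w, X u w⟫_ℂ := by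
    intro v u w
    have h1 := hW.inner_fourier_gauss hl v u w
    rw [← hμ] at h1
    change ⟪X v w, X u w⟫_ℂ = _ * 𝓕 (F v u) w at h1
    rw [h1, ← mul_assoc, ← Complex.ofReal_mul]
    have h2 : 2 * l / Real.pi * (Real.pi / (2 * l)) = 1 := by field_simp
    rw [h2]; simp
  have hFi : ∀ v u, Integrable (F v u) := fun v u => hW.integrable_inner (integrable_gaussC hμ0) v u
  have hFc : ∀ v u, Continuous (F v u) := fun v u =>
    (continuous_gaussC μ).mul (hW.continuous_inner v u)
  -- On the diagonal the transform of F u u is a positive multiple of ‖X u w‖², and |F u u| ≤ ‖u‖²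
  -- bounds its total mass.
  have hpos : ∀ u, Integrable (fun w => 2 * l / Real.pi * ‖X u w‖ ^ 2) ∧
      ∫ w, 2 * l / Real.pi * ‖X u w‖ ^ 2 ≤ ‖u‖ ^ 2 := by
    intro u
    refine integrable_fourier_of_nonneg (hFi u u) (fun ζ => ?_) (fun w => by positivity)
      (fun w => ?_)
    · rw [norm_mul, pow_two]
      calc _ ≤ 1 * (‖u‖ * ‖u‖) := mul_le_mul (norm_gaussC_le hμ0.le ζ) (hW.norm_inner_le u u ζ)
            (norm_nonneg _) zero_le_one
        _ = _ := one_mul _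
    · rw [hX, inner_self_eq_norm_sq_to_K]
      push_cast
      rfl
  have hdom : ∀ w, ‖𝓕 (F v u) w‖ ≤
      (2 * l / Real.pi * ‖X v w‖ ^ 2 + 2 * l / Real.pi * ‖X u w‖ ^ 2) / 2 := by
    intro w
    rw [hX, norm_mul, Complex.norm_real, Real.norm_of_nonneg (by positivity)]
    have h1 := norm_inner_le_norm (𝕜 := ℂ) (X v w) (X u w)
    have h2 : 0 < 2 * l / Real.pi := by positivity
    nlinarith [sq_nonneg (‖X v w‖ - ‖X u w‖)]
  have hGi : Integrable (𝓕 (F v u)) :=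
    Integrable.mono' (((hpos v).1.add (hpos u).1).div_const 2)
      (continuous_fourier_of_integrable (hFi v u)).aestronglyMeasurable (Eventually.of_forall hdom)
  have hinv : ∀ ζ, F v u ζ = 𝓕 (𝓕 (F v u)) (-ζ) := by
    intro ζ
    rw [← Real.fourierInv_eq_fourier_neg, (hFc v u).fourierInv_fourier_eq (hFi v u) hGi]
  -- Parseval: only the supremum of the inverse transform of k enters, against the integrable
  -- transform of F v u.
  have hswap : ∫ ζ, k ζ * F v u ζ = ∫ w, 𝓕⁻ k w * 𝓕 (F v u) w := by
    have h1 := integral_fourier_mul_eq_flip (hk.comp_neg) hGi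
    have h2 : ∫ ζ, k ζ * F v u ζ = ∫ ζ, k (-ζ) * 𝓕 (𝓕 (F v u)) ζ := by
      rw [← integral_neg_eq_self]
      refine integral_congr_ae (Eventually.of_forall fun ζ => ?_)
      simp only
      rw [hinv (-ζ), neg_neg]
    rw [h2, ← h1, Real.fourierInv_eq_fourier_comp_neg]
  change ‖∫ ζ, k ζ * F v u ζ‖ ≤ _
  rw [hswap]
  calc ‖∫ w, 𝓕⁻ k w * 𝓕 (F v u) w‖
      ≤ ∫ w, B * ((2 * l / Real.pi * ‖X v w‖ ^ 2 + 2 * l / Real.pi * ‖X u w‖ ^ 2) / 2) := by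
        refine norm_integral_le_of_norm_le
          ((((hpos v).1.add (hpos u).1).div_const 2).const_mul B) (Eventually.of_forall fun w => ?_)
        rw [norm_mul]
        exact mul_le_mul (hB w) (hdom w) (norm_nonneg _) hB0
    _ = B * ((∫ w, 2 * l / Real.pi * ‖X v w‖ ^ 2) + ∫ w, 2 * l / Real.pi * ‖X u w‖ ^ 2) / 2 := by
        rw [integral_const_mul, integral_div, integral_add (hpos v).1 (hpos u).1]
        ring
    _ ≤ _ := by
        rw [mul_div_assoc]
        have := (hpos v).2
        have := (hpos u).2
        gcongr

end IsWeylSystem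

end PositiveFourier

/-! ### The uniform Calderón–Vaillancourt theorem. -/

section CalderonVaillancourt

open scoped FourierTransform

/-- The operator `(2πi)⁻¹ (∂₁ + i ∂₂)` on Schwartz functions on `ℂ`. -/
noncomputable def dbarC (b : 𝓢(ℂ, ℂ)) : 𝓢(ℂ, ℂ) :=
  (2 * Real.pi * Complex.I : ℂ)⁻¹ • (∂_{(1 : ℂ)} b + Complex.I • ∂_{Complex.I} b)

lemma fourier_dbarC (b : 𝓢(ℂ, ℂ)) (ζ : ℂ) : 𝓕 (dbarC b) ζ = ζ * 𝓕 b ζ := by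
  have h : ∀ m : ℂ, 𝓕 (∂_{m} b) ζ = (2 * Real.pi * Complex.I) * ((inner ℝ ζ m : ℝ) * 𝓕 b ζ) := by
    intro m
    rw [SchwartzMap.fourier_lineDerivOp_eq]
    have : (fun x : ℂ => inner ℝ x m).HasTemperateGrowth := by fun_prop
    simp only [smul_apply, SchwartzMap.smulLeftCLM_apply_apply this, smul_eq_mul,
      Complex.real_smul]
  have hpi : (Real.pi : ℂ) ≠ 0 := by exact_mod_cast Real.pi_ne_zero
  rw [dbarC, FourierTransform.fourier_smul, FourierTransform.fourier_add,
    FourierTransform.fourier_smul]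
  simp only [smul_apply, add_apply, h, smul_eq_mul]
  have h1 : inner ℝ ζ 1 = ζ.re := by simp [Complex.inner]
  have h2 : inner ℝ ζ Complex.I = ζ.im := by simp [Complex.inner]
  rw [h1, h2]
  generalize 𝓕 b ζ = F
  conv_rhs => rw [← Complex.re_add_im ζ]
  field_simp

lemma fourier_dbarC_iterate (b : 𝓢(ℂ, ℂ)) (i : ℕ) (ζ : ℂ) :
    𝓕 (dbarC^[i] b) ζ = ζ ^ i * 𝓕 b ζ := by
  induction i with
  | zero => simp
  | succ i ih => rw [Function.iterate_succ_apply', fourier_dbarC, ih]; ring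

/-- Moving the Fourier transform off b gives the integral of b against a translate of the transform
of θ times a unimodular factor, so the bound is uniform in m and w. -/
lemma norm_shortTime_le {b : 𝓢(ℂ, ℂ)} {B : ℝ} (hB : ∀ z, ‖b z‖ ≤ B) (θ : 𝓢(ℂ, ℂ)) (m w : ℂ) :
    ‖𝓕⁻ (fun ζ => 𝓕 b (ζ + m) * θ ζ) w‖ ≤ B * ∫ z, ‖𝓕 θ z‖ := by
  let θ' : ℂ → ℂ := fun ζ =>
    Complex.exp (((2 * Real.pi * inner ℝ (ζ - m) w : ℝ) : ℂ) * Complex.I) * θ (ζ - m)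
  have hθ' : Integrable θ' := by
    refine (θ.integrable.comp_sub_right m).bdd_mul (c := 1) ?_ (Eventually.of_forall fun ζ => ?_)
    · exact Continuous.aestronglyMeasurable (by fun_prop)
    · rw [Complex.norm_exp_ofReal_mul_I]
  have h1 : 𝓕⁻ (fun ζ => 𝓕 b (ζ + m) * θ ζ) w = ∫ ζ, 𝓕 (b : ℂ → ℂ) ζ * θ' ζ := by
    rw [Real.fourierInv_eq', ← integral_add_right_eq_self (fun ζ => 𝓕 (b : ℂ → ℂ) ζ * θ' ζ) m]
    refine integral_congr_ae (Eventually.of_forall fun ζ => ?_)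
    simp only [θ', add_sub_cancel_right, smul_eq_mul]
    rw [← SchwartzMap.fourier_coe]
    ring
  have h2 : ∀ z, ‖𝓕 θ' z‖ = ‖𝓕 θ (z - w)‖ := by
    intro z
    rw [SchwartzMap.fourier_coe, Real.fourier_eq', Real.fourier_eq',
      ← integral_add_right_eq_self _ m]
    have : ∀ ζ : ℂ, Complex.exp (((-2 * Real.pi * inner ℝ (ζ + m) z : ℝ) : ℂ) * Complex.I) •
        θ' (ζ + m) = Complex.exp (((-2 * Real.pi * inner ℝ m z : ℝ) : ℂ) * Complex.I) *
        (Complex.exp (((-2 * Real.pi * inner ℝ ζ (z - w) : ℝ) : ℂ) * Complex.I) • θ ζ) := by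
      intro ζ
      simp only [θ', add_sub_cancel_right, smul_eq_mul]
      rw [← mul_assoc, ← mul_assoc, ← Complex.exp_add, ← Complex.exp_add]
      congr 2
      rw [inner_add_left, inner_sub_right]
      push_cast
      ring
    simp_rw [this]
    rw [integral_const_mul, norm_mul, Complex.norm_exp_ofReal_mul_I, one_mul]
  rw [h1, integral_fourier_mul_eq_flip b.integrable hθ']
  calc ‖∫ z, b z * 𝓕 θ' z‖ ≤ ∫ z, B * ‖𝓕 θ (z - w)‖ := by
        refine norm_integral_le_of_norm_le (((𝓕 θ).integrable.comp_sub_right w).norm.const_mul B)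
          (Eventually.of_forall fun z => ?_)
        rw [norm_mul, h2]
        exact mul_le_mul_of_nonneg_right (hB z) (norm_nonneg _)
    _ = B * ∫ z, ‖𝓕 θ z‖ := by
        rw [integral_const_mul, integral_sub_right_eq_self (fun z => ‖𝓕 θ z‖) w]

/-- Expand m³ = ((ζ + m) − ζ)³ under the integral. Powers of ζ + m become `dbarC`-derivatives of b,
powers of ζ are absorbed in the window. Working with complex numbers, one first-order operator
suffices instead of two partial derivatives. The exponent 3 is the first integer that makes the
decay integrable over the plane. -/
lemma exists_shortTime_decay (ψ : ℕ → 𝓢(ℂ, ℂ)) (hψ : ∀ i ζ, ψ i ζ = ζ ^ i * ψ 0 ζ) :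
    ∃ C : ℝ, 0 ≤ C ∧ ∀ (b : 𝓢(ℂ, ℂ)) (M : ℝ), (∀ i ≤ 3, ∀ z, ‖(dbarC^[i] b) z‖ ≤ M) →
      ∀ m w : ℂ, ‖𝓕⁻ (fun ζ => 𝓕 b (ζ + m) * ψ 0 ζ) w‖ ≤ C * M * (1 + ‖m‖) ^ (-3 : ℝ) := by
  let c : ℕ → ℝ := fun i => ∫ z, ‖𝓕 (ψ i) z‖
  have hc : ∀ i, 0 ≤ c i := fun i => integral_nonneg fun z => norm_nonneg _
  refine ⟨4 * (c 0 + ((c 3 + 3 * c 2) + (3 * c 1 + c 0))), by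
    have := hc 0; have := hc 1; have := hc 2; have := hc 3; positivity, fun b M hM m w => ?_⟩
  have hM0 : 0 ≤ M := (norm_nonneg _).trans (hM 0 (by norm_num) 0)
  set β := 𝓕⁻ (fun ζ => 𝓕 b (ζ + m) * ψ 0 ζ) w with hβ
  let t : ℕ → ℂ := fun i => 𝓕⁻ (fun ζ => 𝓕 (dbarC^[i] b) (ζ + m) * ψ (3 - i) ζ) w
  have ht : ∀ i ≤ 3, ‖t i‖ ≤ M * c (3 - i) := fun i hi =>
    norm_shortTime_le (hM i hi) (ψ (3 - i)) m w
  have h0 : ‖β‖ ≤ M * c 0 := norm_shortTime_le (hM 0 (by norm_num)) (ψ 0) m w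
  have hi : ∀ i, Integrable (fun ζ => Complex.exp (((2 * Real.pi * inner ℝ ζ w : ℝ) : ℂ) *
      Complex.I) • (𝓕 (dbarC^[i] b) (ζ + m) * ψ (3 - i) ζ)) := by
    intro i
    obtain ⟨B, hB⟩ : ∃ B, ∀ z, ‖𝓕 (dbarC^[i] b) z‖ ≤ B :=
      ⟨_, fun z => SchwartzMap.norm_le_seminorm ℝ (𝓕 (dbarC^[i] b)) z⟩
    refine Integrable.bdd_mul (c := 1) ((ψ (3 - i)).integrable.bdd_mul (c := B) ?_
      (Eventually.of_forall fun z => hB _)) (Continuous.aestronglyMeasurable (by fun_prop))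
      (Eventually.of_forall fun ζ => by rw [Complex.norm_exp_ofReal_mul_I])
    exact ((SchwartzMap.continuous _).comp (continuous_add_const m)).aestronglyMeasurable
  have key : m ^ 3 * β = t 3 - 3 * t 2 + 3 * t 1 - t 0 := by
    let J : ℕ → ℂ → ℂ := fun i ζ => Complex.exp (((2 * Real.pi * inner ℝ ζ w : ℝ) : ℂ) *
      Complex.I) • (𝓕 (dbarC^[i] b) (ζ + m) * ψ (3 - i) ζ)
    have htJ : ∀ i, t i = ∫ ζ, J i ζ := fun i => Real.fourierInv_eq' _ _
    have i0 : Integrable fun ζ => J 0 ζ := hi 0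
    have i1 : Integrable fun ζ => 3 * J 1 ζ := (hi 1).const_mul 3
    have i2 : Integrable fun ζ => 3 * J 2 ζ := (hi 2).const_mul 3
    have i3 : Integrable fun ζ => J 3 ζ := hi 3
    have i32 : Integrable fun ζ => J 3 ζ - 3 * J 2 ζ := i3.sub i2
    have i321 : Integrable fun ζ => J 3 ζ - 3 * J 2 ζ + 3 * J 1 ζ := i32.add i1
    rw [htJ, htJ, htJ, htJ, ← integral_const_mul, ← integral_const_mul, ← integral_sub i3 i2,
      ← integral_add i32 i1, ← integral_sub i321 i0, hβ, Real.fourierInv_eq', ← integral_const_mul]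
    refine integral_congr_ae (Eventually.of_forall fun ζ => ?_)
    simp only [J, fourier_dbarC_iterate, smul_eq_mul]
    rw [hψ (3 - 3), hψ (3 - 2), hψ (3 - 1), hψ (3 - 0)]
    norm_num
    ring
  have hm3 : ‖m‖ ^ 3 * ‖β‖ ≤ M * ((c 3 + 3 * c 2) + (3 * c 1 + c 0)) := by
    rw [← norm_pow, ← norm_mul, key]
    have e0 := ht 0 (by norm_num)
    have e1 := ht 1 (by norm_num)
    have e2 := ht 2 (by norm_num)
    have e3 := ht 3 (by norm_num)
    norm_num at e0 e1 e2 e3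
    calc ‖t 3 - 3 * t 2 + 3 * t 1 - t 0‖ ≤ ‖t 3‖ + ‖3 * t 2‖ + ‖3 * t 1‖ + ‖t 0‖ :=
          (norm_sub_le _ _).trans (add_le_add_left ((norm_add_le _ _).trans
            (add_le_add_left (norm_sub_le _ _) _)) _)
      _ = ‖t 3‖ + 3 * ‖t 2‖ + 3 * ‖t 1‖ + ‖t 0‖ := by simp
      _ ≤ _ := by linarith
  have hpow : (1 + ‖m‖) ^ (-3 : ℝ) = ((1 + ‖m‖) ^ 3)⁻¹ := by
    rw [Real.rpow_neg (by positivity)]; norm_cast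
  rw [hpow, ← div_eq_mul_inv, le_div_iff₀ (by positivity)]
  have h4 : (1 + ‖m‖) ^ 3 ≤ 4 * (1 + ‖m‖ ^ 3) := by
    nlinarith [norm_nonneg m, mul_nonneg (norm_nonneg m) (sq_nonneg (‖m‖ - 1)),
      sq_nonneg (‖m‖ - 1)]
  calc ‖β‖ * (1 + ‖m‖) ^ 3 ≤ ‖β‖ * (4 * (1 + ‖m‖ ^ 3)) :=
        mul_le_mul_of_nonneg_left h4 (norm_nonneg _)
    _ = 4 * (‖β‖ + ‖m‖ ^ 3 * ‖β‖) := by ring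
    _ ≤ 4 * (M * c 0 + M * ((c 3 + 3 * c 2) + (3 * c 1 + c 0))) := by linarith
    _ = _ := by ring

/-- A compactly supported approximate identity `G` on `ℂ`, divided by a Gaussian, together with
its products with powers. -/
lemma exists_window (μ : ℝ) : ∃ (G : ℂ → ℂ) (ψ : ℕ → 𝓢(ℂ, ℂ)), Integrable G ∧ (∫ ζ, G ζ = 1) ∧
    (∀ ζ, G (-ζ) = G ζ) ∧ (∀ ζ, G ζ = ψ 0 ζ * gaussC μ ζ) ∧ ∀ i ζ, ψ i ζ = ζ ^ i * ψ 0 ζ := by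
  let f : ContDiffBump (0 : ℂ) := ⟨1, 2, by norm_num, by norm_num⟩
  -- Compact support permits division by the Gaussian, that is, multiplication by exp(μ|ζ|²).
  let g : ℕ → ℂ → ℂ := fun i ζ =>
    ζ ^ i * (((f.normed volume ζ : ℝ) : ℂ) * Complex.exp ((μ : ℂ) * ((‖ζ‖ ^ 2 : ℝ) : ℂ)))
  have hfs : HasCompactSupport (fun ζ => ((f.normed volume ζ : ℝ) : ℂ)) :=
    f.hasCompactSupport_normed.comp_left (g := fun x : ℝ => (x : ℂ)) (by simp)
  have hs : ∀ i, HasCompactSupport (g i) := fun i => (hfs.mul_right).mul_left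
  have hfd : ContDiff ℝ ∞ (fun ζ => ((f.normed volume ζ : ℝ) : ℂ)) :=
    Complex.ofRealCLM.contDiff.comp (f.contDiff_normed (n := ⊤))
  have hd : ∀ i, ContDiff ℝ ∞ (g i) := by
    intro i
    refine (contDiff_id.pow i).mul (hfd.mul (ContDiff.cexp (contDiff_const.mul ?_)))
    exact Complex.ofRealCLM.contDiff.comp (contDiff_norm_sq ℝ)
  refine ⟨fun ζ => ((f.normed volume ζ : ℝ) : ℂ), fun i => (hs i).toSchwartzMap (hd i),
    f.integrable_normed.ofReal, ?_, fun ζ => ?_, fun ζ => ?_, fun i ζ => ?_⟩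
  · rw [integral_complex_ofReal, f.integral_normed]; simp
  · simp only [f.normed_neg]
  · change _ = g 0 ζ * _
    simp only [g, pow_zero, one_mul, gaussC]
    rw [mul_assoc, ← Complex.exp_add]
    push_cast
    simp
  · change g i ζ = ζ ^ i * g 0 ζ
    simp [g]

/-- Normalize both vectors; homogeneity under real scalars is all that this needs. -/
lemma norm_form_le_of_sq {H : Type*} [NormedAddCommGroup H] [InnerProductSpace ℂ H]
    {T : H → H → ℂ} (hl : ∀ (c : ℝ) v u, T (c • v) u = c * T v u)
    (hr : ∀ (c : ℝ) v u, T v (c • u) = c * T v u) {C : ℝ}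
    (hT : ∀ v u, ‖T v u‖ ≤ C * ((‖v‖ ^ 2 + ‖u‖ ^ 2) / 2)) (v u : H) :
    ‖T v u‖ ≤ C * (‖v‖ * ‖u‖) := by
  rcases eq_or_ne v 0 with rfl | hv
  · have := hl 0 0 u
    simp at this
    simp [this]
  rcases eq_or_ne u 0 with rfl | hu
  · have := hr 0 v 0
    simp at this
    simp [this]
  have hv' := norm_pos_iff.2 hv
  have hu' := norm_pos_iff.2 hu
  have h := hT ((‖v‖⁻¹ : ℝ) • v) ((‖u‖⁻¹ : ℝ) • u)
  rw [hl, hr, norm_smul, norm_smul, norm_mul, norm_mul] at h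
  simp only [Complex.norm_real, norm_inv, norm_norm] at h
  rw [inv_mul_cancel₀ hv'.ne', inv_mul_cancel₀ hu'.ne'] at h
  field_simp at h
  linarith

/-- **Calderón–Vaillancourt theorem** for Weyl systems, uniformly in the Planck constant. -/
theorem exists_norm_weyl_form_le (H : Type*) [NormedAddCommGroup H] [InnerProductSpace ℂ H]
    [CompleteSpace H] (K : ℝ) :
    ∃ C : ℝ, 0 ≤ C ∧ ∀ κ : ℝ, |κ| ≤ K → ∀ W : ℂ → H →L[ℂ] H, IsWeylSystem κ W →
      ∀ (b : 𝓢(ℂ, ℂ)) (M : ℝ), (∀ i ≤ 3, ∀ z, ‖(dbarC^[i] b) z‖ ≤ M) → ∀ v u : H,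
        ‖∫ ζ, 𝓕 b ζ * ⟪v, W ζ u⟫_ℂ‖ ≤ C * M * (‖v‖ * ‖u‖) := by
  have hpi := Real.pi_pos
  -- By the inequality of the means, μ = l/2 + π⁴κ²/(2l) is solvable for l > 0 as soon as μ ≥ π²|κ|
  -- and μ > 0. This μ serves all |κ| ≤ K, so the window and the constant do not depend on κ.
  set μ : ℝ := Real.pi ^ 2 * (|K| + 1) with hμ
  have hμ0 : 0 < μ := by positivity
  obtain ⟨G, ψ, hGi, hG1, hGneg, hGψ, hψ⟩ := exists_window μ
  obtain ⟨C, hC0, hC⟩ := exists_shortTime_decay ψ hψ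
  have hdec : Integrable (fun m : ℂ => (1 + ‖m‖) ^ (-3 : ℝ)) :=
    integrable_one_add_norm (by rw [Complex.finrank_real_complex]; norm_num)
  refine ⟨C * ∫ m : ℂ, (1 + ‖m‖) ^ (-3 : ℝ),
    mul_nonneg hC0 (integral_nonneg fun m => by positivity), fun κ hκ W hW b M hM => ?_⟩
  have hM0 : 0 ≤ M := (norm_nonneg _).trans (hM 0 (by norm_num) 0)
  obtain ⟨l, hl, hlμ⟩ : ∃ l : ℝ, 0 < l ∧ μ = l / 2 + Real.pi ^ 4 * κ ^ 2 / (2 * l) := by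
    have h1 : 0 ≤ μ ^ 2 - Real.pi ^ 4 * κ ^ 2 := by
      have h2 : κ ^ 2 ≤ (|K| + 1) ^ 2 := by
        rw [← sq_abs κ]
        have := le_abs_self K
        gcongr
        linarith
      have : μ ^ 2 = Real.pi ^ 4 * (|K| + 1) ^ 2 := by rw [hμ]; ring
      rw [this]
      nlinarith [pow_pos hpi 4]
    have hs := Real.sq_sqrt h1
    have hs0 := Real.sqrt_nonneg (μ ^ 2 - Real.pi ^ 4 * κ ^ 2)
    -- The larger root of l² − 2μl + π⁴κ² = 0, which stays positive at κ = 0.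
    refine ⟨μ + √(μ ^ 2 - Real.pi ^ 4 * κ ^ 2), by linarith, ?_⟩
    have : 0 < μ + √(μ ^ 2 - Real.pi ^ 4 * κ ^ 2) := by linarith
    field_simp
    nlinarith
  refine norm_form_le_of_sq (T := fun v u => ∫ ζ, 𝓕 b ζ * ⟪v, W ζ u⟫_ℂ) ?_ ?_ ?_
  · intro c v u
    rw [← integral_const_mul]
    refine integral_congr_ae (Eventually.of_forall fun ζ => ?_)
    simp only [← Complex.coe_smul, inner_smul_left, Complex.conj_ofReal]
    ring
  · intro c v u
    rw [← integral_const_mul]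
    refine integral_congr_ae (Eventually.of_forall fun ζ => ?_)
    simp only [← Complex.coe_smul, map_smul, inner_smul_right]
    ring
  intro v u
  set f : 𝓢(ℂ, ℂ) := 𝓕 b with hf
  have hfi : Integrable (fun ζ => f ζ * ⟪v, W ζ u⟫_ℂ) := hW.integrable_inner (𝓕 b).integrable v u
  have hconv : Integrable (fun p : ℂ × ℂ => (f p.2 * ⟪v, W p.2 u⟫_ℂ) * G (p.1 - p.2))
      (volume.prod volume) :=
    Integrable.convolution_integrand (ContinuousLinearMap.mul ℝ ℂ) hfi hGi
  -- Partition of the Fourier side: insert ∫ G(m − ζ) dm = 1, exchange the integrals and translate ζ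
  -- by m.
  have hrep : ∫ ζ, f ζ * ⟪v, W ζ u⟫_ℂ = ∫ m : ℂ, ∫ ζ, f (ζ + m) * ψ 0 ζ *
      (gaussC μ ζ * ⟪W (-(m / 2)) v, W ζ (W (m / 2) u)⟫_ℂ) := by
    have h1 : ∫ ζ, f ζ * ⟪v, W ζ u⟫_ℂ = ∫ ζ, ∫ m, (f ζ * ⟪v, W ζ u⟫_ℂ) * G (m - ζ) := by
      refine integral_congr_ae (Eventually.of_forall fun ζ => ?_)
      simp only
      rw [integral_const_mul, integral_sub_right_eq_self G ζ, hG1, mul_one]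
    rw [h1, integral_integral_swap (f := fun ζ m => (f ζ * ⟪v, W ζ u⟫_ℂ) * G (m - ζ)) hconv.swap]
    refine integral_congr_ae (Eventually.of_forall fun m => ?_)
    simp only
    rw [← integral_add_right_eq_self _ m]
    refine integral_congr_ae (Eventually.of_forall fun ζ => ?_)
    simp only
    have h2 : m - (ζ + m) = -ζ := by ring
    -- In the symmetric product W(m/2)W(ζ)W(m/2) the two phases cancel. The translation thus acts on
    -- the vectors, whose norms it preserves.
    have h3 : ⟪W (-(m / 2)) v, W ζ (W (m / 2) u)⟫_ℂ = ⟪v, W (ζ + m) u⟫_ℂ := by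
      rw [hW.inner_left, neg_neg, hW.mul ζ, map_smul, hW.mul, smul_smul, ← Complex.exp_add]
      have h4 : sympl ζ (m / 2) + sympl (m / 2) (ζ + m / 2) = 0 := by
        simp [sympl]; ring
      have h5 : m / 2 + (ζ + m / 2) = ζ + m := by ring
      rw [h5]
      have h6 : ((-(2 * Real.pi ^ 2 * κ * sympl ζ (m / 2)) : ℝ) : ℂ) * Complex.I +
          ((-(2 * Real.pi ^ 2 * κ * sympl (m / 2) (ζ + m / 2)) : ℝ) : ℂ) * Complex.I = 0 := by
        rw [← add_mul, ← Complex.ofReal_add]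
        have : -(2 * Real.pi ^ 2 * κ * sympl ζ (m / 2)) +
          -(2 * Real.pi ^ 2 * κ * sympl (m / 2) (ζ + m / 2)) = 0 := by
          linear_combination (-(2 * Real.pi ^ 2 * κ)) * h4
        rw [this]; simp
      rw [h6]; simp
    rw [h2, h3, hGneg, hGψ]
    ring
  rw [hrep]
  calc _ ≤ ∫ m : ℂ, (C * M * (1 + ‖m‖) ^ (-3 : ℝ)) * ((‖v‖ ^ 2 + ‖u‖ ^ 2) / 2) := by
        refine norm_integral_le_of_norm_le ((hdec.const_mul _).mul_const _)
          (Eventually.of_forall fun m => ?_)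
        have hk : Integrable fun ζ => f (ζ + m) * ψ 0 ζ := by
          refine (ψ 0).integrable.bdd_mul (c := SchwartzMap.seminorm ℝ 0 0 (𝓕 b)) ?_
            (Eventually.of_forall fun z => SchwartzMap.norm_le_seminorm ℝ (𝓕 b) _)
          exact ((SchwartzMap.continuous (𝓕 b)).comp (continuous_add_const m)).aestronglyMeasurable
        have := hW.norm_integral_gauss_le hl hlμ hk (fun w => hC b M hM m w)
          (W (-(m / 2)) v) (W (m / 2) u)
        rwa [hW.norm_map, hW.norm_map] at this
    _ = _ := by
        rw [integral_mul_const, integral_const_mul]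
        ring

end CalderonVaillancourt

/-! ### Phase space translations of L²(ℝ²) and the family P_t, Q_t. -/

section PhaseTranslation

lemma hasTemperateGrowth_cexp_ofReal_mul_I :
    (fun r : ℝ => Complex.exp ((r : ℂ) * Complex.I)).HasTemperateGrowth := by
  have hd : ∀ r : ℝ, HasDerivAt (fun r : ℝ => Complex.exp ((r : ℂ) * Complex.I))
      (Complex.I * Complex.exp ((r : ℂ) * Complex.I)) r := by
    intro r
    have h1 : HasDerivAt (fun r : ℝ => (r : ℂ) * Complex.I) (1 * Complex.I) r :=
      (Complex.ofRealCLM.hasDerivAt (x := r)).mul_const Complex.I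
    have := h1.cexp
    rwa [one_mul, mul_comm] at this
  have hi : ∀ n : ℕ, iteratedDeriv n (fun r : ℝ => Complex.exp ((r : ℂ) * Complex.I))
      = fun r : ℝ => Complex.I ^ n * Complex.exp ((r : ℂ) * Complex.I) := by
    intro n
    induction n with
    | zero => simp [iteratedDeriv_zero]
    | succ n ih =>
      rw [iteratedDeriv_succ, ih]
      funext r
      rw [((hd r).const_mul (Complex.I ^ n)).deriv]
      ring
  refine ⟨(Complex.ofRealCLM.contDiff.mul contDiff_const).cexp, fun n => ⟨0, 1, fun r => ?_⟩⟩
  rw [norm_iteratedFDeriv_eq_norm_iteratedDeriv, hi]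
  simp [Complex.norm_exp_ofReal_mul_I]

/-- The unimodular function `exp (i (θ + l · z))`. -/
noncomputable def phaseFun (θ : ℝ) (l z : ℝ × ℝ) : ℂ :=
  Complex.exp (((θ + l.1 * z.1 + l.2 * z.2 : ℝ) : ℂ) * Complex.I)

lemma norm_phaseFun (θ : ℝ) (l z : ℝ × ℝ) : ‖phaseFun θ l z‖ = 1 :=
  Complex.norm_exp_ofReal_mul_I _

lemma hasTemperateGrowth_fst : (fun z : ℝ × ℝ => z.1).HasTemperateGrowth :=
  (ContinuousLinearMap.fst ℝ ℝ ℝ).hasTemperateGrowth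

lemma hasTemperateGrowth_snd : (fun z : ℝ × ℝ => z.2).HasTemperateGrowth :=
  (ContinuousLinearMap.snd ℝ ℝ ℝ).hasTemperateGrowth

lemma hasTemperateGrowth_phaseFun (θ : ℝ) (l : ℝ × ℝ) : (phaseFun θ l).HasTemperateGrowth := by
  have h1 := hasTemperateGrowth_fst
  have h2 := hasTemperateGrowth_snd
  have h : (fun z : ℝ × ℝ => θ + l.1 * z.1 + l.2 * z.2).HasTemperateGrowth := by fun_prop
  exact hasTemperateGrowth_cexp_ofReal_mul_I.comp h

/-- The phase space translation `φ ↦ exp (i (θ + l · z)) φ(z + c)` on Schwartz functions. -/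
noncomputable def rhoS (θ : ℝ) (l c : ℝ × ℝ) : 𝓢(ℝ × ℝ, ℂ) →L[ℂ] 𝓢(ℝ × ℝ, ℂ) :=
  SchwartzMap.smulLeftCLM ℂ (phaseFun θ l) ∘L SchwartzMap.compSubConstCLM ℂ (-c)

lemma rhoS_apply (θ : ℝ) (l c : ℝ × ℝ) (φ : 𝓢(ℝ × ℝ, ℂ)) (z : ℝ × ℝ) :
    rhoS θ l c φ z = phaseFun θ l z * φ (z + c) := by
  simp [rhoS, SchwartzMap.smulLeftCLM_apply_apply (hasTemperateGrowth_phaseFun θ l)]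

lemma rhoS_rhoS (θ θ' : ℝ) (l l' c c' : ℝ × ℝ) (φ : 𝓢(ℝ × ℝ, ℂ)) :
    rhoS θ l c (rhoS θ' l' c' φ) =
      rhoS (θ + θ' + (l'.1 * c.1 + l'.2 * c.2)) (l + l') (c + c') φ := by
  ext z
  simp only [rhoS_apply, phaseFun]
  rw [← mul_assoc, ← Complex.exp_add, add_assoc z]
  congr 2
  simp only [Prod.fst_add, Prod.snd_add]
  push_cast
  ring

lemma rhoS_add_phase (α θ : ℝ) (l c : ℝ × ℝ) (φ : 𝓢(ℝ × ℝ, ℂ)) :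
    rhoS (α + θ) l c φ = Complex.exp ((α : ℂ) * Complex.I) • rhoS θ l c φ := by
  ext z
  simp only [rhoS_apply, phaseFun, smul_apply, smul_eq_mul]
  rw [← mul_assoc, ← Complex.exp_add]
  congr 2
  push_cast
  ring

lemma rhoS_zero (φ : 𝓢(ℝ × ℝ, ℂ)) : rhoS 0 0 0 φ = φ := by
  ext z
  simp [rhoS_apply, phaseFun]

/-- The inclusion of Schwartz functions into `L²(ℝ²)`. -/
noncomputable abbrev toL2 : 𝓢(ℝ × ℝ, ℂ) →L[ℂ] L2Plane := SchwartzMap.toLpCLM ℂ ℂ 2 volume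

lemma denseRange_toL2 : DenseRange toL2 := SchwartzMap.denseRange_toLpCLM (by norm_num)

lemma inner_toL2 (φ : 𝓢(ℝ × ℝ, ℂ)) (u : L2Plane) :
    ⟪toL2 φ, u⟫_ℂ = ∫ z, (starRingEnd ℂ) (φ z) * u z := by
  rw [MeasureTheory.L2.inner_def]
  refine integral_congr_ae ?_
  filter_upwards [φ.coeFn_toLp 2 volume] with z hz
  rw [SchwartzMap.toLpCLM_apply, hz, RCLike.inner_apply']

lemma inner_toL2_toL2 (φ ψ : 𝓢(ℝ × ℝ, ℂ)) :
    ⟪toL2 φ, toL2 ψ⟫_ℂ = ∫ z, (starRingEnd ℂ) (φ z) * ψ z := by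
  rw [inner_toL2]
  refine integral_congr_ae ?_
  filter_upwards [ψ.coeFn_toLp 2 volume] with z hz
  rw [SchwartzMap.toLpCLM_apply, hz]

lemma eq_of_inner_toL2 {u w : L2Plane} (h : ∀ φ, ⟪toL2 φ, u⟫_ℂ = ⟪toL2 φ, w⟫_ℂ) : u = w :=
  denseRange_toL2.eq_of_inner_left ℂ
    fun {φ} => by rw [← inner_conj_symm, h, inner_conj_symm]

lemma clm_ext_toL2 {A B : L2Plane →L[ℂ] L2Plane} (h : ∀ φ, A (toL2 φ) = B (toL2 φ)) : A = B :=
  ContinuousLinearMap.coeFn_injective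
    (denseRange_toL2.equalizer A.continuous B.continuous (funext h))

lemma inner_rhoS_left (θ : ℝ) (l c : ℝ × ℝ) (φ ψ : 𝓢(ℝ × ℝ, ℂ)) :
    ⟪toL2 (rhoS θ l c φ), toL2 ψ⟫_ℂ =
      ⟪toL2 φ, toL2 (rhoS (l.1 * c.1 + l.2 * c.2 - θ) (-l) (-c) ψ)⟫_ℂ := by
  rw [inner_toL2_toL2, inner_toL2_toL2,
    ← integral_add_right_eq_self (fun z => (starRingEnd ℂ) (φ z) * _) c]
  refine integral_congr_ae (Eventually.of_forall fun z => ?_)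
  simp only [rhoS_apply, add_neg_cancel_right, map_mul]
  have : (starRingEnd ℂ) (phaseFun θ l z) =
      phaseFun (l.1 * c.1 + l.2 * c.2 - θ) (-l) (z + c) := by
    simp only [phaseFun]
    rw [← Complex.exp_conj, map_mul, Complex.conj_ofReal, Complex.conj_I]
    congr 1
    simp only [Prod.fst_add, Prod.snd_add, Prod.fst_neg, Prod.snd_neg]
    push_cast
    ring
  rw [this]
  ring

lemma norm_toL2_rhoS (θ : ℝ) (l c : ℝ × ℝ) (φ : 𝓢(ℝ × ℝ, ℂ)) :
    ‖toL2 (rhoS θ l c φ)‖ = ‖toL2 φ‖ := by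
  have h : ⟪toL2 (rhoS θ l c φ), toL2 (rhoS θ l c φ)⟫_ℂ = ⟪toL2 φ, toL2 φ⟫_ℂ := by
    rw [inner_rhoS_left, rhoS_rhoS]
    have h1 : l.1 * c.1 + l.2 * c.2 - θ + θ + (l.1 * (-c).1 + l.2 * (-c).2) = 0 := by
      simp only [Prod.fst_neg, Prod.snd_neg]; ring
    rw [h1, neg_add_cancel, neg_add_cancel, rhoS_zero]
  have h2 := congrArg Complex.re h
  have h3 : ∀ x : L2Plane, (⟪x, x⟫_ℂ).re = ‖x‖ ^ 2 := fun x => inner_self_eq_norm_sq (𝕜 := ℂ) x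
  rw [h3, h3] at h2
  exact (pow_left_inj₀ (norm_nonneg _) (norm_nonneg _) two_ne_zero).1 h2

/-- The phase space translation on `L²(ℝ²)`. -/
noncomputable def rho (θ : ℝ) (l c : ℝ × ℝ) : L2Plane →L[ℂ] L2Plane :=
  (toL2.toLinearMap ∘ₗ (rhoS θ l c).toLinearMap).extendOfNorm toL2.toLinearMap

lemma rho_toL2 (θ : ℝ) (l c : ℝ × ℝ) (φ : 𝓢(ℝ × ℝ, ℂ)) :
    rho θ l c (toL2 φ) = toL2 (rhoS θ l c φ) :=
  LinearMap.extendOfNorm_eq (f := toL2.toLinearMap ∘ₗ (rhoS θ l c).toLinearMap)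
    (e := toL2.toLinearMap) denseRange_toL2
    ⟨1, fun φ => by rw [one_mul]; exact (norm_toL2_rhoS θ l c φ).le⟩ φ

lemma norm_rho (θ : ℝ) (l c : ℝ × ℝ) (u : L2Plane) : ‖rho θ l c u‖ = ‖u‖ := by
  refine denseRange_toL2.induction_on u ?_ fun φ => ?_
  · exact isClosed_eq (rho θ l c).continuous.norm continuous_norm
  · rw [rho_toL2, norm_toL2_rhoS]

lemma rho_rho (θ θ' : ℝ) (l l' c c' : ℝ × ℝ) (u : L2Plane) :
    rho θ l c (rho θ' l' c' u) =
      rho (θ + θ' + (l'.1 * c.1 + l'.2 * c.2)) (l + l') (c + c') u := by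
  have : rho θ l c ∘L rho θ' l' c' =
      rho (θ + θ' + (l'.1 * c.1 + l'.2 * c.2)) (l + l') (c + c') :=
    clm_ext_toL2 fun φ => by
      simp only [ContinuousLinearMap.comp_apply, rho_toL2, rhoS_rhoS]
  rw [← this]; rfl

lemma rho_add_phase (α θ : ℝ) (l c : ℝ × ℝ) (u : L2Plane) :
    rho (α + θ) l c u = Complex.exp ((α : ℂ) * Complex.I) • rho θ l c u := by
  have : rho (α + θ) l c = Complex.exp ((α : ℂ) * Complex.I) • rho θ l c :=
    clm_ext_toL2 fun φ => by
      simp only [smul_apply, rho_toL2, rhoS_add_phase, map_smul]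
  rw [this]; rfl

lemma inner_rho_left (θ : ℝ) (l c : ℝ × ℝ) (v u : L2Plane) :
    ⟪rho θ l c v, u⟫_ℂ = ⟪v, rho (l.1 * c.1 + l.2 * c.2 - θ) (-l) (-c) u⟫_ℂ := by
  refine denseRange_toL2.induction_on v ?_ fun φ => ?_
  · exact isClosed_eq ((rho θ l c).continuous.inner continuous_const)
      (continuous_id.inner continuous_const)
  refine denseRange_toL2.induction_on u ?_ fun ψ => ?_
  · exact isClosed_eq (continuous_const.inner continuous_id)
      (continuous_const.inner (rho _ _ _).continuous)
  rw [rho_toL2, rho_toL2, inner_rhoS_left]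

lemma rho_congr {θ θ' : ℝ} {l l' c c' : ℝ × ℝ} (h₁ : θ = θ') (h₂ : l = l') (h₃ : c = c')
    (u : L2Plane) : rho θ l c u = rho θ' l' c' u := by
  subst h₁ h₂ h₃; rfl

lemma continuous_phaseFun :
    Continuous fun q : (ℝ × (ℝ × ℝ)) × (ℝ × ℝ) => phaseFun q.1.1 q.1.2 q.2 := by
  unfold phaseFun; fun_prop

/-- Phase space translations are jointly strongly continuous in their parameters. -/
lemma continuous_rho (u : L2Plane) :
    Continuous fun p : ℝ × (ℝ × ℝ) × (ℝ × ℝ) => rho p.1 p.2.1 p.2.2 u := by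
  have hS : ∀ φ : 𝓢(ℝ × ℝ, ℂ),
      Continuous fun p : ℝ × (ℝ × ℝ) × (ℝ × ℝ) => rho p.1 p.2.1 p.2.2 (toL2 φ) := by
    intro φ
    refine continuous_iff_continuousAt.2 fun q => ?_
    have hin : Tendsto (fun p : ℝ × (ℝ × ℝ) × (ℝ × ℝ) =>
        ⟪toL2 (rhoS q.1 q.2.1 q.2.2 φ), toL2 (rhoS p.1 p.2.1 p.2.2 φ)⟫_ℂ) (𝓝 q)
        (𝓝 ⟪toL2 (rhoS q.1 q.2.1 q.2.2 φ), toL2 (rhoS q.1 q.2.1 q.2.2 φ)⟫_ℂ) := by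
      simp_rw [inner_toL2_toL2]
      refine tendsto_integral_filter_of_dominated_convergence
        (fun z => ‖rhoS q.1 q.2.1 q.2.2 φ z‖ * SchwartzMap.seminorm ℝ 0 0 φ)
        (Eventually.of_forall fun p => ?_) (Eventually.of_forall fun p =>
          Eventually.of_forall fun z => ?_) ?_ (Eventually.of_forall fun z => ?_)
      · exact Continuous.aestronglyMeasurable ((Complex.continuous_conj.comp
          (SchwartzMap.continuous _)).mul (SchwartzMap.continuous _))
      · rw [norm_mul, RCLike.norm_conj]
        refine mul_le_mul_of_nonneg_left ?_ (norm_nonneg _)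
        rw [rhoS_apply, norm_mul, norm_phaseFun, one_mul]
        exact SchwartzMap.norm_le_seminorm ℝ φ _
      · exact (SchwartzMap.integrable _).norm.mul_const _
      · refine Tendsto.const_mul _ ?_
        simp only [rhoS_apply]
        have : Continuous fun p : ℝ × (ℝ × ℝ) × (ℝ × ℝ) => phaseFun p.1 p.2.1 z * φ (z + p.2.2) :=
          (continuous_phaseFun.comp (by fun_prop : Continuous fun p : ℝ × (ℝ × ℝ) × (ℝ × ℝ) =>
            ((p.1, p.2.1), z))).mul (φ.continuous.comp (by fun_prop))
        exact this.tendsto q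
    refine tendsto_iff_norm_sub_tendsto_zero.2 ?_
    -- Weak continuity together with constant norm gives strong continuity.
    have hsq : ∀ p : ℝ × (ℝ × ℝ) × (ℝ × ℝ),
        ‖rho p.1 p.2.1 p.2.2 (toL2 φ) - rho q.1 q.2.1 q.2.2 (toL2 φ)‖ =
        √(2 * ‖toL2 φ‖ ^ 2 - 2 * (⟪toL2 (rhoS q.1 q.2.1 q.2.2 φ),
          toL2 (rhoS p.1 p.2.1 p.2.2 φ)⟫_ℂ).re) := by
      intro p
      rw [← Real.sqrt_sq (norm_nonneg (_ - _)), norm_sub_rev, @norm_sub_sq ℂ]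
      rw [norm_rho, norm_rho, rho_toL2, rho_toL2]
      congr 1
      simp only [RCLike.re_to_complex]
      ring
    simp_rw [hsq]
    have h0 := ((((Complex.continuous_re.tendsto _).comp hin).const_mul 2).const_sub
      (2 * ‖toL2 φ‖ ^ 2)).sqrt
    have h1 : (⟪toL2 (rhoS q.1 q.2.1 q.2.2 φ), toL2 (rhoS q.1 q.2.1 q.2.2 φ)⟫_ℂ).re
        = ‖toL2 φ‖ ^ 2 := by
      rw [← norm_toL2_rhoS q.1 q.2.1 q.2.2 φ]
      exact inner_self_eq_norm_sq (𝕜 := ℂ) _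
    rw [h1, sub_self, Real.sqrt_zero] at h0
    exact h0
  refine continuous_of_uniform_approx_of_continuous fun s hs => ?_
  obtain ⟨δ, hδ, hs⟩ := Metric.mem_uniformity_dist.1 hs
  obtain ⟨φ, hφ⟩ := denseRange_toL2.exists_dist_lt u hδ
  refine ⟨_, hS φ, fun p => hs ?_⟩
  rw [dist_eq_norm, ← map_sub, norm_rho, ← dist_eq_norm]
  exact hφ

attribute [irreducible] rho

/-- `exp (2πi (σ (y + t ε x) + τ (ε² D_y - t ε D_x)))` for `ζ = σ + i τ`, on Schwartz functions. -/
noncomputable def weylS (ε t : ℝ) (ζ : ℂ) : 𝓢(ℝ × ℝ, ℂ) →L[ℂ] 𝓢(ℝ × ℝ, ℂ) :=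
  -- The scalar phase is the Baker–Campbell–Hausdorff term, half the commutator of 2πiσP_t and
  -- 2πiτQ_t up to sign; it arises when the modulation is separated from the translation.
  rhoS (2 * Real.pi ^ 2 * ζ.re * ζ.im * ε ^ 2 * (1 - t ^ 2))
    (2 * Real.pi * ζ.re * t * ε, 2 * Real.pi * ζ.re)
    (-(2 * Real.pi * t * ε * ζ.im), 2 * Real.pi * ε ^ 2 * ζ.im)

/-- `exp (2πi (σ (y + t ε x) + τ (ε² D_y - t ε D_x)))` for `ζ = σ + i τ`, on `L²(ℝ²)`. -/
noncomputable def weylU (ε t : ℝ) (ζ : ℂ) : L2Plane →L[ℂ] L2Plane :=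
  rho (2 * Real.pi ^ 2 * ζ.re * ζ.im * ε ^ 2 * (1 - t ^ 2))
    (2 * Real.pi * ζ.re * t * ε, 2 * Real.pi * ζ.re)
    (-(2 * Real.pi * t * ε * ζ.im), 2 * Real.pi * ε ^ 2 * ζ.im)

lemma weylU_toL2 (ε t : ℝ) (ζ : ℂ) (φ : 𝓢(ℝ × ℝ, ℂ)) :
    weylU ε t ζ (toL2 φ) = toL2 (weylS ε t ζ φ) := rho_toL2 _ _ _ _

lemma continuous_weylU (ε : ℝ) (u : L2Plane) :
    Continuous fun p : ℝ × ℂ => weylU ε p.1 p.2 u := by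
  have hre : Continuous fun p : ℝ × ℂ => p.2.re := Complex.continuous_re.comp continuous_snd
  have him : Continuous fun p : ℝ × ℂ => p.2.im := Complex.continuous_im.comp continuous_snd
  exact (continuous_rho u).comp (by fun_prop : Continuous fun p : ℝ × ℂ =>
    ((2 * Real.pi ^ 2 * p.2.re * p.2.im * ε ^ 2 * (1 - p.1 ^ 2),
      (2 * Real.pi * p.2.re * p.1 * ε, 2 * Real.pi * p.2.re),
      (-(2 * Real.pi * p.1 * ε * p.2.im), 2 * Real.pi * ε ^ 2 * p.2.im)) :
      ℝ × (ℝ × ℝ) × (ℝ × ℝ)))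

/-- The commutator of y with ε²D_y is iε² and that of tεx with −tεD_x is −it²ε². The Planck constant
therefore decreases from ε² at t = 0 to 0 at t = 1, and never exceeds ε² in between. -/
lemma isWeylSystem_weylU (ε t : ℝ) : IsWeylSystem (ε ^ 2 * (1 - t ^ 2)) (weylU ε t) where
  norm_map ζ u := norm_rho _ _ _ u
  inner_left ζ v u := by
    refine (inner_rho_left _ _ _ v u).trans (congrArg _ (rho_congr ?_ ?_ ?_ u))
    · simp only [Complex.neg_re, Complex.neg_im]; ring
    · simp only [Complex.neg_re, Prod.neg_mk, mul_neg, neg_mul]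
    · simp only [Complex.neg_im, Prod.neg_mk, mul_neg]
  mul ζ ζ' u := by
    refine (rho_rho _ _ _ _ _ _ u).trans (Eq.trans (rho_congr ?_ ?_ ?_ u) (rho_add_phase _ _ _ _ u))
    · simp only [sympl, Complex.add_re, Complex.add_im]; ring
    · simp only [Complex.add_re, Prod.mk_add_mk]; congr 1 <;> ring
    · simp only [Complex.add_im, Prod.mk_add_mk]; congr 1 <;> ring
  cont u := (continuous_weylU ε u).comp (by fun_prop : Continuous fun ζ : ℂ => (t, ζ))

end PhaseTranslation

/-! ### The quantizations Op_t(b) of Schwartz symbols and their uniform L² bound. -/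

section WeylQuantization

open scoped FourierTransform

/-- A Schwartz function on `ℝ × ℝ`, read as a function on `ℂ`. -/
noncomputable def toC : 𝓢(ℝ × ℝ, ℂ) →L[ℂ] 𝓢(ℂ, ℂ) :=
  SchwartzMap.compCLMOfContinuousLinearEquiv ℂ Complex.equivRealProdCLM

lemma toC_apply (b : 𝓢(ℝ × ℝ, ℂ)) (ζ : ℂ) : toC b ζ = b (ζ.re, ζ.im) := rfl

/-- The Fourier transform of a Schwartz function on `ℝ × ℝ`, as a function on `ℂ`. -/
noncomputable def ftC (b : 𝓢(ℝ × ℝ, ℂ)) : 𝓢(ℂ, ℂ) := 𝓕 (toC b)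

lemma ftC_add (b b' : 𝓢(ℝ × ℝ, ℂ)) : ftC (b + b') = ftC b + ftC b' := by
  rw [ftC, map_add, FourierTransform.fourier_add]; rfl

lemma ftC_smul (c : ℂ) (b : 𝓢(ℝ × ℝ, ℂ)) : ftC (c • b) = c • ftC b := by
  rw [ftC, map_smul, FourierTransform.fourier_smul]; rfl

lemma lineDeriv_toC (b : 𝓢(ℝ × ℝ, ℂ)) (m : ℂ) : ∂_{m} (toC b) = toC (∂_{(m.re, m.im)} b) := by
  rw [toC, SchwartzMap.lineDerivOp_compCLMOfContinuousLinearEquiv]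
  rfl

lemma ftC_lineDeriv (b : 𝓢(ℝ × ℝ, ℂ)) (m ζ : ℂ) :
    ftC (∂_{(m.re, m.im)} b) ζ = 2 * Real.pi * Complex.I * ((inner ℝ ζ m : ℝ) * ftC b ζ) := by
  rw [ftC, ← lineDeriv_toC, SchwartzMap.fourier_lineDerivOp_eq]
  have : (fun x : ℂ => inner ℝ x m).HasTemperateGrowth := by fun_prop
  simp only [smul_apply, SchwartzMap.smulLeftCLM_apply_apply this, smul_eq_mul,
    Complex.real_smul]
  rfl

lemma ftC_lineDeriv_fst (b : 𝓢(ℝ × ℝ, ℂ)) (ζ : ℂ) :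
    ftC (∂_{((1, 0) : ℝ × ℝ)} b) ζ = 2 * Real.pi * Complex.I * (ζ.re * ftC b ζ) := by
  have := ftC_lineDeriv b 1 ζ
  simpa [Complex.inner] using this

lemma ftC_lineDeriv_snd (b : 𝓢(ℝ × ℝ, ℂ)) (ζ : ℂ) :
    ftC (∂_{((0, 1) : ℝ × ℝ)} b) ζ = 2 * Real.pi * Complex.I * (ζ.im * ftC b ζ) := by
  have := ftC_lineDeriv b Complex.I ζ
  simpa [Complex.inner] using this

/-- All derivatives of `b` of order `n` are bounded by `K n`. -/
def SymbolBound (K : ℕ → ℝ) (b : ℝ × ℝ → ℂ) : Prop :=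
  ∀ n z, ‖iteratedFDeriv ℝ n b z‖ ≤ K n

lemma SymbolBound.nonneg {K : ℕ → ℝ} {b : ℝ × ℝ → ℂ} (hb : SymbolBound K b) (n : ℕ) : 0 ≤ K n :=
  (norm_nonneg _).trans (hb n 0)

lemma SymbolBound.norm_le {K : ℕ → ℝ} {b : ℝ × ℝ → ℂ} (hb : SymbolBound K b) (z : ℝ × ℝ) :
    ‖b z‖ ≤ K 0 := by
  simpa using hb 0 z

lemma SymbolBound.lineDeriv {K : ℕ → ℝ} {b : 𝓢(ℝ × ℝ, ℂ)} (hb : SymbolBound K b) {v : ℝ × ℝ}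
    (hv : ‖v‖ ≤ 1) : SymbolBound (fun n => K (n + 1)) (∂_{v} b : 𝓢(ℝ × ℝ, ℂ)) := by
  intro n z
  have h1 : (⇑(∂_{v} b : 𝓢(ℝ × ℝ, ℂ)) : ℝ × ℝ → ℂ) =
      (ContinuousLinearMap.apply ℝ ℂ v) ∘ (fderiv ℝ b) := by
    funext z
    rw [SchwartzMap.lineDerivOp_apply_eq_fderiv]; rfl
  have h2 : ContDiff ℝ n (fderiv ℝ b) := (b.smooth ⊤).fderiv_right (by exact_mod_cast le_top)
  rw [h1, ContinuousLinearMap.iteratedFDeriv_comp_left _ h2.contDiffAt le_rfl]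
  refine (ContinuousLinearMap.norm_compContinuousMultilinearMap_le _ _).trans ?_
  rw [norm_iteratedFDeriv_fderiv]
  have h3 : ‖ContinuousLinearMap.apply ℝ ℂ v‖ ≤ 1 := by
    refine ContinuousLinearMap.opNorm_le_bound _ zero_le_one fun L => ?_
    rw [ContinuousLinearMap.apply_apply, one_mul]
    exact (L.le_opNorm v).trans (mul_le_of_le_one_right (norm_nonneg _) hv)
  calc _ ≤ 1 * K (n + 1) := mul_le_mul h3 (hb _ _) (norm_nonneg _) zero_le_one
    _ = _ := one_mul _

lemma SymbolBound.add {K K' : ℕ → ℝ} {b b' : 𝓢(ℝ × ℝ, ℂ)} (hb : SymbolBound K b)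
    (hb' : SymbolBound K' b') : SymbolBound (fun n => K n + K' n) (b + b' : 𝓢(ℝ × ℝ, ℂ)) := by
  intro n z
  have h1 : (⇑(b + b') : ℝ × ℝ → ℂ) = b + b' := rfl
  rw [h1, iteratedFDeriv_add_apply ((b.smooth n).contDiffAt) ((b'.smooth n).contDiffAt)]
  exact (norm_add_le _ _).trans (add_le_add (hb n z) (hb' n z))

lemma SymbolBound.smul {K : ℕ → ℝ} {b : 𝓢(ℝ × ℝ, ℂ)} (hb : SymbolBound K b) (c : ℂ) :
    SymbolBound (fun n => ‖c‖ * K n) (c • b : 𝓢(ℝ × ℝ, ℂ)) := by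
  intro n z
  have h1 : (⇑(c • b) : ℝ × ℝ → ℂ) = c • ⇑b := rfl
  rw [h1, iteratedFDeriv_const_smul_apply ((b.smooth n).contDiffAt), norm_smul]
  exact mul_le_mul_of_nonneg_left (hb n z) (norm_nonneg _)

lemma SymbolBound.mono {K K' : ℕ → ℝ} {b : ℝ × ℝ → ℂ} (hb : SymbolBound K b)
    (h : ∀ n, K n ≤ K' n) : SymbolBound K' b := fun n z => (hb n z).trans (h n)

/-- The factor 1/(2π) ≤ 1/2 absorbs the sum of two partial derivatives, so iteration costs no
constant. -/
lemma dbarC_toC {K : ℕ → ℝ} {b : 𝓢(ℝ × ℝ, ℂ)} (hb : SymbolBound K b) :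
    ∃ b' : 𝓢(ℝ × ℝ, ℂ), dbarC (toC b) = toC b' ∧ SymbolBound (fun n => K (n + 1)) b' := by
  refine ⟨(2 * Real.pi * Complex.I : ℂ)⁻¹ • (∂_{((1, 0) : ℝ × ℝ)} b +
    Complex.I • ∂_{((0, 1) : ℝ × ℝ)} b), ?_, ?_⟩
  · rw [dbarC, lineDeriv_toC, lineDeriv_toC, map_smul, map_add, map_smul]
    simp
  · have h1 : SymbolBound (fun n => K (n + 1)) (∂_{((1, 0) : ℝ × ℝ)} b : 𝓢(ℝ × ℝ, ℂ)) :=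
      hb.lineDeriv (by simp [Prod.norm_def])
    have h2 : SymbolBound (fun n => K (n + 1)) (∂_{((0, 1) : ℝ × ℝ)} b : 𝓢(ℝ × ℝ, ℂ)) :=
      hb.lineDeriv (by simp [Prod.norm_def])
    refine ((h1.add (h2.smul Complex.I)).smul _).mono fun n => ?_
    have h3 := hb.nonneg (n + 1)
    have h4 : ‖(2 * Real.pi * Complex.I : ℂ)⁻¹‖ ≤ 1 / 2 := by
      rw [norm_inv]
      simp only [norm_mul, Complex.norm_ofNat, Complex.norm_real, Complex.norm_I, mul_one]
      rw [Real.norm_of_nonneg Real.pi_pos.le, one_div]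
      gcongr
      nlinarith [Real.pi_gt_three]
    simp only [Complex.norm_I, one_mul]
    nlinarith

lemma norm_dbarC_iterate_toC_le {K : ℕ → ℝ} {b : 𝓢(ℝ × ℝ, ℂ)} (hb : SymbolBound K b) (i : ℕ)
    (z : ℂ) : ‖(dbarC^[i] (toC b)) z‖ ≤ K i := by
  induction i generalizing K b with
  | zero => exact hb.norm_le _
  | succ i ih =>
    obtain ⟨b', h1, h2⟩ := dbarC_toC hb
    rw [Function.iterate_succ_apply, h1]
    exact ih h2

/-- The Weyl quantization `b(y + t ε x, ε² D_y - t ε D_x)` of a Schwartz function `b`. -/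
noncomputable def opS (ε t : ℝ) (b : 𝓢(ℝ × ℝ, ℂ)) : L2Plane →L[ℂ] L2Plane :=
  LinearMap.mkContinuous
    { toFun := fun u => ∫ ζ, ftC b ζ • weylU ε t ζ u
      map_add' := fun u w => by
        simp only [map_add, smul_add]
        exact integral_add ((isWeylSystem_weylU ε t).integrable_smul (ftC b).integrable u)
          ((isWeylSystem_weylU ε t).integrable_smul (ftC b).integrable w)
      map_smul' := fun c u => by
        simp only [map_smul, RingHom.id_apply]
        rw [← integral_smul]
        exact integral_congr_ae (Eventually.of_forall fun ζ => smul_comm _ _ _) }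
    (∫ ζ, ‖ftC b ζ‖) (fun u => by
      rw [← integral_mul_const]
      refine norm_integral_le_of_norm_le ((ftC b).integrable.norm.mul_const _)
        (Eventually.of_forall fun ζ => ?_)
      rw [norm_smul, (isWeylSystem_weylU ε t).norm_map])

lemma opS_apply (ε t : ℝ) (b : 𝓢(ℝ × ℝ, ℂ)) (u : L2Plane) :
    opS ε t b u = ∫ ζ, ftC b ζ • weylU ε t ζ u := rfl

lemma inner_opS (ε t : ℝ) (b : 𝓢(ℝ × ℝ, ℂ)) (v u : L2Plane) :
    ⟪v, opS ε t b u⟫_ℂ = ∫ ζ, ftC b ζ * ⟪v, weylU ε t ζ u⟫_ℂ := by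
  rw [opS_apply, ← integral_inner ((isWeylSystem_weylU ε t).integrable_smul (ftC b).integrable u)]
  simp_rw [inner_smul_right]

lemma opS_add (ε t : ℝ) (b b' : 𝓢(ℝ × ℝ, ℂ)) (u : L2Plane) :
    opS ε t (b + b') u = opS ε t b u + opS ε t b' u := by
  simp only [opS_apply, ftC_add, add_apply, add_smul]
  exact integral_add ((isWeylSystem_weylU ε t).integrable_smul (ftC b).integrable u)
    ((isWeylSystem_weylU ε t).integrable_smul (ftC b').integrable u)

lemma opS_smul (ε t : ℝ) (c : ℂ) (b : 𝓢(ℝ × ℝ, ℂ)) (u : L2Plane) :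
    opS ε t (c • b) u = c • opS ε t b u := by
  simp only [opS_apply, ftC_smul, smul_apply, smul_assoc]
  exact integral_smul _ _

/-- The Planck constants ε²(1 − t²) all lie in [0, E²], so a single Calderón–Vaillancourt constant
serves every ε and t; derivatives of order at most 3 enter. -/
lemma exists_norm_opS_le (E : ℝ) : ∃ C : ℝ, 0 ≤ C ∧ ∀ ε t : ℝ, |ε| ≤ E → t ∈ Icc (0 : ℝ) 1 →
    ∀ (K : ℕ → ℝ) (b : 𝓢(ℝ × ℝ, ℂ)), SymbolBound K b → ∀ u : L2Plane,
      ‖opS ε t b u‖ ≤ C * (∑ n ∈ Finset.range 4, K n) * ‖u‖ := by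
  obtain ⟨C, hC0, hC⟩ := exists_norm_weyl_form_le L2Plane (E ^ 2)
  refine ⟨C, hC0, fun ε t hε ht K b hb u => ?_⟩
  have hκ : |ε ^ 2 * (1 - t ^ 2)| ≤ E ^ 2 := by
    have h1 : 0 ≤ 1 - t ^ 2 := by nlinarith [ht.1, ht.2]
    have h2 : 1 - t ^ 2 ≤ 1 := by nlinarith [sq_nonneg t]
    rw [abs_of_nonneg (by positivity)]
    have h3 : ε ^ 2 ≤ E ^ 2 := by rw [← sq_abs ε]; gcongr
    nlinarith [sq_nonneg ε]
  have hM : ∀ i ≤ 3, ∀ z, ‖(dbarC^[i] (toC b)) z‖ ≤ ∑ n ∈ Finset.range 4, K n := fun i hi z =>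
    (norm_dbarC_iterate_toC_le hb i z).trans
      (Finset.single_le_sum (f := K) (fun n _ => hb.nonneg n) (Finset.mem_range.2 (by omega)))
  -- The form is tested on the vector Op_t(b)u itself, which produces the square of its norm.
  have h := hC _ hκ _ (isWeylSystem_weylU ε t) (toC b) _ hM (opS ε t b u) u
  change ‖∫ ζ, ftC b ζ * ⟪opS ε t b u, weylU ε t ζ u⟫_ℂ‖ ≤ _ at h
  rw [← inner_opS, inner_self_eq_norm_sq_to_K] at h
  rcases eq_or_ne (opS ε t b u) 0 with h0 | h0
  · rw [h0, norm_zero]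
    have : 0 ≤ ∑ n ∈ Finset.range 4, K n := Finset.sum_nonneg fun n _ => hb.nonneg n
    positivity
  · have hpos := norm_pos_iff.2 h0
    simp only [norm_pow, Complex.coe_algebraMap, Complex.norm_real, norm_norm] at h
    refine le_of_mul_le_mul_right ?_ hpos
    calc _ = ‖opS ε t b u‖ ^ 2 := by ring
      _ ≤ _ := h
      _ = _ := by ring

end WeylQuantization

/-! ### Weighted spaces in weak form and commutators with x and D_x. -/

section WeightedSpaces

/-- Riesz representation after extension by density. It turns a bound tested on Schwartz functions
into a vector such as x u or D_x u. -/
lemma exists_inner_toL2_eq (f : 𝓢(ℝ × ℝ, ℂ) →ₗ[ℂ] ℂ) {K : ℝ} (hK : 0 ≤ K)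
    (hf : ∀ φ, ‖f φ‖ ≤ K * ‖toL2 φ‖) :
    ∃ w : L2Plane, ‖w‖ ≤ K ∧ ∀ φ, ⟪w, toL2 φ⟫_ℂ = f φ := by
  let F : L2Plane →L[ℂ] ℂ := f.extendOfNorm toL2.toLinearMap
  refine ⟨(InnerProductSpace.toDual ℂ L2Plane).symm F, ?_, fun φ => ?_⟩
  · rw [LinearIsometryEquiv.norm_map]
    exact LinearMap.opNorm_extendOfNorm_le denseRange_toL2 hK hf
  · rw [InnerProductSpace.toDual_symm_apply]
    exact LinearMap.extendOfNorm_eq (f := f) (e := toL2.toLinearMap) denseRange_toL2 ⟨K, hf⟩ φ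

lemma norm_le_of_inner_toL2_le {u : L2Plane} {K : ℝ} (hK : 0 ≤ K)
    (h : ∀ φ, ‖⟪toL2 φ, u⟫_ℂ‖ ≤ K * ‖toL2 φ‖) : ‖u‖ ≤ K := by
  have h1 : ∀ v : L2Plane, ‖⟪v, u⟫_ℂ‖ ≤ K * ‖v‖ := by
    intro v
    refine denseRange_toL2.induction_on v ?_ h
    exact isClosed_le (continuous_id.inner continuous_const).norm (continuous_norm.const_mul K)
  rcases eq_or_ne u 0 with rfl | h0
  · simpa using hK
  · have := h1 u
    rw [inner_self_eq_norm_sq_to_K] at this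
    simp only [norm_pow, Complex.coe_algebraMap, Complex.norm_real, norm_norm] at this
    refine le_of_mul_le_mul_right ?_ (norm_pos_iff.2 h0)
    rwa [← pow_two]

/-- Multiplication by `x` on Schwartz functions. -/
noncomputable def xS : 𝓢(ℝ × ℝ, ℂ) →L[ℂ] 𝓢(ℝ × ℝ, ℂ) :=
  SchwartzMap.smulLeftCLM ℂ (fun z : ℝ × ℝ => (z.1 : ℂ))

/-- `D_x` on Schwartz functions. -/
noncomputable def dS : 𝓢(ℝ × ℝ, ℂ) →L[ℂ] 𝓢(ℝ × ℝ, ℂ) :=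
  (-Complex.I) • LineDeriv.lineDerivOpCLM ℂ 𝓢(ℝ × ℝ, ℂ) ((1, 0) : ℝ × ℝ)

lemma hasTemperateGrowth_ofReal_fst : (fun z : ℝ × ℝ => (z.1 : ℂ)).HasTemperateGrowth := by
  have := hasTemperateGrowth_fst
  fun_prop

lemma xS_apply (φ : 𝓢(ℝ × ℝ, ℂ)) (z : ℝ × ℝ) : xS φ z = z.1 * φ z := by
  simp [xS, SchwartzMap.smulLeftCLM_apply_apply hasTemperateGrowth_ofReal_fst]

lemma dS_eq (φ : 𝓢(ℝ × ℝ, ℂ)) : dS φ = (-Complex.I) • ∂_{((1, 0) : ℝ × ℝ)} φ := rfl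

lemma dS_apply (φ : 𝓢(ℝ × ℝ, ℂ)) (z : ℝ × ℝ) :
    dS φ z = -Complex.I * fderiv ℝ φ z (1, 0) := by
  rw [dS_eq, smul_apply, SchwartzMap.lineDerivOp_apply_eq_fderiv]; rfl

/-- The generators `x` (for `true`) and `D_x` (for `false`). -/
noncomputable def gen : Bool → 𝓢(ℝ × ℝ, ℂ) →L[ℂ] 𝓢(ℝ × ℝ, ℂ)
  | true => xS
  | false => dS

/-- `w = x u` (for `true`), respectively `w = D_x u` (for `false`), weakly. -/
def IsGen (i : Bool) (u w : L2Plane) : Prop := ∀ φ, ⟪toL2 φ, w⟫_ℂ = ⟪toL2 (gen i φ), u⟫_ℂ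

/-- Words in the generators, applied to a Schwartz function. -/
noncomputable def wordS : List Bool → 𝓢(ℝ × ℝ, ℂ) →L[ℂ] 𝓢(ℝ × ℝ, ℂ)
  | [] => ContinuousLinearMap.id ℂ _
  | i :: l => gen i ∘L wordS l

/-- `u` and all words of length at most `k` in `x`, `D_x`, applied to `u`, are in `L²(ℝ²)` with
norm at most `K`. -/
def Bd (k : ℕ) (K : ℝ) (u : L2Plane) : Prop :=
  0 ≤ K ∧ ∀ l : List Bool, l.length ≤ k → ∀ φ, ‖⟪toL2 (wordS l φ), u⟫_ℂ‖ ≤ K * ‖toL2 φ‖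

namespace Bd

variable {k : ℕ} {K K' : ℝ} {u u' : L2Plane}

lemma norm_le (h : Bd k K u) : ‖u‖ ≤ K :=
  norm_le_of_inner_toL2_le h.1 fun φ => h.2 [] (Nat.zero_le k) φ

lemma of_norm_le (h : ‖u‖ ≤ K) : Bd 0 K u := by
  refine ⟨(norm_nonneg _).trans h, fun l hl φ => ?_⟩
  obtain rfl : l = [] := List.length_eq_zero_iff.1 (Nat.le_zero.1 hl)
  refine (norm_inner_le_norm _ _).trans ?_
  rw [mul_comm]
  exact mul_le_mul_of_nonneg_right h (norm_nonneg _)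

lemma mono (h : Bd k K u) {k' : ℕ} (hk : k' ≤ k) (hK : K ≤ K') : Bd k' K' u :=
  ⟨h.1.trans hK, fun l hl φ => (h.2 l (hl.trans hk) φ).trans
    (mul_le_mul_of_nonneg_right hK (norm_nonneg _))⟩

lemma add (h : Bd k K u) (h' : Bd k K' u') : Bd k (K + K') (u + u') := by
  refine ⟨add_nonneg h.1 h'.1, fun l hl φ => ?_⟩
  rw [inner_add_right, add_mul]
  exact (norm_add_le _ _).trans (add_le_add (h.2 l hl φ) (h'.2 l hl φ))

lemma smul (h : Bd k K u) (c : ℂ) : Bd k (‖c‖ * K) (c • u) := by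
  refine ⟨mul_nonneg (norm_nonneg _) h.1, fun l hl φ => ?_⟩
  rw [inner_smul_right, norm_mul, mul_assoc]
  exact mul_le_mul_of_nonneg_left (h.2 l hl φ) (norm_nonneg _)

lemma zero (k : ℕ) : Bd k 0 0 := ⟨le_rfl, fun l _ φ => by simp⟩

lemma sub (h : Bd k K u) (h' : Bd k K' u') : Bd k (K + K') (u - u') := by
  have := h.add (h'.smul (-1))
  simpa [sub_eq_add_neg] using this

lemma sum {ι : Type*} (s : Finset ι) {K : ι → ℝ} {u : ι → L2Plane}
    (h : ∀ i ∈ s, Bd k (K i) (u i)) : Bd k (∑ i ∈ s, K i) (∑ i ∈ s, u i) := by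
  classical
  induction s using Finset.induction_on with
  | empty => simpa using zero k
  | insert a s ha ih =>
    rw [Finset.sum_insert ha, Finset.sum_insert ha]
    exact (h a (Finset.mem_insert_self a s)).add
      (ih fun i hi => h i (Finset.mem_insert_of_mem hi))

/-- The generators map `Bd (k + 1)` to `Bd k`. -/
lemma exists_isGen (h : Bd (k + 1) K u) (i : Bool) : ∃ w, IsGen i u w ∧ Bd k K w := by
  let f : 𝓢(ℝ × ℝ, ℂ) →ₗ[ℂ] ℂ :=
    { toFun := fun φ => ⟪u, toL2 (gen i φ)⟫_ℂ
      map_add' := fun φ ψ => by simp only [map_add, inner_add_right]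
      map_smul' := fun c φ => by simp only [map_smul, inner_smul_right]; rfl }
  obtain ⟨w, -, hw⟩ := exists_inner_toL2_eq f h.1 fun φ => by
    change ‖⟪u, toL2 (gen i φ)⟫_ℂ‖ ≤ _
    rw [norm_inner_symm]
    exact h.2 [i] (by simp) φ
  have hg : IsGen i u w := fun φ => by
    rw [← inner_conj_symm, hw]
    exact inner_conj_symm (𝕜 := ℂ) (toL2 (gen i φ)) u
  refine ⟨w, hg, h.1, fun l hl φ => ?_⟩
  rw [hg]
  exact h.2 (i :: l) (by simpa using hl) φ

/-- The outermost letter of a word on the test function is the one that acts first on u, so it can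
be peeled off. Allowing letters in any order is what makes this induction free of commutators. -/
lemma of_isGen (h : Bd k K u) (hg : ∀ i, ∃ w, IsGen i u w ∧ Bd k K w) : Bd (k + 1) K u := by
  refine ⟨h.1, fun l hl φ => ?_⟩
  cases l with
  | nil => exact h.2 [] (Nat.zero_le k) φ
  | cons i l =>
    obtain ⟨w, hw, hB⟩ := hg i
    have := hB.2 l (by simpa using hl) φ
    rwa [hw] at this

/-- `Bd` is closed under weak limits. -/
lemma of_tendsto {v : ℕ → L2Plane} (h : ∀ n, Bd k K (v n))
    (hv : ∀ φ, Tendsto (fun n => ⟪toL2 φ, v n⟫_ℂ) atTop (𝓝 ⟪toL2 φ, u⟫_ℂ)) : Bd k K u :=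
  ⟨(h 0).1, fun l hl φ => le_of_tendsto (hv (wordS l φ)).norm
    (Eventually.of_forall fun n => (h n).2 l hl φ)⟩

/-- `Bd` is stable under weak integration. -/
lemma of_integral {v : ℝ → L2Plane} {T : ℝ} (hT : 0 ≤ T) (h : ∀ s ∈ Icc 0 T, Bd k K (v s))
    (hu : ∀ φ, ⟪toL2 φ, u⟫_ℂ = ∫ s in (0 : ℝ)..T, ⟪toL2 φ, v s⟫_ℂ) : Bd k (K * T) u := by
  have hK : 0 ≤ K := (h 0 ⟨le_rfl, hT⟩).1
  refine ⟨mul_nonneg hK hT, fun l hl φ => ?_⟩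
  rw [hu]
  have := intervalIntegral.norm_integral_le_of_norm_le_const (a := 0) (b := T)
    (f := fun s => ⟪toL2 (wordS l φ), v s⟫_ℂ) (C := K * ‖toL2 φ‖) fun s hs => by
      rw [uIoc_of_le hT] at hs
      exact (h s ⟨hs.1.le, hs.2⟩).2 l hl φ
  rw [sub_zero, abs_of_nonneg hT] at this
  linarith

end Bd

/-- The direction in which the symbol is differentiated in the commutator with a generator. -/
def genDir : Bool → ℝ × ℝ
  | true => (0, 1)
  | false => (1, 0)

/-- The component of `ζ` that appears in the commutator with a generator. -/
def genCoord : Bool → ℂ → ℝ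
  | true => Complex.im
  | false => Complex.re

lemma norm_genDir_le (i : Bool) : ‖genDir i‖ ≤ 1 := by
  cases i <;> simp [genDir, Prod.norm_def]

lemma ftC_genDir (i : Bool) (b : 𝓢(ℝ × ℝ, ℂ)) (ζ : ℂ) :
    ftC (∂_{genDir i} b) ζ = 2 * Real.pi * Complex.I * (genCoord i ζ * ftC b ζ) := by
  cases i
  · exact ftC_lineDeriv_fst b ζ
  · exact ftC_lineDeriv_snd b ζ

lemma genCoord_neg (i : Bool) (ζ : ℂ) : genCoord i (-ζ) = -genCoord i ζ := by
  cases i <;> simp [genCoord]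

lemma xS_rhoS (θ : ℝ) (l c : ℝ × ℝ) (φ : 𝓢(ℝ × ℝ, ℂ)) :
    xS (rhoS θ l c φ) = rhoS θ l c (xS φ) + ((-c.1 : ℝ) : ℂ) • rhoS θ l c φ := by
  ext z
  simp only [xS_apply, rhoS_apply, add_apply, smul_apply, smul_eq_mul, Prod.fst_add]
  push_cast
  ring

lemma fderiv_rhoS (θ : ℝ) (l c : ℝ × ℝ) (φ : 𝓢(ℝ × ℝ, ℂ)) (z : ℝ × ℝ) :
    fderiv ℝ (rhoS θ l c φ) z (1, 0) =
      phaseFun θ l z * fderiv ℝ φ (z + c) (1, 0) + Complex.I * l.1 * (rhoS θ l c φ z) := by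
  have h1 : (rhoS θ l c φ : ℝ × ℝ → ℂ) = fun z => phaseFun θ l z * φ (z + c) :=
    funext fun z => rhoS_apply θ l c φ z
  have h2 : HasFDerivAt (fun z => φ (z + c)) (fderiv ℝ φ (z + c)) z :=
    (hasFDerivAt_comp_add_right c).2 (φ.hasFDerivAt (z + c))
  have h3 : HasFDerivAt (fun z : ℝ × ℝ => ((θ + l.1 * z.1 + l.2 * z.2 : ℝ) : ℂ))
      (Complex.ofRealCLM.comp (l.1 • ContinuousLinearMap.fst ℝ ℝ ℝ +
        l.2 • ContinuousLinearMap.snd ℝ ℝ ℝ)) z := by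
    refine Complex.ofRealCLM.hasFDerivAt.comp z ?_
    exact ((hasFDerivAt_fst.const_mul l.1).const_add θ).add (hasFDerivAt_snd.const_mul l.2)
  have h4 := (h3.mul_const Complex.I).cexp
  have h5 : HasFDerivAt (fun z => phaseFun θ l z * φ (z + c)) _ z := h4.mul h2
  rw [h1, h5.fderiv]
  simp only [add_apply, smul_apply, ContinuousLinearMap.comp_apply, ContinuousLinearMap.coe_fst', ContinuousLinearMap.coe_snd',
    smul_eq_mul, Complex.ofRealCLM_apply, phaseFun]
  simp
  ring

lemma dS_rhoS (θ : ℝ) (l c : ℝ × ℝ) (φ : 𝓢(ℝ × ℝ, ℂ)) :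
    dS (rhoS θ l c φ) = rhoS θ l c (dS φ) + ((l.1 : ℝ) : ℂ) • rhoS θ l c φ := by
  ext z
  simp only [dS_apply, fderiv_rhoS, add_apply, smul_apply, smul_eq_mul]
  rw [rhoS_apply (φ := dS φ), dS_apply]
  linear_combination (-(l.1 * rhoS θ l c φ z)) * Complex.I_sq

/-- A phase space translation shifts x and D_x by scalars. The shifts are 2πtε times Im ζ and Re ζ
respectively, which on the Fourier side are derivatives of the symbol. -/
lemma gen_weylS (i : Bool) (ε t : ℝ) (ζ : ℂ) (φ : 𝓢(ℝ × ℝ, ℂ)) :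
    gen i (weylS ε t ζ φ) = weylS ε t ζ (gen i φ) +
      ((2 * Real.pi * t * ε * genCoord i ζ : ℝ) : ℂ) • weylS ε t ζ φ := by
  cases i
  · refine (dS_rhoS _ _ _ φ).trans ?_
    congr 3
    simp only [genCoord]; ring
  · refine (xS_rhoS _ _ _ φ).trans ?_
    congr 3
    simp only [genCoord]; ring

lemma inner_weylU_left (ε t : ℝ) (ζ : ℂ) (ψ : 𝓢(ℝ × ℝ, ℂ)) (v : L2Plane) :
    ⟪toL2 ψ, weylU ε t ζ v⟫_ℂ = ⟪toL2 (weylS ε t (-ζ) ψ), v⟫_ℂ := by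
  rw [← weylU_toL2, (isWeylSystem_weylU ε t).inner_left, neg_neg]

lemma IsGen.inner_weylU {i : Bool} {u w : L2Plane} (h : IsGen i u w) (ε t : ℝ) (ζ : ℂ)
    (φ : 𝓢(ℝ × ℝ, ℂ)) : ⟪toL2 φ, weylU ε t ζ w⟫_ℂ = ⟪toL2 (gen i φ), weylU ε t ζ u⟫_ℂ -
      ((2 * Real.pi * t * ε * genCoord i ζ : ℝ) : ℂ) * ⟪toL2 φ, weylU ε t ζ u⟫_ℂ := by
  rw [inner_weylU_left, h, gen_weylS, map_add, map_smul, inner_add_left, inner_smul_left,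
    inner_weylU_left, inner_weylU_left, Complex.conj_ofReal, genCoord_neg]
  push_cast
  ring

/-- Commutator of a generator with a quantized symbol. -/
lemma IsGen.opS {i : Bool} {u w : L2Plane} (h : IsGen i u w) (ε t : ℝ) (b : 𝓢(ℝ × ℝ, ℂ)) :
    IsGen i (opS ε t b u)
      (opS ε t b w + (-Complex.I * (t * ε : ℝ)) • opS ε t (∂_{genDir i} b) u) := by
  have hW := isWeylSystem_weylU ε t
  intro φ
  rw [inner_add_right, inner_smul_right, inner_opS, inner_opS, inner_opS, ← integral_const_mul,
    ← integral_add (hW.integrable_inner (ftC b).integrable _ _)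
      ((hW.integrable_inner (ftC _).integrable _ _).const_mul _)]
  refine integral_congr_ae (Eventually.of_forall fun ζ => ?_)
  simp only [h.inner_weylU, ftC_genDir]
  push_cast
  linear_combination (-(2 * Real.pi * t * ε * genCoord i ζ * ftC b ζ *
    ⟪toL2 φ, weylU ε t ζ u⟫_ℂ)) * Complex.I_sq

/-- Quantized symbols act on the weighted spaces, uniformly in all parameters. -/
lemma exists_Bd_opS (E : ℝ) (s : ℕ) : ∃ C : ℝ, 0 ≤ C ∧ ∀ ε t : ℝ, |ε| ≤ E → t ∈ Icc (0 : ℝ) 1 →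
    ∀ (K : ℕ → ℝ) (b : 𝓢(ℝ × ℝ, ℂ)), SymbolBound K b → ∀ (u : L2Plane) (κ : ℝ), Bd s κ u →
      Bd s (C * (∑ n ∈ Finset.range (s + 4), K n) * κ) (opS ε t b u) := by
  induction s with
  | zero =>
    obtain ⟨C, hC0, hC⟩ := exists_norm_opS_le E
    refine ⟨C, hC0, fun ε t hε ht K b hb u κ hu => Bd.of_norm_le ?_⟩
    refine (hC ε t hε ht K b hb u).trans ?_
    have : 0 ≤ ∑ n ∈ Finset.range 4, K n := Finset.sum_nonneg fun n _ => hb.nonneg n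
    exact mul_le_mul_of_nonneg_left hu.norm_le (mul_nonneg hC0 this)
  | succ s ih =>
    obtain ⟨C, hC0, hC⟩ := ih
    refine ⟨C * (1 + |E|), by positivity, fun ε t hε ht K b hb u κ hu => ?_⟩
    have hE : 0 ≤ E := (abs_nonneg _).trans hε
    have hκ := hu.1
    set S := ∑ n ∈ Finset.range (s + 1 + 4), K n with hS
    have hS0 : 0 ≤ S := Finset.sum_nonneg fun n _ => hb.nonneg n
    have hS1 : ∑ n ∈ Finset.range (s + 4), K n ≤ S := by
      refine Finset.sum_le_sum_of_subset_of_nonneg (Finset.range_mono (by omega))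
        fun n _ _ => hb.nonneg n
    have hS2 : ∑ n ∈ Finset.range (s + 4), K (n + 1) ≤ S := by
      have h1 := Finset.sum_range_succ' K (s + 4)
      have h2 := hb.nonneg 0
      rw [hS, show s + 1 + 4 = (s + 4) + 1 by ring]
      linarith
    have hle : ∀ {v : L2Plane} {b' : 𝓢(ℝ × ℝ, ℂ)} {K' : ℕ → ℝ}, SymbolBound K' b' →
        ∑ n ∈ Finset.range (s + 4), K' n ≤ S → Bd s κ v → Bd s (C * S * κ) (opS ε t b' v) := by
      intro v b' K' hb' hK' hv
      refine (hC ε t hε ht K' b' hb' v κ hv).mono le_rfl ?_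
      gcongr
    refine Bd.of_isGen ((hle hb hS1 (hu.mono (by omega) le_rfl)).mono le_rfl ?_) fun i => ?_
    · rw [abs_of_nonneg hE]
      have : 0 ≤ C * S * κ := by positivity
      nlinarith
    · obtain ⟨w, hw, hwB⟩ := hu.exists_isGen i
      refine ⟨_, hw.opS ε t b, ?_⟩
      have h1 := hle hb hS1 hwB
      have h2 := (hle (hb.lineDeriv (norm_genDir_le i)) hS2 (hu.mono (by omega) le_rfl)).smul
        (-Complex.I * (t * ε : ℝ))
      refine (h1.add h2).mono le_rfl ?_
      have h3 : ‖-Complex.I * ((t * ε : ℝ) : ℂ)‖ ≤ |E| := by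
        rw [norm_mul, norm_neg, Complex.norm_I, one_mul, Complex.norm_real, Real.norm_eq_abs,
          abs_mul, abs_of_nonneg ht.1, abs_of_nonneg hE]
        calc t * |ε| ≤ 1 * E := mul_le_mul ht.2 hε (abs_nonneg _) zero_le_one
          _ = E := one_mul E
      have h4 : 0 ≤ C * S * κ := by positivity
      nlinarith [mul_le_mul_of_nonneg_right h3 h4]

end WeightedSpaces

/-! ### Normal ordering: words in x and D_x versus x^α D_x^β. -/

section MixedPowers

/-- Complex conjugation of Schwartz functions. -/
noncomputable def conjS : 𝓢(ℝ × ℝ, ℂ) →L[ℝ] 𝓢(ℝ × ℝ, ℂ) :=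
  SchwartzMap.postcompCLM (𝕜 := ℝ) (Complex.conjCLE : ℂ →L[ℝ] ℂ)

lemma conjS_apply (φ : 𝓢(ℝ × ℝ, ℂ)) (z : ℝ × ℝ) : conjS φ z = (starRingEnd ℂ) (φ z) := rfl

lemma conjS_conjS (φ : 𝓢(ℝ × ℝ, ℂ)) : conjS (conjS φ) = φ := by
  ext z; simp [conjS_apply]

lemma conjS_smul (c : ℂ) (φ : 𝓢(ℝ × ℝ, ℂ)) :
    conjS (c • φ) = (starRingEnd ℂ) c • conjS φ := by
  ext z; simp [conjS_apply]

lemma lineDeriv_conjS (v : ℝ × ℝ) (φ : 𝓢(ℝ × ℝ, ℂ)) : ∂_{v} (conjS φ) = conjS (∂_{v} φ) := by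
  ext z
  rw [conjS_apply, SchwartzMap.lineDerivOp_apply_eq_fderiv, SchwartzMap.lineDerivOp_apply_eq_fderiv]
  have h : HasFDerivAt (conjS φ) ((Complex.conjCLE : ℂ →L[ℝ] ℂ).comp (fderiv ℝ φ z)) z :=
    (Complex.conjCLE : ℂ →L[ℝ] ℂ).hasFDerivAt.comp z (φ.hasFDerivAt z)
  rw [h.fderiv]
  rfl

lemma conjS_dS (φ : 𝓢(ℝ × ℝ, ℂ)) :
    conjS (dS φ) = Complex.I • ∂_{((1, 0) : ℝ × ℝ)} (conjS φ) := by
  rw [dS_eq, conjS_smul, lineDeriv_conjS, map_neg, Complex.conj_I, neg_neg]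

/-- Distributions pair bilinearly and the inner product is conjugate linear in the test function.
Conjugation translates the distributional definitions into identities tested on Schwartz functions.
-/
lemma distribution_apply (u : L2Plane) (φ : 𝓢(ℝ × ℝ, ℂ)) :
    (u : 𝓢'(ℝ × ℝ, ℂ)) φ = ⟪toL2 (conjS φ), u⟫_ℂ := by
  rw [Lp.toTemperedDistribution_apply, inner_toL2]
  simp [conjS_apply]

lemma distDx_apply (T : 𝓢'(ℝ × ℝ, ℂ)) (φ : 𝓢(ℝ × ℝ, ℂ)) :
    distDx T (conjS φ) = T (conjS (dS φ)) := by
  have : distDx T (conjS φ) = (-Complex.I) • (∂_{((1, 0) : ℝ × ℝ)} T) (conjS φ) := rfl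
  rw [this, TemperedDistribution.lineDerivOp_apply_apply, conjS_dS, map_smul, map_neg]
  simp

lemma distDx_iterate_apply (T : 𝓢'(ℝ × ℝ, ℂ)) (n : ℕ) (φ : 𝓢(ℝ × ℝ, ℂ)) :
    distDx^[n] T (conjS φ) = T (conjS ((dS ^ n) φ)) := by
  induction n generalizing φ with
  | zero => rfl
  | succ n ih =>
    rw [Function.iterate_succ_apply', distDx_apply, ih, pow_succ]
    rfl

lemma hasTemperateGrowth_ofReal_fst_pow (n : ℕ) :
    (fun z : ℝ × ℝ => (z.1 : ℂ) ^ n).HasTemperateGrowth := by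
  have := hasTemperateGrowth_ofReal_fst
  fun_prop

lemma smulLeftCLM_pow_conjS (n : ℕ) (φ : 𝓢(ℝ × ℝ, ℂ)) :
    SchwartzMap.smulLeftCLM ℂ (fun z : ℝ × ℝ => (z.1 : ℂ) ^ n) (conjS φ) = conjS ((xS ^ n) φ) := by
  have h : ∀ n, ∀ z, (xS ^ n) φ z = (z.1 : ℂ) ^ n * φ z := by
    intro n
    induction n with
    | zero => intro z; simp
    | succ n ih =>
      intro z
      have : (xS ^ (n + 1)) φ = xS ((xS ^ n) φ) := by rw [pow_succ']; rfl
      rw [this, xS_apply, ih, pow_succ]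
      ring
  ext z
  rw [SchwartzMap.smulLeftCLM_apply_apply (hasTemperateGrowth_ofReal_fst_pow n), conjS_apply,
    conjS_apply, h]
  simp

/-- Adjoint form of `x ^ α D_x ^ β` on Schwartz functions. -/
noncomputable def nf (p : ℕ × ℕ) : 𝓢(ℝ × ℝ, ℂ) →L[ℂ] 𝓢(ℝ × ℝ, ℂ) :=
  (dS ^ p.2) ∘L (xS ^ p.1)

/-- Both x and D_x are symmetric, and transposition reverses their order: hence D_x^β x^α on the
test function. -/
lemma isXD_iff {α β : ℕ} {u w : L2Plane} :
    IsXD α β u w ↔ ∀ φ, ⟪toL2 φ, w⟫_ℂ = ⟪toL2 (nf (α, β) φ), u⟫_ℂ := by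
  have key : ∀ φ, TemperedDistribution.smulLeftCLM ℂ (fun z : ℝ × ℝ => (z.1 : ℂ) ^ α)
      (distDx^[β] (u : 𝓢'(ℝ × ℝ, ℂ))) (conjS φ) = ⟪toL2 (nf (α, β) φ), u⟫_ℂ := by
    intro φ
    rw [TemperedDistribution.smulLeftCLM_apply_apply, smulLeftCLM_pow_conjS, distDx_iterate_apply,
      distribution_apply, conjS_conjS]
    rfl
  constructor
  · intro h φ
    rw [← key, ← h, distribution_apply, conjS_conjS]
  · intro h
    refine DFunLike.ext _ _ fun φ => ?_
    rw [← conjS_conjS φ, key, distribution_apply, conjS_conjS, h]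

lemma dS_xS (φ : 𝓢(ℝ × ℝ, ℂ)) : dS (xS φ) = xS (dS φ) + (-Complex.I) • φ := by
  ext z
  simp only [dS_apply, xS_apply, add_apply, smul_apply, smul_eq_mul]
  have h1 : (xS φ : ℝ × ℝ → ℂ) = fun z => (z.1 : ℂ) * φ z := funext fun z => xS_apply φ z
  have h2 : HasFDerivAt (fun z : ℝ × ℝ => (z.1 : ℂ))
      (Complex.ofRealCLM.comp (ContinuousLinearMap.fst ℝ ℝ ℝ)) z :=
    Complex.ofRealCLM.hasFDerivAt.comp z hasFDerivAt_fst
  have h3 : HasFDerivAt (fun z : ℝ × ℝ => (z.1 : ℂ) * φ z) _ z := h2.mul (φ.hasFDerivAt z)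
  rw [h1, h3.fderiv]
  simp
  ring

lemma nf_zero (φ : 𝓢(ℝ × ℝ, ℂ)) : nf (0, 0) φ = φ := rfl

lemma dS_nf (α β : ℕ) (φ : 𝓢(ℝ × ℝ, ℂ)) : dS (nf (α, β) φ) = nf (α, β + 1) φ := by
  simp only [nf, pow_succ']; rfl

/-- This is [x, D_x^β] = iβ D_x^{β−1}. The truncated exponent at β = 0 is harmless because its
coefficient vanishes. -/
lemma xS_nf (α β : ℕ) (φ : 𝓢(ℝ × ℝ, ℂ)) :
    xS (nf (α, β) φ) = nf (α + 1, β) φ + (Complex.I * β) • nf (α, β - 1) φ := by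
  induction β with
  | zero =>
    simp only [nf, pow_succ', pow_zero, Nat.cast_zero, mul_zero, zero_smul, add_zero]; rfl
  | succ β ih =>
    have h1 := congrArg dS ih
    rw [dS_xS, dS_nf, map_add, map_smul, dS_nf, dS_nf] at h1
    have h2 : (Complex.I * β : ℂ) • nf (α, β - 1 + 1) φ = (Complex.I * β : ℂ) • nf (α, β) φ := by
      rcases β with _ | β
      · simp
      · rfl
    rw [h2] at h1
    rw [eq_sub_of_add_eq h1, Nat.add_sub_cancel]
    push_cast
    module

lemma isXD_opXD {α β : ℕ} {u : L2Plane} (h : ∃ w, IsXD α β u w) : IsXD α β u (opXD α β u) := by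
  rw [opXD, dif_pos h]
  exact h.choose_spec

lemma IsXD.opXD_eq {α β : ℕ} {u w : L2Plane} (h : IsXD α β u w) : opXD α β u = w :=
  (isXD_opXD ⟨w, h⟩).unique h

lemma opXD_zero_zero (u : L2Plane) : opXD 0 0 u = u :=
  (isXD_iff.2 fun φ => by rw [nf_zero]).opXD_eq

lemma mem_pairsLE {k : ℕ} {p : ℕ × ℕ} : p ∈ pairsLE k ↔ p.1 + p.2 ≤ k := by
  simp only [pairsLE, Finset.mem_filter, Finset.mem_product, Finset.mem_range]
  omega

/-- Commutators only shorten words, so normal ordering stays within the given length. All words are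
thus controlled by the powers that enter `normB`. -/
lemma wordS_mem_span (l : List Bool) :
    wordS l ∈ Submodule.span ℂ (nf '' {p | p.1 + p.2 ≤ l.length}) := by
  induction l with
  | nil => exact Submodule.subset_span ⟨(0, 0), by simp, rfl⟩
  | cons i l ih =>
    change gen i ∘L wordS l ∈ _
    refine Submodule.span_induction (p := fun A _ => gen i ∘L A ∈ Submodule.span ℂ
      (nf '' {p | p.1 + p.2 ≤ (i :: l).length})) ?_ ?_ ?_ ?_ ih
    · rintro _ ⟨⟨α, β⟩, hp, rfl⟩
      replace hp : α + β ≤ l.length := hp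
      cases i
      · refine Submodule.subset_span ⟨(α, β + 1), by simp; omega, ?_⟩
        ext1 φ
        exact (dS_nf α β φ).symm
      · have : gen true ∘L nf (α, β) = nf (α + 1, β) + (Complex.I * β) • nf (α, β - 1) := by
          ext1 φ
          exact xS_nf α β φ
        rw [this]
        exact Submodule.add_mem _ (Submodule.subset_span ⟨(α + 1, β), by simp; omega, rfl⟩)
          (Submodule.smul_mem _ _ (Submodule.subset_span ⟨(α, β - 1), by simp; omega, rfl⟩))
    · simp
    · intro A B _ _ hA hB
      rw [ContinuousLinearMap.comp_add]
      exact Submodule.add_mem _ hA hB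
    · intro c A _ hA
      rw [ContinuousLinearMap.comp_smul]
      exact Submodule.smul_mem _ _ hA

lemma norm_opXD_le_normB {k : ℕ} {p : ℕ × ℕ} (hp : p.1 + p.2 ≤ k) (u : L2Plane) :
    ‖opXD p.1 p.2 u‖ ≤ normB k u := by
  refine Real.le_sqrt_of_sq_le ?_
  exact Finset.single_le_sum (f := fun p : ℕ × ℕ => ‖opXD p.1 p.2 u‖ ^ 2)
    (fun _ _ => sq_nonneg _) (mem_pairsLE.2 hp)

lemma exists_norm_inner_wordS_le (l : List Bool) : ∃ C : ℝ, 0 ≤ C ∧ ∀ (k : ℕ) (u : L2Plane),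
    l.length ≤ k → MemB k u → ∀ φ, ‖⟪toL2 (wordS l φ), u⟫_ℂ‖ ≤ C * normB k u * ‖toL2 φ‖ := by
  have key := Submodule.span_induction (p := fun (A : 𝓢(ℝ × ℝ, ℂ) →L[ℂ] 𝓢(ℝ × ℝ, ℂ))
    (_ : A ∈ Submodule.span ℂ (nf '' {p | p.1 + p.2 ≤ l.length})) => ∃ C : ℝ, 0 ≤ C ∧
      ∀ (k : ℕ) (u : L2Plane), l.length ≤ k → MemB k u →
        ∀ φ, ‖⟪toL2 (A φ), u⟫_ℂ‖ ≤ C * normB k u * ‖toL2 φ‖)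
  refine key ?_ ?_ ?_ ?_ (wordS_mem_span l)
  · rintro _ ⟨⟨α, β⟩, hp, rfl⟩
    replace hp : α + β ≤ l.length := hp
    refine ⟨1, zero_le_one, fun k u hk hu φ => ?_⟩
    rw [← isXD_iff.1 (isXD_opXD (hu α β (hp.trans hk))) φ, one_mul, mul_comm]
    exact (norm_inner_le_norm _ _).trans (mul_le_mul_of_nonneg_left
      (norm_opXD_le_normB (p := (α, β)) (hp.trans hk) u) (norm_nonneg _))
  · exact ⟨0, le_rfl, fun k u _ _ φ => by
      rw [zero_apply, map_zero]; simp⟩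
  · rintro A B _ _ ⟨C, hC0, hC⟩ ⟨C', hC0', hC'⟩
    refine ⟨C + C', add_nonneg hC0 hC0', fun k u hk hu φ => ?_⟩
    rw [add_apply, map_add, inner_add_left, add_mul, add_mul]
    exact (norm_add_le _ _).trans (add_le_add (hC k u hk hu φ) (hC' k u hk hu φ))
  · rintro c A _ ⟨C, hC0, hC⟩
    refine ⟨‖c‖ * C, by positivity, fun k u hk hu φ => ?_⟩
    rw [smul_apply, map_smul, inner_smul_left, norm_mul, RCLike.norm_conj, mul_assoc, mul_assoc,
      ← mul_assoc C]
    exact mul_le_mul_of_nonneg_left (hC k u hk hu φ) (norm_nonneg _)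

lemma MemB.exists_Bd (k : ℕ) : ∃ C : ℝ, 0 ≤ C ∧ ∀ u, MemB k u → Bd k (C * normB k u) u := by
  choose C hC0 hC using exists_norm_inner_wordS_le
  have hfin := (List.finite_length_le Bool k)
  refine ⟨∑ l ∈ hfin.toFinset, C l, Finset.sum_nonneg fun l _ => hC0 l, fun u hu =>
    ⟨mul_nonneg (Finset.sum_nonneg fun l _ => hC0 l) (Real.sqrt_nonneg _), fun l hl φ => ?_⟩⟩
  refine (hC l k u hl hu φ).trans ?_
  have : C l ≤ ∑ l ∈ hfin.toFinset, C l :=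
    Finset.single_le_sum (f := C) (fun l _ => hC0 l) (by simpa using hl)
  have h0 : 0 ≤ normB k u := Real.sqrt_nonneg _
  gcongr

lemma wordS_append (l l' : List Bool) (φ : 𝓢(ℝ × ℝ, ℂ)) :
    wordS (l ++ l') φ = wordS l (wordS l' φ) := by
  induction l with
  | nil => rfl
  | cons i l ih => exact congrArg (gen i) ih

lemma wordS_replicate (n : ℕ) (i : Bool) : wordS (List.replicate n i) = gen i ^ n := by
  induction n with
  | zero => rfl
  | succ n ih => rw [List.replicate_succ, pow_succ', ← ih]; rfl

/-- The normally ordered monomial is itself a word, so the converse comparison loses no constant. -/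
lemma Bd.exists_isXD {k : ℕ} {K : ℝ} {u : L2Plane} (h : Bd k K u) {α β : ℕ} (hk : α + β ≤ k) :
    ∃ w, IsXD α β u w ∧ ‖w‖ ≤ K := by
  have hn : ∀ φ, nf (α, β) φ = wordS (List.replicate β false ++ List.replicate α true) φ := by
    intro φ
    rw [wordS_append, wordS_replicate, wordS_replicate]
    rfl
  let f : 𝓢(ℝ × ℝ, ℂ) →ₗ[ℂ] ℂ :=
    { toFun := fun φ => ⟪u, toL2 (nf (α, β) φ)⟫_ℂ
      map_add' := fun φ ψ => by simp only [map_add, inner_add_right]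
      map_smul' := fun c φ => by simp only [map_smul, inner_smul_right]; rfl }
  obtain ⟨w, hwn, hw⟩ := exists_inner_toL2_eq f h.1 fun φ => by
    change ‖⟪u, toL2 (nf (α, β) φ)⟫_ℂ‖ ≤ _
    rw [norm_inner_symm, hn]
    exact h.2 _ (by simp; omega) φ
  refine ⟨w, isXD_iff.2 fun φ => ?_, hwn⟩
  rw [← inner_conj_symm, hw]
  exact inner_conj_symm (𝕜 := ℂ) (toL2 (nf (α, β) φ)) u

lemma Bd.memB {k : ℕ} {K : ℝ} {u : L2Plane} (h : Bd k K u) : MemB k u := fun _ _ hk =>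
  let ⟨w, hw, _⟩ := h.exists_isXD hk
  ⟨w, hw⟩

lemma Bd.normB_le {k : ℕ} {K : ℝ} {u : L2Plane} (h : Bd k K u) :
    normB k u ≤ √((pairsLE k).card) * K := by
  have h1 : ∑ p ∈ pairsLE k, ‖opXD p.1 p.2 u‖ ^ 2 ≤ (pairsLE k).card * K ^ 2 := by
    rw [← nsmul_eq_mul]
    refine Finset.sum_le_card_nsmul _ _ _ fun p hp => ?_
    obtain ⟨w, hw, hn⟩ := h.exists_isXD (mem_pairsLE.1 hp)
    rw [hw.opXD_eq]
    gcongr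
  refine (Real.sqrt_le_sqrt h1).trans_eq ?_
  rw [Real.sqrt_mul (by positivity), Real.sqrt_sq h.1]

lemma Bd.opXD_isGen_false {j : ℕ} {K : ℝ} {u w : L2Plane} (h : Bd (j + 1) K u)
    (hw : IsGen false u w) {α β : ℕ} (hk : α + β ≤ j) :
    opXD α β w = opXD α (β + 1) u := by
  obtain ⟨v, hv, -⟩ := h.exists_isXD (show α + (β + 1) ≤ j + 1 by omega)
  rw [hv.opXD_eq]
  refine (isXD_iff.2 fun φ => ?_ : IsXD α β w v).opXD_eq
  rw [isXD_iff.1 hv, ← dS_nf]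
  exact (hw _).symm

/-- Moving the factor x of w = x u to the left through D_x^β leaves one commutator term. It is the
origin of the middle term in `termS`. -/
lemma Bd.opXD_isGen_true {j : ℕ} {K : ℝ} {u w : L2Plane} (h : Bd (j + 1) K u)
    (hw : IsGen true u w) {α β : ℕ} (hk : α + β ≤ j) :
    opXD α β w = opXD (α + 1) β u - (Complex.I * β) • opXD α (β - 1) u := by
  obtain ⟨v, hv, -⟩ := h.exists_isXD (show (α + 1) + β ≤ j + 1 by omega)
  obtain ⟨v', hv', -⟩ := h.exists_isXD (show α + (β - 1) ≤ j + 1 by omega)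
  rw [hv.opXD_eq, hv'.opXD_eq]
  refine (isXD_iff.2 fun φ => ?_ : IsXD α β w _).opXD_eq
  rw [hw, inner_sub_right, inner_smul_right, isXD_iff.1 hv, isXD_iff.1 hv']
  change _ = ⟪toL2 (xS (nf (α, β) φ)), u⟫_ℂ
  rw [xS_nf, map_add, map_smul, inner_add_left, inner_smul_left]
  simp
  ring

end MixedPowers

/-! ### Differentiation of Op_t(b) in t. -/

section TaylorExpansion

lemma weylS_apply (ε t : ℝ) (ζ : ℂ) (φ : 𝓢(ℝ × ℝ, ℂ)) (z : ℝ × ℝ) :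
    weylS ε t ζ φ z = Complex.exp (((2 * Real.pi ^ 2 * ζ.re * ζ.im * ε ^ 2 * (1 - t ^ 2) +
        2 * Real.pi * ζ.re * t * ε * z.1 + 2 * Real.pi * ζ.re * z.2 : ℝ) : ℂ) * Complex.I) *
      φ (z + (-(2 * Real.pi * t * ε * ζ.im), 2 * Real.pi * ε ^ 2 * ζ.im)) :=
  rhoS_apply _ _ _ φ z

/-- The exponent changes by 2πiε(σx − τD_x) ds, and σx − τD_x commutes with σP_s + τQ_s. The
exponential is therefore differentiated as in the scalar case, with no ordering correction. -/
lemma hasDerivAt_weylS (ε s : ℝ) (ζ : ℂ) (φ : 𝓢(ℝ × ℝ, ℂ)) (z : ℝ × ℝ) :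
    HasDerivAt (fun s => weylS ε s ζ φ z) (2 * Real.pi * Complex.I * ε *
      (ζ.re * weylS ε s ζ (xS φ) z - ζ.im * weylS ε s ζ (dS φ) z)) s := by
  simp only [weylS_apply, xS_apply, dS_apply]
  have h1 : HasDerivAt (fun s : ℝ => 2 * Real.pi ^ 2 * ζ.re * ζ.im * ε ^ 2 * (1 - s ^ 2) +
      2 * Real.pi * ζ.re * s * ε * z.1 + 2 * Real.pi * ζ.re * z.2)
      (2 * Real.pi ^ 2 * ζ.re * ζ.im * ε ^ 2 * (-(2 * s)) + 2 * Real.pi * ζ.re * ε * z.1) s := by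
    have e1 : HasDerivAt (fun s : ℝ => 1 - s ^ 2) (-(2 * s)) s := by
      simpa using ((hasDerivAt_pow 2 s).const_sub 1)
    have e2 : HasDerivAt (fun s : ℝ => 2 * Real.pi * ζ.re * s * ε * z.1)
        (2 * Real.pi * ζ.re * ε * z.1) s := by
      simpa using (((hasDerivAt_id s).const_mul (2 * Real.pi * ζ.re)).mul_const ε).mul_const z.1
    exact ((e1.const_mul _).add e2).add_const _
  have h2 := (h1.ofReal_comp.mul_const Complex.I).cexp
  have h3 : HasDerivAt (fun s : ℝ => z + (-(2 * Real.pi * s * ε * ζ.im),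
      2 * Real.pi * ε ^ 2 * ζ.im)) (-(2 * Real.pi * ε * ζ.im), 0) s := by
    refine HasDerivAt.const_add z (HasDerivAt.prodMk ?_ (hasDerivAt_const _ _))
    have e := ((((hasDerivAt_id s).const_mul (2 * Real.pi)).mul_const ε).mul_const ζ.im).fun_neg
    simpa using e
  have h4 := (φ.hasFDerivAt (z + (-(2 * Real.pi * s * ε * ζ.im),
    2 * Real.pi * ε ^ 2 * ζ.im))).comp_hasDerivAt s h3
  have h5 : ((-(2 * Real.pi * ε * ζ.im), 0) : ℝ × ℝ) = (-(2 * Real.pi * ε * ζ.im)) • (1, 0) := by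
    simp
  rw [h5, map_smul] at h4
  refine (h2.mul h4).congr_deriv ?_
  simp only [Complex.real_smul, Prod.fst_add]
  push_cast
  generalize Complex.exp _ = e
  generalize (fderiv ℝ φ _) _ = d
  simp only [Function.comp_apply]
  linear_combination (-(2 * Real.pi * ε * ζ.im * e * d)) * Complex.I_sq

lemma norm_weylS_apply_le (ε t : ℝ) (ζ : ℂ) (φ : 𝓢(ℝ × ℝ, ℂ)) (z : ℝ × ℝ) :
    ‖weylS ε t ζ φ z‖ ≤ SchwartzMap.seminorm ℝ 0 0 φ := by
  rw [weylS_apply, norm_mul, Complex.norm_exp_ofReal_mul_I, one_mul]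
  exact SchwartzMap.norm_le_seminorm ℝ φ _

lemma continuous_weylS_apply (ε : ℝ) (ζ : ℂ) (φ : 𝓢(ℝ × ℝ, ℂ)) :
    Continuous fun p : ℝ × (ℝ × ℝ) => weylS ε p.1 ζ φ p.2 := by
  simp only [weylS_apply]
  exact (by fun_prop : Continuous fun p : ℝ × (ℝ × ℝ) => _).mul (φ.continuous.comp (by fun_prop))

lemma continuous_weylU_time (ε : ℝ) (ζ : ℂ) (u : L2Plane) :
    Continuous fun t : ℝ => weylU ε t ζ u :=
  (continuous_weylU ε u).comp (by fun_prop : Continuous fun t : ℝ => (t, ζ))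

/-- The pointwise derivative is integrated against a Schwartz function and Fubini exchanges the
integrals; no differentiability in the L² norm is needed. -/
lemma toL2_weylS_sub (ε t : ℝ) (ζ : ℂ) (φ : 𝓢(ℝ × ℝ, ℂ)) :
    toL2 (weylS ε t ζ φ) - toL2 (weylS ε 0 ζ φ) = ∫ s in (0 : ℝ)..t,
      (2 * Real.pi * Complex.I * ε : ℂ) • ((ζ.re : ℂ) • weylU ε s ζ (toL2 (xS φ)) -
        (ζ.im : ℂ) • weylU ε s ζ (toL2 (dS φ))) := by
  have hc : Continuous fun s => (2 * Real.pi * Complex.I * ε : ℂ) •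
      ((ζ.re : ℂ) • weylU ε s ζ (toL2 (xS φ)) - (ζ.im : ℂ) • weylU ε s ζ (toL2 (dS φ))) :=
    Continuous.fun_const_smul (Continuous.fun_sub
      (Continuous.fun_const_smul (continuous_weylU_time ε ζ _) _)
      (Continuous.fun_const_smul (continuous_weylU_time ε ζ _) _)) _
  refine eq_of_inner_toL2 fun ψ => ?_
  have hL := ((innerSL ℂ (toL2 ψ))).intervalIntegral_comp_comm (hc.intervalIntegrable (μ := volume) 0 t)
  simp only [innerSL_apply_apply] at hL
  rw [← hL]
  set f : ℝ → ℝ × ℝ → ℂ := fun s z => (starRingEnd ℂ) (ψ z) * (2 * Real.pi * Complex.I * ε *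
      (ζ.re * weylS ε s ζ (xS φ) z - ζ.im * weylS ε s ζ (dS φ) z)) with hf
  have h1 : ∀ s, ⟪toL2 ψ, (2 * Real.pi * Complex.I * ε : ℂ) •
      ((ζ.re : ℂ) • weylU ε s ζ (toL2 (xS φ)) - (ζ.im : ℂ) • weylU ε s ζ (toL2 (dS φ)))⟫_ℂ =
      ∫ z, f s z := by
    intro s
    have e : (2 * Real.pi * Complex.I * ε : ℂ) • ((ζ.re : ℂ) • weylU ε s ζ (toL2 (xS φ)) -
        (ζ.im : ℂ) • weylU ε s ζ (toL2 (dS φ))) = toL2 ((2 * Real.pi * Complex.I * ε : ℂ) •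
        ((ζ.re : ℂ) • weylS ε s ζ (xS φ) - (ζ.im : ℂ) • weylS ε s ζ (dS φ))) := by
      simp only [weylU_toL2, map_smul, map_sub]
    rw [e, inner_toL2_toL2]
    rfl
  simp_rw [h1]
  have hfc : Continuous (Function.uncurry f) :=
    ((Complex.continuous_conj.comp (ψ.continuous.comp continuous_snd))).mul
      (continuous_const.mul ((continuous_const.mul (continuous_weylS_apply ε ζ (xS φ))).sub
        (continuous_const.mul (continuous_weylS_apply ε ζ (dS φ)))))
  rw [intervalIntegral_integral_swap, inner_sub_right, inner_toL2_toL2, inner_toL2_toL2,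
    ← integral_sub]
  · refine integral_congr_ae (Eventually.of_forall fun z => ?_)
    have := intervalIntegral.integral_eq_sub_of_hasDerivAt (a := 0) (b := t)
      (fun s _ => (hasDerivAt_weylS ε s ζ φ z).const_mul ((starRingEnd ℂ) (ψ z)))
      (Continuous.intervalIntegrable (hfc.comp (by fun_prop : Continuous fun s => (s, z))) _ _)
    exact this.symm
  · exact (ψ.integrable.norm.mul_const (SchwartzMap.seminorm ℝ 0 0 φ)).mono'
      (((Complex.continuous_conj.comp ψ.continuous).mul
        (SchwartzMap.continuous _)).aestronglyMeasurable) (Eventually.of_forall fun z => by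
        rw [norm_mul, RCLike.norm_conj]
        exact mul_le_mul_of_nonneg_left (norm_weylS_apply_le _ _ _ _ _) (norm_nonneg _))
  · exact (ψ.integrable.norm.mul_const (SchwartzMap.seminorm ℝ 0 0 φ)).mono'
      (((Complex.continuous_conj.comp ψ.continuous).mul
        (SchwartzMap.continuous _)).aestronglyMeasurable) (Eventually.of_forall fun z => by
        rw [norm_mul, RCLike.norm_conj]
        exact mul_le_mul_of_nonneg_left (norm_weylS_apply_le _ _ _ _ _) (norm_nonneg _))
  · have hI : Integrable (fun p : ℝ × (ℝ × ℝ) => (‖2 * Real.pi * Complex.I * ε‖ *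
        (‖(ζ.re : ℂ)‖ * SchwartzMap.seminorm ℝ 0 0 (xS φ) +
          ‖(ζ.im : ℂ)‖ * SchwartzMap.seminorm ℝ 0 0 (dS φ))) * ‖ψ p.2‖)
        ((volume.restrict (uIoc 0 t)).prod volume) :=
      Integrable.mul_prod (f := fun _ : ℝ => _) (g := fun z => ‖ψ z‖)
        (integrable_const_iff.2 (Or.inr (by
          rw [isFiniteMeasure_restrict, uIoc]; exact measure_Ioc_lt_top.ne))) ψ.integrable.norm
    refine hI.mono' hfc.aestronglyMeasurable (Eventually.of_forall fun p => ?_)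
    simp only [Function.uncurry, hf, norm_mul, RCLike.norm_conj]
    rw [mul_comm]
    refine mul_le_mul_of_nonneg_right (mul_le_mul_of_nonneg_left ?_ (by positivity))
      (norm_nonneg _)
    refine (norm_sub_le _ _).trans (add_le_add ?_ ?_) <;> rw [norm_mul] <;>
      exact mul_le_mul_of_nonneg_left (norm_weylS_apply_le _ _ _ _ _) (norm_nonneg _)

/-- For u that is not Schwartz the formula is transposed: W(ζ)* = W(−ζ) acts on the test function ψ.
Moving x and D_x back onto u creates shifts proportional to στ − τσ, which cancel. -/
lemma inner_weylU_sub {u w₁ w₂ : L2Plane} (h₁ : IsGen true u w₁) (h₂ : IsGen false u w₂)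
    (ε t : ℝ) (ζ : ℂ) (ψ : 𝓢(ℝ × ℝ, ℂ)) :
    ⟪toL2 ψ, weylU ε t ζ u⟫_ℂ - ⟪toL2 ψ, weylU ε 0 ζ u⟫_ℂ = ∫ s in (0 : ℝ)..t,
      2 * Real.pi * Complex.I * ε *
        (ζ.re * ⟪toL2 ψ, weylU ε s ζ w₁⟫_ℂ - ζ.im * ⟪toL2 ψ, weylU ε s ζ w₂⟫_ℂ) := by
  have hc : Continuous fun s => (2 * Real.pi * Complex.I * ε : ℂ) •
      (((-ζ).re : ℂ) • weylU ε s (-ζ) (toL2 (xS ψ)) -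
        ((-ζ).im : ℂ) • weylU ε s (-ζ) (toL2 (dS ψ))) :=
    Continuous.fun_const_smul (Continuous.fun_sub
      (Continuous.fun_const_smul (continuous_weylU_time ε _ _) _)
      (Continuous.fun_const_smul (continuous_weylU_time ε _ _) _)) _
  have hL := ((innerSL ℂ u)).intervalIntegral_comp_comm (hc.intervalIntegrable (μ := volume) 0 t)
  simp only [innerSL_apply_apply] at hL
  have hJ := (Complex.conjCLE : ℂ →L[ℝ] ℂ).intervalIntegral_comp_comm
    (Continuous.intervalIntegrable (μ := volume) ((continuous_const (y := u)).inner hc) 0 t)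
  rw [inner_weylU_left, inner_weylU_left, ← inner_sub_left, toL2_weylS_sub, ← inner_conj_symm,
    ← hL]
  refine Eq.trans hJ.symm (intervalIntegral.integral_congr fun s _ => ?_)
  have key : ∀ s, (starRingEnd ℂ) ⟪u, (2 * Real.pi * Complex.I * ε : ℂ) •
      (((-ζ).re : ℂ) • weylU ε s (-ζ) (toL2 (xS ψ)) -
        ((-ζ).im : ℂ) • weylU ε s (-ζ) (toL2 (dS ψ)))⟫_ℂ = 2 * Real.pi * Complex.I * ε *
        (ζ.re * ⟪toL2 ψ, weylU ε s ζ w₁⟫_ℂ - ζ.im * ⟪toL2 ψ, weylU ε s ζ w₂⟫_ℂ) := by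
    intro s
    rw [inner_conj_symm, inner_smul_left, inner_sub_left, inner_smul_left, inner_smul_left,
      (isWeylSystem_weylU ε s).inner_left, (isWeylSystem_weylU ε s).inner_left,
      h₁.inner_weylU, h₂.inner_weylU]
    simp only [neg_neg, map_mul, Complex.conj_ofReal, Complex.conj_I, map_ofNat, Complex.neg_re,
      Complex.neg_im, Complex.ofReal_neg, map_neg, genCoord, gen]
    push_cast
    ring
  exact key s

lemma continuous_inner_opS (ε : ℝ) (b : 𝓢(ℝ × ℝ, ℂ)) (v u : L2Plane) :
    Continuous fun t => ⟪v, opS ε t b u⟫_ℂ := by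
  simp_rw [inner_opS]
  refine continuous_of_dominated (bound := fun ζ => ‖ftC b ζ‖ * (‖v‖ * ‖u‖)) (fun t => ?_)
    (fun t => Eventually.of_forall fun ζ => ?_) ((ftC b).integrable.norm.mul_const _)
    (Eventually.of_forall fun ζ => ?_)
  · exact ((isWeylSystem_weylU ε t).integrable_inner (ftC b).integrable v u).aestronglyMeasurable
  · rw [norm_mul]
    exact mul_le_mul_of_nonneg_left ((isWeylSystem_weylU ε t).norm_inner_le _ _ _) (norm_nonneg _)
  · exact continuous_const.mul (continuous_const.inner (continuous_weylU_time ε ζ u))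

/-- First order Taylor formula for the quantization in the deformation parameter. -/
lemma inner_opS_sub {u w₁ w₂ : L2Plane} (h₁ : IsGen true u w₁) (h₂ : IsGen false u w₂)
    (ε t : ℝ) (b : 𝓢(ℝ × ℝ, ℂ)) (ψ : 𝓢(ℝ × ℝ, ℂ)) :
    ⟪toL2 ψ, opS ε t b u⟫_ℂ - ⟪toL2 ψ, opS ε 0 b u⟫_ℂ = ∫ s in (0 : ℝ)..t,
      (ε : ℂ) * (⟪toL2 ψ, opS ε s (∂_{((1, 0) : ℝ × ℝ)} b) w₁⟫_ℂ -
        ⟪toL2 ψ, opS ε s (∂_{((0, 1) : ℝ × ℝ)} b) w₂⟫_ℂ) := by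
  set b₁ : 𝓢(ℝ × ℝ, ℂ) := ∂_{((1, 0) : ℝ × ℝ)} b with hb₁
  set b₂ : 𝓢(ℝ × ℝ, ℂ) := ∂_{((0, 1) : ℝ × ℝ)} b with hb₂
  set f : ℝ → ℂ → ℂ := fun s ζ => (ε : ℂ) * (ftC b₁ ζ * ⟪toL2 ψ, weylU ε s ζ w₁⟫_ℂ -
    ftC b₂ ζ * ⟪toL2 ψ, weylU ε s ζ w₂⟫_ℂ) with hf
  have hi := fun (s : ℝ) (c : 𝓢(ℝ × ℝ, ℂ)) (w : L2Plane) =>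
    (isWeylSystem_weylU ε s).integrable_inner (ftC c).integrable (toL2 ψ) w
  have h3 : ∀ s, (ε : ℂ) * (⟪toL2 ψ, opS ε s b₁ w₁⟫_ℂ - ⟪toL2 ψ, opS ε s b₂ w₂⟫_ℂ) =
      ∫ ζ, f s ζ := by
    intro s
    rw [inner_opS, inner_opS, ← integral_sub (hi s b₁ w₁) (hi s b₂ w₂), ← integral_const_mul]
  simp_rw [h3]
  have hcu : ∀ w, Continuous fun p : ℝ × ℂ => ⟪toL2 ψ, weylU ε p.1 p.2 w⟫_ℂ := fun w =>
    continuous_const.inner (continuous_weylU ε w)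
  have hfc : Continuous (Function.uncurry f) :=
    continuous_const.mul ((((ftC b₁).continuous.comp continuous_snd).mul (hcu w₁)).sub
      (((ftC b₂).continuous.comp continuous_snd).mul (hcu w₂)))
  rw [intervalIntegral_integral_swap, inner_opS, inner_opS, ← integral_sub (hi t b u) (hi 0 b u)]
  · refine integral_congr_ae (Eventually.of_forall fun ζ => ?_)
    simp only [hf]
    rw [← mul_sub, inner_weylU_sub h₁ h₂, ← intervalIntegral.integral_const_mul]
    refine intervalIntegral.integral_congr fun s _ => ?_
    -- The factors 2πiσ and 2πiτ turn b̂ into the transforms of ∂₁b and ∂₂b; so ∂₁b goes with x and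
    -- ∂₂b with D_x.
    simp only [hb₁, hb₂, ftC_lineDeriv_fst, ftC_lineDeriv_snd]
    ring
  · have hI : Integrable (fun p : ℝ × ℂ => 1 * (‖(ε : ℂ)‖ * (‖ftC b₁ p.2‖ * (‖toL2 ψ‖ * ‖w₁‖) +
        ‖ftC b₂ p.2‖ * (‖toL2 ψ‖ * ‖w₂‖)))) ((volume.restrict (uIoc 0 t)).prod volume) :=
      Integrable.mul_prod (f := fun _ : ℝ => (1 : ℝ)) (g := fun ζ => ‖(ε : ℂ)‖ *
        (‖ftC b₁ ζ‖ * (‖toL2 ψ‖ * ‖w₁‖) + ‖ftC b₂ ζ‖ * (‖toL2 ψ‖ * ‖w₂‖)))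
        (integrable_const_iff.2 (Or.inr (by
          rw [isFiniteMeasure_restrict, uIoc]; exact measure_Ioc_lt_top.ne)))
        ((((ftC b₁).integrable.norm.mul_const _).add
          ((ftC b₂).integrable.norm.mul_const _)).const_mul _)
    refine hI.mono' hfc.aestronglyMeasurable (Eventually.of_forall fun p => ?_)
    simp only [Function.uncurry, hf, norm_mul, one_mul]
    refine mul_le_mul_of_nonneg_left ((norm_sub_le _ _).trans ?_) (norm_nonneg _)
    rw [norm_mul, norm_mul]
    have := fun w => (isWeylSystem_weylU ε p.1).norm_inner_le (toL2 ψ) w p.2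
    exact add_le_add (mul_le_mul_of_nonneg_left (this _) (norm_nonneg _))
      (mul_le_mul_of_nonneg_left (this _) (norm_nonneg _))

end TaylorExpansion

/-! ### Taylor coefficients and remainder in t. -/

section TaylorTerms

/-- `∂₁` and `∂₂` on Schwartz functions. -/
noncomputable def partialS (v : ℝ × ℝ) : 𝓢(ℝ × ℝ, ℂ) →L[ℂ] 𝓢(ℝ × ℝ, ℂ) :=
  LineDeriv.lineDerivOpCLM ℂ 𝓢(ℝ × ℝ, ℂ) v

/-- The symbol that multiplies `x ^ k₁ D_x ^ k₂` in the `j`-th term of the Taylor expansion of the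
quantization, for Schwartz symbols. -/
noncomputable def termS : ℕ → ℕ → ℕ → 𝓢(ℝ × ℝ, ℂ) →L[ℂ] 𝓢(ℝ × ℝ, ℂ)
  | 0, k₁, k₂ => if k₁ = 0 ∧ k₂ = 0 then ContinuousLinearMap.id ℂ _ else 0
  -- The recursion reads (j + 1)T_{j+1}(b)u = T_j(∂₁b)(xu) − T_j(∂₂b)(D_x u). Since x^k D_x^l x =
  -- x^{k+1}D_x^l − i l x^k D_x^{l−1}, the first two terms come from ∂₁b and the third from ∂₂b.
  | j + 1, k₁, k₂ => ((j : ℂ) + 1)⁻¹ •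
      ((if k₁ = 0 then 0 else termS j (k₁ - 1) k₂ ∘L partialS (1, 0))
        - (Complex.I * (k₂ + 1)) • (termS j k₁ (k₂ + 1) ∘L partialS (1, 0))
        - (if k₂ = 0 then 0 else termS j k₁ (k₂ - 1) ∘L partialS (0, 1)))

lemma termS_eq_zero {j k₁ k₂ : ℕ} (h : j < k₁ + k₂) : termS j k₁ k₂ = 0 := by
  induction j generalizing k₁ k₂ with
  | zero => rw [termS, if_neg (by omega)]
  | succ j ih =>
    rw [termS]
    have h1 : (if k₁ = 0 then 0 else termS j (k₁ - 1) k₂ ∘L partialS (1, 0)) = 0 := by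
      split_ifs with h0
      · rfl
      · rw [ih (by omega), ContinuousLinearMap.zero_comp]
    have h2 : (if k₂ = 0 then 0 else termS j k₁ (k₂ - 1) ∘L partialS (0, 1)) = 0 := by
      split_ifs with h0
      · rfl
      · rw [ih (by omega), ContinuousLinearMap.zero_comp]
    rw [h1, h2, ih (by omega), ContinuousLinearMap.zero_comp]
    simp

lemma opS_zero (ε t : ℝ) (u : L2Plane) : opS ε t 0 u = 0 := by
  simpa using opS_smul ε t 0 0 u

lemma opS_sub (ε t : ℝ) (b b' : 𝓢(ℝ × ℝ, ℂ)) (u : L2Plane) :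
    opS ε t (b - b') u = opS ε t b u - opS ε t b' u := by
  have := opS_add ε t b ((-1 : ℂ) • b') u
  rw [opS_smul] at this
  simpa [sub_eq_add_neg] using this

/-- The `j`-th Taylor coefficient of the quantization of `b`. -/
noncomputable def taylorS (ε : ℝ) (j : ℕ) (b : 𝓢(ℝ × ℝ, ℂ)) (u : L2Plane) : L2Plane :=
  ∑ k ∈ pairsLE j, opS ε 0 (termS j k.1 k.2 b) (opXD k.1 k.2 u)

/-- Enlarging the triangle to a square where the summand vanishes allows each index to be shifted
separately. -/
lemma sum_pairsLE {E : Type*} [AddCommMonoid E] {j n : ℕ} (hn : j < n) (f : ℕ → ℕ → E)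
    (hf : ∀ a b, j < a + b → f a b = 0) :
    ∑ k ∈ pairsLE j, f k.1 k.2 = ∑ a ∈ Finset.range n, ∑ b ∈ Finset.range n, f a b := by
  rw [← Finset.sum_product']
  refine Finset.sum_subset (fun p hp => ?_) fun p _ hp => ?_
  · have := mem_pairsLE.1 hp
    simp only [Finset.mem_product, Finset.mem_range]
    omega
  · exact hf _ _ (not_le.1 fun h => hp (mem_pairsLE.2 h))

lemma sum_range_shift_pred {E : Type*} [AddCommMonoid E] (F : ℕ → E) (n : ℕ) (hF : F n = 0) :
    ∑ a ∈ Finset.range (n + 1), (if a = 0 then 0 else F (a - 1)) =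
      ∑ a ∈ Finset.range (n + 1), F a := by
  rw [Finset.sum_range_succ', Finset.sum_range_succ, hF]
  simp

lemma sum_range_shift_succ {E : Type*} [AddCommMonoid E] (F : ℕ → E) (n : ℕ) (h0 : F 0 = 0)
    (hF : F n = 0) : ∑ a ∈ Finset.range n, F (a + 1) = ∑ a ∈ Finset.range n, F a := by
  have h := Finset.sum_range_succ' F n
  rw [Finset.sum_range_succ, hF, h0, add_zero, add_zero] at h
  exact h.symm

lemma taylorS_zero (ε : ℝ) (b : 𝓢(ℝ × ℝ, ℂ)) (u : L2Plane) : taylorS ε 0 b u = opS ε 0 b u := by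
  have : pairsLE 0 = {(0, 0)} := by
    ext ⟨a, b⟩
    simp [mem_pairsLE]
  rw [taylorS, this, Finset.sum_singleton, opXD_zero_zero]
  simp [termS]

lemma taylorS_succ {j : ℕ} {K : ℝ} {u w₁ w₂ : L2Plane} (hu : Bd (j + 1) K u)
    (h₁ : IsGen true u w₁) (h₂ : IsGen false u w₂) (ε : ℝ) (b : 𝓢(ℝ × ℝ, ℂ)) :
    ((j : ℂ) + 1) • taylorS ε (j + 1) b u =
      taylorS ε j (∂_{((1, 0) : ℝ × ℝ)} b) w₁ - taylorS ε j (∂_{((0, 1) : ℝ × ℝ)} b) w₂ := by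
  set b₁ : 𝓢(ℝ × ℝ, ℂ) := ∂_{((1, 0) : ℝ × ℝ)} b with hb₁
  set b₂ : 𝓢(ℝ × ℝ, ℂ) := ∂_{((0, 1) : ℝ × ℝ)} b with hb₂
  have hvan : ∀ (c : 𝓢(ℝ × ℝ, ℂ)) (k l : ℕ), j < k + l → ∀ v, opS ε 0 (termS j k l c) v = 0 := by
    intro c k l hkl v
    rw [termS_eq_zero hkl, zero_apply, opS_zero]
  have e0 : taylorS ε (j + 1) b u = ∑ k ∈ Finset.range (j + 2), ∑ l ∈ Finset.range (j + 2),
      opS ε 0 (termS (j + 1) k l b) (opXD k l u) := by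
    refine sum_pairsLE (by omega) (fun k l => opS ε 0 (termS (j + 1) k l b) (opXD k l u)) ?_
    intro k l hkl
    rw [termS_eq_zero hkl, zero_apply, opS_zero]
  have e1 : taylorS ε j b₁ w₁ = ∑ k ∈ Finset.range (j + 2), ∑ l ∈ Finset.range (j + 2),
      (opS ε 0 (termS j k l b₁) (opXD (k + 1) l u) -
        (Complex.I * l) • opS ε 0 (termS j k l b₁) (opXD k (l - 1) u)) := by
    refine (sum_pairsLE (show j < j + 2 by omega)
      (fun k l => opS ε 0 (termS j k l b₁) (opXD k l w₁)) fun k l hkl => hvan _ _ _ hkl _).trans ?_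
    refine Finset.sum_congr rfl fun k _ => Finset.sum_congr rfl fun l _ => ?_
    rcases le_or_gt (k + l) j with hkl | hkl
    · rw [hu.opXD_isGen_true h₁ hkl, map_sub, map_smul]
    · simp only [hvan _ _ _ hkl]; simp
  have e2 : taylorS ε j b₂ w₂ = ∑ k ∈ Finset.range (j + 2), ∑ l ∈ Finset.range (j + 2),
      opS ε 0 (termS j k l b₂) (opXD k (l + 1) u) := by
    refine (sum_pairsLE (show j < j + 2 by omega)
      (fun k l => opS ε 0 (termS j k l b₂) (opXD k l w₂)) fun k l hkl => hvan _ _ _ hkl _).trans ?_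
    refine Finset.sum_congr rfl fun k _ => Finset.sum_congr rfl fun l _ => ?_
    rcases le_or_gt (k + l) j with hkl | hkl
    · rw [hu.opXD_isGen_false h₂ hkl]
    · simp only [hvan _ _ _ hkl]
  have hj : ((j : ℂ) + 1) ≠ 0 := Nat.cast_add_one_ne_zero j
  have e3 : ∀ k l, ((j : ℂ) + 1) • opS ε 0 (termS (j + 1) k l b) (opXD k l u) =
      (if k = 0 then 0 else opS ε 0 (termS j (k - 1) l b₁) (opXD (k - 1 + 1) l u)) -
        (Complex.I * ((l + 1 : ℕ) : ℂ)) • opS ε 0 (termS j k (l + 1) b₁) (opXD k (l + 1 - 1) u) -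
        (if l = 0 then 0 else opS ε 0 (termS j k (l - 1) b₂) (opXD k (l - 1 + 1) u)) := by
    intro k l
    rw [termS, smul_apply, opS_smul, smul_smul, mul_inv_cancel₀ hj, one_smul, sub_apply, sub_apply,
      opS_sub, opS_sub, smul_apply, opS_smul, Nat.cast_add, Nat.cast_one, Nat.add_sub_cancel]
    congr 1
    · congr 1
      split_ifs with h0
      · rw [zero_apply, opS_zero]
      · rw [Nat.sub_add_cancel (Nat.pos_of_ne_zero h0)]; rfl
    · split_ifs with h0
      · rw [zero_apply, opS_zero]
      · rw [Nat.sub_add_cancel (Nat.pos_of_ne_zero h0)]; rfl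
  rw [e0, e1, e2, Finset.smul_sum]
  simp_rw [Finset.smul_sum, e3, Finset.sum_sub_distrib]
  congr 1
  · congr 1
    · rw [← sum_range_shift_pred (fun k => ∑ l ∈ Finset.range (j + 2),
        opS ε 0 (termS j k l b₁) (opXD (k + 1) l u)) (j + 1)
        (Finset.sum_eq_zero fun l _ => hvan _ _ _ (by omega) _)]
      refine Finset.sum_congr rfl fun k _ => ?_
      split_ifs
      · simp
      · rfl
    · refine Finset.sum_congr rfl fun k _ => ?_
      -- The shifted sum loses nothing at either end: the factor l vanishes at 0, the symbol
      -- vanishes at j + 2.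
      exact sum_range_shift_succ (fun l => (Complex.I * (l : ℂ)) •
        opS ε 0 (termS j k l b₁) (opXD k (l - 1) u)) (j + 2) (by simp)
        (by rw [hvan _ _ _ (by omega), smul_zero])
  · refine Finset.sum_congr rfl fun k _ => ?_
    exact sum_range_shift_pred (fun l => opS ε 0 (termS j k l b₂) (opXD k (l + 1) u)) (j + 1)
      (hvan _ _ _ (by omega) _)

/-- The Taylor remainder of the quantization in the deformation parameter. -/
noncomputable def taylorRem (ε t : ℝ) (M : ℕ) (b : 𝓢(ℝ × ℝ, ℂ)) (u : L2Plane) : L2Plane :=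
  opS ε t b u - ∑ j ∈ Finset.range M, (((t * ε) ^ j : ℝ) : ℂ) • taylorS ε j b u

lemma integral_mul_pow (ε t : ℝ) (j : ℕ) (a : ℂ) :
    ∫ s in (0 : ℝ)..t, (ε : ℂ) * ((((s * ε) ^ j : ℝ) : ℂ) * (((j : ℂ) + 1) * a)) =
      (((t * ε) ^ (j + 1) : ℝ) : ℂ) * a := by
  have hd : ∀ s : ℝ, HasDerivAt (fun s : ℝ => (((s * ε) ^ (j + 1) : ℝ) : ℂ) * a)
      ((ε : ℂ) * ((((s * ε) ^ j : ℝ) : ℂ) * (((j : ℂ) + 1) * a))) s := by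
    intro s
    have h := (((hasDerivAt_id s).mul_const ε).fun_pow (j + 1)).ofReal_comp.mul_const a
    refine h.congr_deriv ?_
    simp
    ring
  rw [intervalIntegral.integral_eq_sub_of_hasDerivAt (fun s _ => hd s)
    (Continuous.intervalIntegrable (by fun_prop) _ _)]
  simp

/-- The first-order formula is subtracted from its Taylor polynomial term by term, since ∫₀ᵗ ε(j +
1)(sε)^j ds = (tε)^{j+1}. Iterating replaces any use of higher t-derivatives. -/
lemma inner_taylorRem_succ {M : ℕ} {K : ℝ} {u w₁ w₂ : L2Plane} (hu : Bd M K u)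
    (h₁ : IsGen true u w₁) (h₂ : IsGen false u w₂) (ε t : ℝ) (b ψ : 𝓢(ℝ × ℝ, ℂ)) :
    ⟪toL2 ψ, taylorRem ε t (M + 1) b u⟫_ℂ = ∫ s in (0 : ℝ)..t,
      ⟪toL2 ψ, (ε : ℂ) • (taylorRem ε s M (∂_{((1, 0) : ℝ × ℝ)} b) w₁ -
        taylorRem ε s M (∂_{((0, 1) : ℝ × ℝ)} b) w₂)⟫_ℂ := by
  set b₁ : 𝓢(ℝ × ℝ, ℂ) := ∂_{((1, 0) : ℝ × ℝ)} b with hb₁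
  set b₂ : 𝓢(ℝ × ℝ, ℂ) := ∂_{((0, 1) : ℝ × ℝ)} b with hb₂
  have hint : ∀ s, ⟪toL2 ψ, (ε : ℂ) • (taylorRem ε s M b₁ w₁ - taylorRem ε s M b₂ w₂)⟫_ℂ =
      (ε : ℂ) * (⟪toL2 ψ, opS ε s b₁ w₁⟫_ℂ - ⟪toL2 ψ, opS ε s b₂ w₂⟫_ℂ) -
      ∑ j ∈ Finset.range M, (ε : ℂ) * ((((s * ε) ^ j : ℝ) : ℂ) *
        (((j : ℂ) + 1) * ⟪toL2 ψ, taylorS ε (j + 1) b u⟫_ℂ)) := by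
    intro s
    have h3 : ∀ j ∈ Finset.range M, (ε : ℂ) * ((((s * ε) ^ j : ℝ) : ℂ) *
        (((j : ℂ) + 1) * ⟪toL2 ψ, taylorS ε (j + 1) b u⟫_ℂ)) =
        ε * ((((s * ε) ^ j : ℝ) : ℂ) * ⟪toL2 ψ, taylorS ε j b₁ w₁⟫_ℂ) -
        ε * ((((s * ε) ^ j : ℝ) : ℂ) * ⟪toL2 ψ, taylorS ε j b₂ w₂⟫_ℂ) := by
      intro j hj
      rw [← inner_smul_right, taylorS_succ (hu.mono (Finset.mem_range.1 hj) le_rfl) h₁ h₂,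
        inner_sub_right]
      ring
    rw [Finset.sum_congr rfl h3, Finset.sum_sub_distrib, inner_smul_right, inner_sub_right,
      taylorRem, taylorRem, inner_sub_right, inner_sub_right, inner_sum, inner_sum]
    simp_rw [inner_smul_right, ← Finset.mul_sum]
    ring
  simp_rw [hint]
  rw [intervalIntegral.integral_sub, ← inner_opS_sub h₁ h₂, intervalIntegral.integral_finsetSum]
  · simp_rw [integral_mul_pow]
    rw [taylorRem, inner_sub_right, inner_sum, Finset.sum_range_succ', taylorS_zero]
    simp_rw [inner_smul_right]
    simp
    ring
  · exact fun j _ => Continuous.intervalIntegrable (by fun_prop) _ _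
  · exact Continuous.intervalIntegrable (continuous_const.mul
      ((continuous_inner_opS ε b₁ _ w₁).sub (continuous_inner_opS ε b₂ _ w₂))) _ _
  · exact Continuous.intervalIntegrable (by fun_prop) _ _

/-- The Taylor remainder of order `M` is of size `ε ^ M` and costs `M` generators. -/
lemma exists_Bd_taylorRem (E : ℝ) (s M : ℕ) : ∃ C : ℝ, 0 ≤ C ∧ ∀ ε t : ℝ, |ε| ≤ E →
    t ∈ Icc (0 : ℝ) 1 → ∀ (K : ℕ → ℝ) (b : 𝓢(ℝ × ℝ, ℂ)), SymbolBound K b →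
      ∀ (u : L2Plane) (κ : ℝ), Bd (s + M) κ u →
        Bd s (C * |ε| ^ M * (∑ n ∈ Finset.range (s + 4 + M), K n) * κ) (taylorRem ε t M b u) := by
  induction M with
  | zero =>
    obtain ⟨C, hC0, hC⟩ := exists_Bd_opS E s
    refine ⟨C, hC0, fun ε t hε ht K b hb u κ hu => ?_⟩
    simpa [taylorRem] using hC ε t hε ht K b hb u κ hu
  | succ M ih =>
    obtain ⟨C, hC0, hC⟩ := ih
    -- The factor 2 counts the contributions of x and of D_x. Each step trades one generator on u
    -- and one derivative of b for a factor |ε|.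
    refine ⟨C * 2, by positivity, fun ε t hε ht K b hb u κ hu => ?_⟩
    have hκ := hu.1
    obtain ⟨w₁, h₁, hB₁⟩ := Bd.exists_isGen (k := s + M) hu true
    obtain ⟨w₂, h₂, hB₂⟩ := Bd.exists_isGen (k := s + M) hu false
    set S := ∑ n ∈ Finset.range (s + 4 + (M + 1)), K n with hS
    have hS0 : 0 ≤ S := Finset.sum_nonneg fun n _ => hb.nonneg n
    have hS2 : ∑ n ∈ Finset.range (s + 4 + M), K (n + 1) ≤ S := by
      have h1 := Finset.sum_range_succ' K (s + 4 + M)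
      have h2 := hb.nonneg 0
      rw [hS, ← add_assoc]
      linarith
    have key : ∀ r ∈ Icc 0 t, Bd s (|ε| * (C * |ε| ^ M * S * κ + C * |ε| ^ M * S * κ))
        ((ε : ℂ) • (taylorRem ε r M (∂_{((1, 0) : ℝ × ℝ)} b) w₁ -
          taylorRem ε r M (∂_{((0, 1) : ℝ × ℝ)} b) w₂)) := by
      intro r hr
      have hr' : r ∈ Icc (0 : ℝ) 1 := ⟨hr.1, hr.2.trans ht.2⟩
      have g1 := (hC ε r hε hr' _ _ (hb.lineDeriv (v := (1, 0)) (by simp [Prod.norm_def])) _ _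
        hB₁).mono le_rfl (show _ ≤ C * |ε| ^ M * S * κ by gcongr)
      have g2 := (hC ε r hε hr' _ _ (hb.lineDeriv (v := (0, 1)) (by simp [Prod.norm_def])) _ _
        hB₂).mono le_rfl (show _ ≤ C * |ε| ^ M * S * κ by gcongr)
      have := (g1.sub g2).smul (ε : ℂ)
      rwa [Complex.norm_real, Real.norm_eq_abs] at this
    have h3 := Bd.of_integral ht.1 key fun ψ =>
      inner_taylorRem_succ (hu.mono (show M ≤ _ by omega) le_rfl) h₁ h₂ ε t b ψ
    refine h3.mono le_rfl ?_
    have h4 : 0 ≤ |ε| * (C * |ε| ^ M * S * κ + C * |ε| ^ M * S * κ) := by positivity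
    calc _ ≤ |ε| * (C * |ε| ^ M * S * κ + C * |ε| ^ M * S * κ) * 1 :=
          mul_le_mul_of_nonneg_left ht.2 h4
      _ = _ := by ring

end TaylorTerms

/-! ### Weak limits of uniformly bounded operators. -/

section WeakLimits

lemma tendsto_zero_of_denseRange {E α : Type*} [SeminormedAddCommGroup E] {e : α → E}
    (he : DenseRange e) {F : ℕ → E → ℂ} {L : ℝ} (hF : ∀ n x y, ‖F n x - F n y‖ ≤ L * ‖x - y‖)
    (h : ∀ a, Tendsto (fun n => F n (e a)) atTop (𝓝 0)) (x : E) :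
    Tendsto (fun n => F n x) atTop (𝓝 0) := by
  rw [Metric.tendsto_atTop]
  intro δ hδ
  have hL : 0 < |L| + 1 := by positivity
  obtain ⟨a, ha⟩ := he.exists_dist_lt x (div_pos (half_pos hδ) hL)
  obtain ⟨N, hN⟩ := Metric.tendsto_atTop.1 (h a) (δ / 2) (half_pos hδ)
  refine ⟨N, fun n hn => ?_⟩
  have h1 := hN n hn
  rw [dist_zero_right] at h1 ⊢
  have h2 : ‖F n x - F n (e a)‖ < δ / 2 := by
    refine (hF n x (e a)).trans_lt ?_
    rw [dist_eq_norm, lt_div_iff₀ hL] at ha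
    nlinarith [le_abs_self L, norm_nonneg (x - e a)]
  calc ‖F n x‖ = ‖(F n x - F n (e a)) + F n (e a)‖ := by rw [sub_add_cancel]
    _ ≤ _ := norm_add_le _ _
    _ < δ := by linarith

/-- Weak convergence of a bounded sequence of operators can be tested on Schwartz functions. -/
lemma tendsto_inner_of_schwartz {A : ℕ → L2Plane →L[ℂ] L2Plane} {A₀ : L2Plane →L[ℂ] L2Plane}
    {C : ℝ} (hC : ∀ n u, ‖A n u‖ ≤ C * ‖u‖)
    (h : ∀ ψ φ, Tendsto (fun n => ⟪toL2 ψ, A n (toL2 φ)⟫_ℂ) atTop (𝓝 ⟪toL2 ψ, A₀ (toL2 φ)⟫_ℂ))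
    (v u : L2Plane) : Tendsto (fun n => ⟪v, A n u⟫_ℂ) atTop (𝓝 ⟪v, A₀ u⟫_ℂ) := by
  have hb : ∀ n w, ‖A n w - A₀ w‖ ≤ (C + ‖A₀‖) * ‖w‖ := fun n w => by
    rw [add_mul]
    exact (norm_sub_le _ _).trans (add_le_add (hC n w) (A₀.le_opNorm w))
  have h1 : ∀ ψ w, Tendsto (fun n => ⟪toL2 ψ, A n w - A₀ w⟫_ℂ) atTop (𝓝 0) := by
    intro ψ w
    refine tendsto_zero_of_denseRange denseRange_toL2 (L := ‖toL2 ψ‖ * (C + ‖A₀‖))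
      (F := fun n w => ⟪toL2 ψ, A n w - A₀ w⟫_ℂ) (fun n x y => ?_) (fun φ => ?_) w
    · rw [← inner_sub_right, sub_sub_sub_comm, ← map_sub, ← map_sub, mul_assoc]
      exact (norm_inner_le_norm _ _).trans (mul_le_mul_of_nonneg_left (hb n _) (norm_nonneg _))
    · simp_rw [inner_sub_right]
      exact tendsto_sub_nhds_zero_iff.2 (h ψ φ)
  have h2 : Tendsto (fun n => ⟪v, A n u - A₀ u⟫_ℂ) atTop (𝓝 0) := by
    refine tendsto_zero_of_denseRange denseRange_toL2 (L := (C + ‖A₀‖) * ‖u‖)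
      (F := fun n v => ⟪v, A n u - A₀ u⟫_ℂ) (fun n x y => ?_) (fun ψ => h1 ψ u) v
    rw [← inner_sub_left, mul_comm]
    exact (norm_inner_le_norm _ _).trans (mul_le_mul_of_nonneg_left (hb n u) (norm_nonneg _))
  simp_rw [inner_sub_right] at h2
  exact tendsto_sub_nhds_zero_iff.1 h2

/-- The limit f is a bounded sesquilinear form on a dense subspace; Riesz representation in ψ and
extension by density in φ produce the operator. -/
lemma exists_weak_limit {A : ℕ → L2Plane →L[ℂ] L2Plane} {C : ℝ} (hC0 : 0 ≤ C)
    (hC : ∀ n u, ‖A n u‖ ≤ C * ‖u‖) (f : 𝓢(ℝ × ℝ, ℂ) → 𝓢(ℝ × ℝ, ℂ) → ℂ)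
    (hf : ∀ ψ φ, Tendsto (fun n => ⟪toL2 ψ, A n (toL2 φ)⟫_ℂ) atTop (𝓝 (f ψ φ))) :
    ∃ A₀ : L2Plane →L[ℂ] L2Plane, ∀ ψ φ, ⟪toL2 ψ, A₀ (toL2 φ)⟫_ℂ = f ψ φ := by
  have hadd : ∀ ψ ψ' φ, f (ψ + ψ') φ = f ψ φ + f ψ' φ := fun ψ ψ' φ => by
    refine tendsto_nhds_unique (hf (ψ + ψ') φ) ?_
    simp_rw [map_add, inner_add_left]
    exact (hf ψ φ).add (hf ψ' φ)
  have hsmul : ∀ (c : ℂ) ψ φ, f (c • ψ) φ = (starRingEnd ℂ) c * f ψ φ := fun c ψ φ => by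
    refine tendsto_nhds_unique (hf (c • ψ) φ) ?_
    simp_rw [map_smul, inner_smul_left]
    exact (hf ψ φ).const_mul _
  have hadd' : ∀ ψ φ φ', f ψ (φ + φ') = f ψ φ + f ψ φ' := fun ψ φ φ' => by
    refine tendsto_nhds_unique (hf ψ (φ + φ')) ?_
    simp_rw [map_add, inner_add_right]
    exact (hf ψ φ).add (hf ψ φ')
  have hsmul' : ∀ (c : ℂ) ψ φ, f ψ (c • φ) = c * f ψ φ := fun c ψ φ => by
    refine tendsto_nhds_unique (hf ψ (c • φ)) ?_
    simp_rw [map_smul, inner_smul_right]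
    exact (hf ψ φ).const_mul _
  have hbd : ∀ ψ φ, ‖f ψ φ‖ ≤ C * ‖toL2 φ‖ * ‖toL2 ψ‖ := fun ψ φ => by
    refine le_of_tendsto (hf ψ φ).norm (Eventually.of_forall fun n => ?_)
    refine (norm_inner_le_norm _ _).trans ?_
    rw [mul_comm]
    exact mul_le_mul_of_nonneg_right (hC n _) (norm_nonneg _)
  have hex : ∀ φ, ∃ w : L2Plane, ‖w‖ ≤ C * ‖toL2 φ‖ ∧ ∀ ψ, ⟪toL2 ψ, w⟫_ℂ = f ψ φ := by
    intro φ
    let g : 𝓢(ℝ × ℝ, ℂ) →ₗ[ℂ] ℂ :=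
      { toFun := fun ψ => (starRingEnd ℂ) (f ψ φ)
        map_add' := fun ψ ψ' => by rw [hadd, map_add]
        map_smul' := fun c ψ => by rw [hsmul, map_mul, Complex.conj_conj]; rfl }
    obtain ⟨w, hw, hw'⟩ := exists_inner_toL2_eq g (K := C * ‖toL2 φ‖) (by positivity) fun ψ => by
      change ‖(starRingEnd ℂ) (f ψ φ)‖ ≤ _
      rw [RCLike.norm_conj]
      exact hbd ψ φ
    refine ⟨w, hw, fun ψ => ?_⟩
    rw [← inner_conj_symm, hw']
    exact Complex.conj_conj _
  choose w hwn hw using hex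
  let T : 𝓢(ℝ × ℝ, ℂ) →ₗ[ℂ] L2Plane :=
    { toFun := w
      map_add' := fun φ φ' => eq_of_inner_toL2 fun ψ => by
        rw [inner_add_right, hw, hw, hw, hadd']
      map_smul' := fun c φ => eq_of_inner_toL2 fun ψ => by
        rw [RingHom.id_apply, inner_smul_right, hw, hw, hsmul'] }
  refine ⟨T.extendOfNorm toL2.toLinearMap, fun ψ φ => ?_⟩
  rw [← hw]
  congr 1
  exact LinearMap.extendOfNorm_eq (f := T) (e := toL2.toLinearMap) denseRange_toL2 ⟨C, hwn⟩ φ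

end WeakLimits

/-! ### Approximation of symbols by Schwartz functions. -/

section Cutoffs

lemma norm_iteratedFDeriv_comp_clm_le {E F G : Type*} [NormedAddCommGroup E] [NormedSpace ℝ E]
    [NormedAddCommGroup F] [NormedSpace ℝ F] [NormedAddCommGroup G] [NormedSpace ℝ G]
    {f : F → G} (hf : ContDiff ℝ ∞ f) (L : E →L[ℝ] F) (hL : ‖L‖ ≤ 1) (c : F) (n : ℕ) (x : E) :
    ‖iteratedFDeriv ℝ n (fun x => f (L x + c)) x‖ ≤ ‖iteratedFDeriv ℝ n f (L x + c)‖ := by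
  have h1 : ContDiff ℝ ∞ fun y => f (y + c) := hf.comp (contDiff_id.add contDiff_const)
  have h2 := L.iteratedFDeriv_comp_right h1 x (i := n) (by exact_mod_cast le_top)
  rw [show (fun x => f (L x + c)) = (fun y => f (y + c)) ∘ L from rfl, h2,
    iteratedFDeriv_comp_add_right]
  refine (ContinuousMultilinearMap.norm_compContinuousLinearMap_le _ _).trans ?_
  refine mul_le_of_le_one_right (norm_nonneg _) ?_
  exact Finset.prod_le_one (fun _ _ => norm_nonneg _) fun _ _ => hL

lemma norm_iteratedFDeriv_mul_le_sum {E : Type*} [NormedAddCommGroup E] [NormedSpace ℝ E]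
    {f g : E → ℂ} (hf : ContDiff ℝ ∞ f) (hg : ContDiff ℝ ∞ g) {x : E} {n : ℕ} {K : ℕ → ℝ} {D : ℝ}
    (hK : ∀ i ≤ n, ‖iteratedFDeriv ℝ i f x‖ ≤ K i) (hD : ∀ i ≤ n, ‖iteratedFDeriv ℝ i g x‖ ≤ D) :
    ‖iteratedFDeriv ℝ n (fun y => f y * g y) x‖ ≤
      2 ^ n * (∑ i ∈ Finset.range (n + 1), K i) * D := by
  have hK0 : ∀ i ≤ n, 0 ≤ K i := fun i hi => (norm_nonneg _).trans (hK i hi)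
  have hD0 : 0 ≤ D := (norm_nonneg _).trans (hD 0 (Nat.zero_le n))
  refine (norm_iteratedFDeriv_mul_le (hf.of_le le_rfl) (hg.of_le le_rfl) x
    (by exact_mod_cast le_top)).trans ?_
  rw [Finset.mul_sum, Finset.sum_mul]
  refine Finset.sum_le_sum fun i hi => ?_
  have hi' : i ≤ n := Nat.lt_succ_iff.1 (Finset.mem_range.1 hi)
  have hc : (n.choose i : ℝ) ≤ 2 ^ n := by exact_mod_cast Nat.choose_le_two_pow n i
  have := hK0 i hi'
  exact mul_le_mul (mul_le_mul hc (hK i hi') (norm_nonneg _) (by positivity))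
    (hD _ (Nat.sub_le n i)) (norm_nonneg _) (by positivity)

/-- Every smooth function with bounded derivatives is a limit of Schwartz functions, locally
uniformly stationary and bounded in `S(1)`. -/
lemma exists_cutoff : ∃ D : ℕ → ℝ, (∀ m, 0 ≤ D m) ∧ ∀ (K : ℕ → ℝ) (c : ℝ × ℝ → ℂ),
    ContDiff ℝ ∞ c → SymbolBound K c → ∃ b : ℕ → 𝓢(ℝ × ℝ, ℂ),
      (∀ n, SymbolBound (fun m => D m * ∑ i ∈ Finset.range (m + 1), K i) (b n)) ∧
      ∀ z, ∀ᶠ n in atTop, (b n : ℝ × ℝ → ℂ) =ᶠ[𝓝 z] c := by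
  let χ : ContDiffBump (0 : ℝ × ℝ) := ⟨1, 2, one_pos, one_lt_two⟩
  let g : ℝ × ℝ → ℂ := fun z => (χ z : ℂ)
  have hg : ContDiff ℝ ∞ g := Complex.ofRealCLM.contDiff.comp χ.contDiff
  have hgs : HasCompactSupport g := χ.hasCompactSupport.comp_left Complex.ofReal_zero
  have hDex : ∀ m : ℕ, ∃ D : ℝ, 0 ≤ D ∧ ∀ i ≤ m, ∀ z, ‖iteratedFDeriv ℝ i g z‖ ≤ D := by
    intro m
    have h1 : ∀ i : ℕ, ∃ D : ℝ, ∀ z, ‖iteratedFDeriv ℝ i g z‖ ≤ D := fun i =>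
      (hgs.iteratedFDeriv i).exists_bound_of_continuous
        (hg.continuous_iteratedFDeriv (m := i) (by exact_mod_cast le_top))
    choose D hD using h1
    have hD0 : ∀ i, 0 ≤ D i := fun i => (norm_nonneg _).trans (hD i 0)
    refine ⟨∑ i ∈ Finset.range (m + 1), D i, Finset.sum_nonneg fun i _ => hD0 i,
      fun i hi z => (hD i z).trans ?_⟩
    exact Finset.single_le_sum (f := D) (fun i _ => hD0 i) (Finset.mem_range.2 (by omega))
  choose D hD0 hD using hDex
  refine ⟨fun m => 2 ^ m * D m, fun m => mul_nonneg (by positivity) (hD0 m),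
    fun K c hc hK => ?_⟩
  -- Dilation by a factor at most 1 does not increase derivatives of the bump, so the constants
  -- depend neither on n nor on the symbol.
  let r : ℕ → ℝ := fun n => ((n : ℝ) + 1)⁻¹
  have hr0 : ∀ n, 0 < r n := fun n => by positivity
  have hr1 : ∀ n, r n ≤ 1 := fun n => inv_le_one_of_one_le₀ (by linarith [n.cast_nonneg (α := ℝ)])
  let L : ℕ → (ℝ × ℝ) →L[ℝ] (ℝ × ℝ) := fun n => r n • ContinuousLinearMap.id ℝ (ℝ × ℝ)
  have hL : ∀ n, ‖L n‖ ≤ 1 := fun n => by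
    refine (norm_smul_le (r n) (ContinuousLinearMap.id ℝ (ℝ × ℝ))).trans ?_
    rw [Real.norm_of_nonneg (hr0 n).le]
    exact mul_le_one₀ (hr1 n) (norm_nonneg _) ContinuousLinearMap.norm_id_le
  let G : ℕ → ℝ × ℝ → ℂ := fun n z => g (L n z + 0)
  have hG : ∀ n, ContDiff ℝ ∞ (G n) := fun n =>
    hg.comp ((L n).contDiff.add contDiff_const)
  have hGs : ∀ n, HasCompactSupport (G n) := fun n => by
    have : G n = fun z => g (r n • z) := funext fun z => by simp [G, L]
    rw [this]
    exact hgs.comp_smul (hr0 n).ne'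
  have hb : ∀ n, HasCompactSupport fun z => c z * G n z := fun n => (hGs n).mul_left
  have hb' : ∀ n, ContDiff ℝ ∞ fun z => c z * G n z := fun n => hc.mul (hG n)
  refine ⟨fun n => (hb n).toSchwartzMap (hb' n), fun n m z => ?_, fun z => ?_⟩
  · change ‖iteratedFDeriv ℝ m (fun z => c z * G n z) z‖ ≤ _
    refine (norm_iteratedFDeriv_mul_le_sum hc (hG n) (fun i _ => hK i z) fun i hi =>
      (norm_iteratedFDeriv_comp_clm_le hg (L n) (hL n) 0 i z).trans (hD m i hi _)).trans_eq ?_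
    ring
  · have hev : ∀ᶠ n : ℕ in atTop, ‖z‖ + 1 < (n : ℝ) + 1 := by
      filter_upwards [eventually_gt_atTop ⌈‖z‖⌉₊] with n hn
      have := (Nat.lt_of_ceil_lt hn)
      linarith
    filter_upwards [hev] with n hn
    filter_upwards [Metric.ball_mem_nhds z one_pos] with w hw
    change c w * G n w = c w
    have h1 : ‖w‖ < (n : ℝ) + 1 := by
      have h2 : ‖w - z‖ < 1 := by rwa [← dist_eq_norm]
      have h3 := norm_add_le (w - z) z
      rw [sub_add_cancel] at h3
      linarith
    have h2 : G n w = 1 := by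
      have : χ (r n • w) = 1 := by
        refine χ.one_of_mem_closedBall ?_
        rw [mem_closedBall_zero_iff, norm_smul, Real.norm_of_nonneg (hr0 n).le]
        change ((n : ℝ) + 1)⁻¹ * ‖w‖ ≤ 1
        rw [inv_mul_le_iff₀ (by positivity), mul_one]
        exact h1.le
      simp [G, L, g, this]
    rw [h2, mul_one]

end Cutoffs

/-! ### Convergence and stability of the Weyl integral. -/

section WeylFormula

open scoped FourierTransform

/-- With r the second coordinate of p, this is integrable decay in y', uniform in x, for the
derivatives that occur in two integrations by parts. -/
lemma exists_schwartz_decay (φ : 𝓢(ℝ × ℝ, ℂ)) : ∃ C : ℝ, 0 ≤ C ∧ ∀ i ≤ 2, ∀ (p : ℝ × ℝ) (r : ℝ),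
    |r| ≤ ‖p‖ → ‖iteratedFDeriv ℝ i φ p‖ ≤ C * (1 + r ^ 2)⁻¹ := by
  have h : ∀ i : ℕ, ∃ C : ℝ, ∀ p : ℝ × ℝ, (1 + ‖p‖ ^ 2) * ‖iteratedFDeriv ℝ i φ p‖ ≤ C := by
    intro i
    obtain ⟨C₀, h₀⟩ := φ.decay' 0 i
    obtain ⟨C₂, h₂⟩ := φ.decay' 2 i
    refine ⟨C₀ + C₂, fun p => ?_⟩
    have := h₀ p
    rw [pow_zero, one_mul] at this
    rw [add_mul, one_mul]
    exact add_le_add this (h₂ p)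
  choose C hC using h
  have hC0 : ∀ i, 0 ≤ C i := fun i => le_trans (by positivity) (hC i 0)
  refine ⟨∑ i ∈ Finset.range 3, C i, Finset.sum_nonneg fun i _ => hC0 i, fun i hi p r hr => ?_⟩
  have h1 : C i ≤ ∑ i ∈ Finset.range 3, C i :=
    Finset.single_le_sum (f := C) (fun i _ => hC0 i) (Finset.mem_range.2 (by omega))
  have h2 : (1 + r ^ 2) * ‖iteratedFDeriv ℝ i φ p‖ ≤ C i := by
    refine le_trans (mul_le_mul_of_nonneg_right ?_ (norm_nonneg _)) (hC i p)
    have := sq_le_sq₀ (abs_nonneg r) (norm_nonneg p) |>.2 hr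
    rw [sq_abs] at this
    linarith
  rw [← div_eq_mul_inv, le_div_iff₀ (by positivity), mul_comm]
  exact h2.trans h1

lemma exists_norm_schwartz_snd_le (φ : 𝓢(ℝ × ℝ, ℂ)) : ∃ C : ℝ, 0 ≤ C ∧ ∀ x y : ℝ,
    ‖φ (x, y)‖ ≤ C * (1 + y ^ 2)⁻¹ := by
  obtain ⟨C, hC0, hC⟩ := exists_schwartz_decay φ
  refine ⟨C, hC0, fun x y => ?_⟩
  simpa using hC 0 (by norm_num) (x, y) y (norm_snd_le (x, y))

/-- The inner integral in the Weyl quantization formula. -/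
noncomputable def weylInner (h : ℝ) (c φ : ℝ × ℝ → ℂ) (z : ℝ × ℝ) (η : ℝ) : ℂ :=
  ∫ y' : ℝ, Complex.exp (Complex.I * (((z.2 - y') * η / h : ℝ) : ℂ)) * c ((z.2 + y') / 2, η) *
    φ (z.1, y')

lemma norm_exp_I_mul_ofReal (r : ℝ) : ‖Complex.exp (Complex.I * (r : ℂ))‖ = 1 := by
  rw [mul_comm, Complex.norm_exp_ofReal_mul_I]

lemma norm_fourier_le_integral {g : ℝ → ℂ} {D : ℝ} (hg : ∀ y, ‖g y‖ ≤ D * (1 + y ^ 2)⁻¹) (w : ℝ) :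
    ‖𝓕 g w‖ ≤ D * Real.pi := by
  have h : D * Real.pi = ∫ y : ℝ, D * (1 + y ^ 2)⁻¹ := by
    rw [integral_const_mul, integral_univ_inv_one_add_sq]
  rw [Real.fourier_real_eq_integral_exp_smul, h]
  refine norm_integral_le_of_norm_le (g := fun y => D * (1 + y ^ 2)⁻¹)
    (integrable_inv_one_add_sq.const_mul D)
    (Eventually.of_forall fun y => ?_)
  rw [norm_smul, Complex.norm_exp_ofReal_mul_I, one_mul]
  exact hg y

/-- Two integrations by parts in the inner integral. -/
lemma exists_norm_weylInner_le {h : ℝ} (hh : 0 < h) (φ : 𝓢(ℝ × ℝ, ℂ)) : ∃ C : ℝ, 0 ≤ C ∧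
    ∀ (K : ℕ → ℝ) (c : ℝ × ℝ → ℂ), ContDiff ℝ ∞ c → SymbolBound K c → ∀ z η,
      ‖weylInner h c φ z η‖ ≤ C * (∑ i ∈ Finset.range 3, K i) * (1 + η ^ 2)⁻¹ := by
  obtain ⟨C, hC0, hC⟩ := exists_schwartz_decay φ
  refine ⟨8 * C * Real.pi * (1 + h ^ 2), by positivity, fun K c hc hK z η => ?_⟩
  set S := ∑ i ∈ Finset.range 3, K i with hS
  have hS0 : 0 ≤ S := Finset.sum_nonneg fun i _ => hK.nonneg i
  let L₁ : ℝ →L[ℝ] ℝ × ℝ := (2⁻¹ : ℝ) • ContinuousLinearMap.inl ℝ ℝ ℝ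
  let L₂ : ℝ →L[ℝ] ℝ × ℝ := ContinuousLinearMap.inr ℝ ℝ ℝ
  have hL₁ : ‖L₁‖ ≤ 1 := ContinuousLinearMap.opNorm_le_bound _ zero_le_one fun r => by
    simp [L₁, Prod.norm_def]
    linarith [abs_nonneg r]
  have hL₂ : ‖L₂‖ ≤ 1 := ContinuousLinearMap.opNorm_le_bound _ zero_le_one fun r => by
    simp [L₂, Prod.norm_def]
  let f₁ : ℝ → ℂ := fun y => c (L₁ y + (z.2 / 2, η))
  let f₂ : ℝ → ℂ := fun y => φ (L₂ y + (z.1, 0))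
  let g : ℝ → ℂ := fun y => f₁ y * f₂ y
  have hf₁ : ContDiff ℝ ∞ f₁ := hc.comp (L₁.contDiff.add contDiff_const)
  have hf₂ : ContDiff ℝ ∞ f₂ := (φ.smooth ⊤).comp (L₂.contDiff.add contDiff_const)
  have hg : ContDiff ℝ ∞ g := hf₁.mul hf₂
  have hgb : ∀ m ≤ 2, ∀ y, ‖iteratedDeriv m g y‖ ≤ 4 * S * C * (1 + y ^ 2)⁻¹ := by
    intro m hm y
    rw [← norm_iteratedFDeriv_eq_norm_iteratedDeriv]
    refine (norm_iteratedFDeriv_mul_le_sum hf₁ hf₂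
      (fun i _ => (norm_iteratedFDeriv_comp_clm_le hc L₁ hL₁ _ i y).trans (hK i _))
      (fun i hi => (norm_iteratedFDeriv_comp_clm_le (φ.smooth ⊤) L₂ hL₂ _ i y).trans
        (hC i (hi.trans hm) _ y ?_))).trans ?_
    · simp [L₂]
    · have h1 : ∑ i ∈ Finset.range (m + 1), K i ≤ S :=
        Finset.sum_le_sum_of_subset_of_nonneg (Finset.range_mono (by omega))
          fun i _ _ => hK.nonneg i
      have h2 : (2 : ℝ) ^ m ≤ 4 := by
        calc (2 : ℝ) ^ m ≤ 2 ^ 2 := pow_le_pow_right₀ one_le_two hm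
          _ = 4 := by norm_num
      have h3 : 0 ≤ ∑ i ∈ Finset.range (m + 1), K i := Finset.sum_nonneg fun i _ => hK.nonneg i
      calc _ ≤ 4 * S * (C * (1 + y ^ 2)⁻¹) := by gcongr
        _ = _ := by ring
  have hint : ∀ m : ℕ, m ≤ ((2 : ℕ) : ℕ∞) → Integrable (iteratedDeriv m g) := by
    intro m hm
    have hm' : m ≤ 2 := by exact_mod_cast hm
    refine (integrable_inv_one_add_sq.const_mul (4 * S * C)).mono' ?_
      (Eventually.of_forall (hgb m hm'))
    exact (hg.continuous_iteratedDeriv m (by exact_mod_cast le_top)).aestronglyMeasurable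
  -- At this frequency the inner integral is, up to a unimodular factor, the Fourier transform of g.
  set w := η / (2 * Real.pi * h) with hw
  have hF : weylInner h c φ z η =
      Complex.exp (Complex.I * ((z.2 * η / h : ℝ) : ℂ)) * 𝓕 g w := by
    rw [Real.fourier_real_eq_integral_exp_smul, ← integral_const_mul]
    refine integral_congr_ae (Eventually.of_forall fun y => ?_)
    have e1 : (L₁ y + (z.2 / 2, η)) = ((z.2 + y) / 2, η) := by
      simp [L₁]; ring
    have e2 : (L₂ y + (z.1, 0)) = (z.1, y) := by simp [L₂]
    simp only [g, f₁, f₂, e1, e2, smul_eq_mul]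
    rw [← mul_assoc, ← mul_assoc, ← Complex.exp_add]
    congr 3
    have : -2 * Real.pi * y * w = -(y * η / h) := by
      rw [hw]; field_simp
    rw [this]
    push_cast
    ring
  -- Two derivatives of g give a factor w⁻², hence decay like (1 + η²)⁻¹. This makes the outer
  -- integral absolutely convergent although c has no decay.
  have h2 := congrFun (Real.fourier_iteratedDeriv (N := ((2 : ℕ) : ℕ∞)) (n := 2)
    (hg.of_le (by exact_mod_cast le_top)) hint le_rfl) w
  have h3 : ‖𝓕 g w‖ ≤ 4 * S * C * Real.pi :=
    norm_fourier_le_integral (fun y => by simpa using hgb 0 (by norm_num) y) w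
  have h4 : ‖𝓕 (iteratedDeriv 2 g) w‖ ≤ 4 * S * C * Real.pi :=
    norm_fourier_le_integral (hgb 2 le_rfl) w
  rw [h2, norm_smul, norm_pow] at h4
  have h5 : ‖(2 * Real.pi * Complex.I * w : ℂ)‖ ^ 2 * h ^ 2 = η ^ 2 := by
    simp only [norm_mul, Complex.norm_I, Complex.norm_ofNat, Complex.norm_real, mul_one,
      Real.norm_eq_abs, mul_pow, sq_abs]
    rw [hw]; field_simp
  rw [hF, norm_mul, norm_exp_I_mul_ofReal, one_mul, ← div_eq_mul_inv, le_div_iff₀ (by positivity)]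
  set X := ‖𝓕 g w‖ with hX
  have hX0 : 0 ≤ X := norm_nonneg _
  rw [← h5]
  have h6 : ‖(2 * Real.pi * Complex.I * w : ℂ)‖ ^ 2 * X * h ^ 2 ≤ 4 * S * C * Real.pi * h ^ 2 :=
    mul_le_mul_of_nonneg_right h4 (sq_nonneg h)
  have h7 : 0 ≤ 4 * S * C * Real.pi := hX0.trans h3
  have h8 : 0 ≤ 4 * S * C * Real.pi * h ^ 2 := by positivity
  nlinarith

lemma weylIntegral_eq (h : ℝ) (c φ : ℝ × ℝ → ℂ) (z : ℝ × ℝ) :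
    weylIntegral h c φ z = ((2 * Real.pi * h : ℝ) : ℂ)⁻¹ * ∫ η : ℝ, weylInner h c φ z η := rfl

lemma continuous_weyl_integrand (h : ℝ) {c : ℝ × ℝ → ℂ} (hc : Continuous c) (φ : 𝓢(ℝ × ℝ, ℂ)) :
    Continuous fun p : ((ℝ × ℝ) × ℝ) × ℝ => Complex.exp (Complex.I *
      (((p.1.1.2 - p.2) * p.1.2 / h : ℝ) : ℂ)) * c ((p.1.1.2 + p.2) / 2, p.1.2) *
        φ (p.1.1.1, p.2) := by
  have h1 : Continuous fun p : ((ℝ × ℝ) × ℝ) × ℝ => c ((p.1.1.2 + p.2) / 2, p.1.2) :=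
    hc.comp (by fun_prop)
  have h2 : Continuous fun p : ((ℝ × ℝ) × ℝ) × ℝ => φ (p.1.1.1, p.2) :=
    φ.continuous.comp (by fun_prop)
  have h3 : Continuous fun p : ((ℝ × ℝ) × ℝ) × ℝ => Complex.exp (Complex.I *
      (((p.1.1.2 - p.2) * p.1.2 / h : ℝ) : ℂ)) := by fun_prop
  exact (h3.mul h1).mul h2

lemma stronglyMeasurable_weylInner (h : ℝ) {c : ℝ × ℝ → ℂ} (hc : Continuous c)
    (φ : 𝓢(ℝ × ℝ, ℂ)) :
    StronglyMeasurable fun p : (ℝ × ℝ) × ℝ => weylInner h c φ p.1 p.2 :=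
  (continuous_weyl_integrand h hc φ).stronglyMeasurable.integral_prod_right'

lemma stronglyMeasurable_weylIntegral (h : ℝ) {c : ℝ × ℝ → ℂ} (hc : Continuous c)
    (φ : 𝓢(ℝ × ℝ, ℂ)) : StronglyMeasurable (weylIntegral h c φ) :=
  (stronglyMeasurable_weylInner h hc φ).integral_prod_right'.const_mul _

lemma aestronglyMeasurable_weylInner (h : ℝ) {c : ℝ × ℝ → ℂ} (hc : Continuous c)
    (φ : 𝓢(ℝ × ℝ, ℂ)) (z : ℝ × ℝ) : AEStronglyMeasurable (weylInner h c φ z) volume :=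
  ((stronglyMeasurable_weylInner h hc φ).comp_measurable measurable_prodMk_left).aestronglyMeasurable

lemma exists_norm_weylIntegral_le {h : ℝ} (hh : 0 < h) (φ : 𝓢(ℝ × ℝ, ℂ)) : ∃ C : ℝ, 0 ≤ C ∧
    ∀ (K : ℕ → ℝ) (c : ℝ × ℝ → ℂ), ContDiff ℝ ∞ c → SymbolBound K c → ∀ z,
      ‖weylIntegral h c φ z‖ ≤ C * ∑ i ∈ Finset.range 3, K i := by
  obtain ⟨C, hC0, hC⟩ := exists_norm_weylInner_le hh φ
  refine ⟨(2 * Real.pi * h)⁻¹ * (C * Real.pi), by positivity, fun K c hc hK z => ?_⟩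
  rw [weylIntegral_eq, norm_mul, norm_inv, Complex.norm_real,
    Real.norm_of_nonneg (by positivity), mul_assoc _ (C * Real.pi)]
  refine mul_le_mul_of_nonneg_left ?_ (inv_nonneg.2 (by positivity))
  refine (norm_integral_le_of_norm_le (integrable_inv_one_add_sq.const_mul _)
    (Eventually.of_forall (hC K c hc hK z))).trans_eq ?_
  rw [integral_const_mul, integral_univ_inv_one_add_sq]
  ring

lemma integrable_schwartz_snd (φ : 𝓢(ℝ × ℝ, ℂ)) (x : ℝ) : Integrable fun y => φ (x, y) := by
  obtain ⟨C, -, hC⟩ := exists_norm_schwartz_snd_le φ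
  exact (integrable_inv_one_add_sq.const_mul C).mono'
    (φ.continuous.comp (by fun_prop)).aestronglyMeasurable (Eventually.of_forall (hC x))

/-- Weyl integrals converge along bounded, locally stationary sequences of symbols. -/
lemma tendsto_weylIntegral {h : ℝ} (hh : 0 < h) {K : ℕ → ℝ} {b : ℕ → ℝ × ℝ → ℂ} {c : ℝ × ℝ → ℂ}
    (hbs : ∀ n, ContDiff ℝ ∞ (b n)) (hb : ∀ n, SymbolBound K (b n))
    (hbc : ∀ z, ∀ᶠ n in atTop, b n =ᶠ[𝓝 z] c) (φ : 𝓢(ℝ × ℝ, ℂ)) (z : ℝ × ℝ) :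
    Tendsto (fun n => weylIntegral h (b n) φ z) atTop (𝓝 (weylIntegral h c φ z)) := by
  obtain ⟨C, hC0, hC⟩ := exists_norm_weylInner_le hh φ
  simp_rw [weylIntegral_eq]
  refine Tendsto.const_mul _ ?_
  refine tendsto_integral_of_dominated_convergence _
    (fun n => aestronglyMeasurable_weylInner h (hbs n).continuous φ z)
    (integrable_inv_one_add_sq.const_mul _)
    (fun n => Eventually.of_forall (hC K (b n) (hbs n) (hb n) z))
    (Eventually.of_forall fun η => ?_)
  refine tendsto_integral_of_dominated_convergence (fun y => K 0 * ‖φ (z.1, y)‖) (fun n => ?_)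
    ((integrable_schwartz_snd φ z.1).norm.const_mul _)
    (fun n => Eventually.of_forall fun y => ?_) (Eventually.of_forall fun y => ?_)
  · exact ((continuous_weyl_integrand h (hbs n).continuous φ).comp
      (by fun_prop : Continuous fun y : ℝ => ((z, η), y))).aestronglyMeasurable
  · rw [norm_mul, norm_mul, norm_exp_I_mul_ofReal, one_mul]
    exact mul_le_mul_of_nonneg_right ((hb n).norm_le _) (norm_nonneg _)
  · refine tendsto_const_nhds.congr' ?_
    filter_upwards [hbc ((z.2 + y) / 2, η)] with n hn
    rw [hn.eq_of_nhds]

end WeylFormula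

/-! ### Op_0 is the Weyl quantization in y, for Schwartz symbols and in the limit. -/

section WeylExistence

open scoped FourierTransform

/-- Fourier inversion in the first variable. -/
lemma ae_integral_ftC (b : 𝓢(ℝ × ℝ, ℂ)) : ∀ᵐ τ : ℝ, ∀ p : ℝ,
    ∫ σ : ℝ, ftC b ⟨σ, τ⟩ * Complex.exp (((2 * Real.pi * σ * p : ℝ) : ℂ) * Complex.I) =
      ∫ q : ℝ, b (p, q) * Complex.exp (((-(2 * Real.pi * τ * q) : ℝ) : ℂ) * Complex.I) := by
  have hI : Integrable (fun q : ℝ × ℝ => ftC b ⟨q.1, q.2⟩) :=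
    Complex.volume_preserving_equiv_real_prod.symm.integrable_comp_of_integrable
      (ftC b).integrable
  -- Fubini gives integrability of σ ↦ b̂(σ, τ) for almost every τ only. For such τ, b̂(·, τ) is the
  -- transform of the continuous function F and can be inverted.
  filter_upwards [hI.prod_left_ae] with τ hτ p
  set F : ℝ → ℂ := fun p => ∫ q : ℝ, b (p, q) *
    Complex.exp (((-(2 * Real.pi * τ * q) : ℝ) : ℂ) * Complex.I) with hF
  obtain ⟨C, hC0, hC⟩ := exists_norm_schwartz_snd_le b
  have hc : Continuous fun z : ℝ × ℝ =>
      b z * Complex.exp (((-(2 * Real.pi * τ * z.2) : ℝ) : ℂ) * Complex.I) :=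
    b.continuous.mul (by fun_prop)
  have hbi : Integrable fun z : ℝ × ℝ =>
      b z * Complex.exp (((-(2 * Real.pi * τ * z.2) : ℝ) : ℂ) * Complex.I) :=
    b.integrable.norm.mono' hc.aestronglyMeasurable (Eventually.of_forall fun z => by
      rw [norm_mul, Complex.norm_exp_ofReal_mul_I, mul_one])
  have hFi : Integrable F := hbi.integral_prod_left
  have hFc : Continuous F := by
    refine continuous_of_dominated (bound := fun q => C * (1 + q ^ 2)⁻¹) (fun p => ?_)
      (fun p => Eventually.of_forall fun q => ?_) (integrable_inv_one_add_sq.const_mul C)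
      (Eventually.of_forall fun q => ?_)
    · exact (hc.comp (by fun_prop : Continuous fun q => (p, q))).aestronglyMeasurable
    · rw [norm_mul, Complex.norm_exp_ofReal_mul_I, mul_one]
      exact hC p q
    · exact hc.comp (by fun_prop : Continuous fun p => (p, q))
  have hFF : 𝓕 F = fun σ => ftC b ⟨σ, τ⟩ := by
    funext σ
    rw [Real.fourier_real_eq_integral_exp_smul, ftC, SchwartzMap.fourier_coe, Real.fourier_eq',
      ← Complex.volume_preserving_equiv_real_prod.symm.integral_comp
        Complex.measurableEquivRealProd.symm.measurableEmbedding, Measure.volume_eq_prod, integral_prod]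
    · refine integral_congr_ae (Eventually.of_forall fun p => ?_)
      simp only [hF, smul_eq_mul]
      rw [← integral_const_mul]
      refine integral_congr_ae (Eventually.of_forall fun q => ?_)
      simp only [Complex.measurableEquivRealProd_symm_apply, toC_apply, Complex.inner]
      rw [mul_left_comm, ← Complex.exp_add, mul_comm]
      congr 2
      simp
      ring
    · rw [← Measure.volume_eq_prod]
      refine b.integrable.norm.mono' ?_ (Eventually.of_forall fun z => ?_)
      · refine Continuous.aestronglyMeasurable ?_
        have : Continuous Complex.measurableEquivRealProd.symm :=
          Complex.equivRealProdCLM.symm.continuous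
        simp only [smul_eq_mul]
        refine Continuous.mul ?_ ((toC b).continuous.comp this)
        fun_prop
      · rw [norm_smul, Complex.norm_exp_ofReal_mul_I, one_mul]
        exact le_of_eq rfl
  have h := congrFun (hFc.fourierInv_fourier_eq hFi (by rw [hFF]; exact hτ)) p
  rw [hFF, Real.fourierInv_eq'] at h
  refine Eq.trans ?_ h
  refine integral_congr_ae (Eventually.of_forall fun σ => ?_)
  simp only [smul_eq_mul]
  rw [mul_comm]
  congr 3
  simp
  ring

/-- The quantization of a Schwartz symbol, pointwise, is a Weyl integral. -/
lemma integral_ftC_mul_weylS {h ε : ℝ} (hh : 0 < h) (hε : ε ^ 2 = h) (b φ : 𝓢(ℝ × ℝ, ℂ))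
    (z : ℝ × ℝ) : ∫ ζ, ftC b ζ * weylS ε 0 ζ φ z = weylIntegral h b φ z := by
  obtain ⟨C, hC0, hC⟩ := exists_norm_schwartz_snd_le b
  set G : ℝ → ℂ := fun y' => φ (z.1, y') * ∫ q : ℝ, b ((z.2 + y') / 2, q) *
    Complex.exp (((z.2 - y') * q / h : ℝ) * Complex.I) with hG
  have hI : Integrable (fun ζ => ftC b ζ * weylS ε 0 ζ φ z) := by
    refine ((ftC b).integrable.norm.mul_const (SchwartzMap.seminorm ℝ 0 0 φ)).mono' ?_
      (Eventually.of_forall fun ζ => ?_)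
    · refine Continuous.aestronglyMeasurable ((ftC b).continuous.mul ?_)
      simp only [weylS_apply]
      have h1 := Complex.continuous_re
      have h2 := Complex.continuous_im
      exact (by fun_prop : Continuous fun ζ : ℂ => _).mul (φ.continuous.comp (by fun_prop))
    · rw [norm_mul]
      exact mul_le_mul_of_nonneg_left (norm_weylS_apply_le _ _ _ _ _) (norm_nonneg _)
  have hI' : Integrable (fun p : ℝ × ℝ => ftC b (Complex.measurableEquivRealProd.symm p) *
      weylS ε 0 (Complex.measurableEquivRealProd.symm p) φ z) (volume.prod volume) :=
    Complex.volume_preserving_equiv_real_prod.symm.integrable_comp_of_integrable hI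
  have h1 : ∫ ζ, ftC b ζ * weylS ε 0 ζ φ z = ∫ τ : ℝ, G (2 * Real.pi * h * τ + z.2) := by
    rw [← Complex.volume_preserving_equiv_real_prod.symm.integral_comp
      Complex.measurableEquivRealProd.symm.measurableEmbedding, Measure.volume_eq_prod,
      integral_prod_symm _ hI']
    refine integral_congr_ae ?_
    filter_upwards [ae_integral_ftC b] with τ hτ
    -- The translation in y sets y' = y + 2πhτ, and the phase 2π²στh moves the evaluation point from
    -- y to y + πhτ, which is the midpoint (y + y')/2.
    have h2 := hτ (z.2 + Real.pi * h * τ)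
    simp only [hG]
    have h3 : (z.2 + (2 * Real.pi * h * τ + z.2)) / 2 = z.2 + Real.pi * h * τ := by ring
    have h4 : ∀ q : ℝ, (z.2 - (2 * Real.pi * h * τ + z.2)) * q / h = -(2 * Real.pi * τ * q) := by
      intro q; field_simp; ring
    simp_rw [h3, h4]
    rw [← h2, ← integral_const_mul]
    refine integral_congr_ae (Eventually.of_forall fun σ => ?_)
    simp only [Complex.measurableEquivRealProd_symm_apply, weylS_apply]
    have h5 : z + (-(2 * Real.pi * 0 * ε * τ), 2 * Real.pi * ε ^ 2 * τ) =
        (z.1, 2 * Real.pi * h * τ + z.2) := by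
      ext
      · simp
      · simp [hε]; ring
    rw [h5, mul_comm (φ _), ← mul_assoc]
    congr 4
    rw [hε]
    ring_nf
  have h2 : ∫ τ : ℝ, G (2 * Real.pi * h * τ + z.2) =
      ((2 * Real.pi * h : ℝ) : ℂ)⁻¹ * ∫ y', G y' := by
    have := Measure.integral_comp_mul_left (fun y => G (y + z.2)) (2 * Real.pi * h)
    rw [this, integral_add_right_eq_self G, abs_of_nonneg (by positivity), Complex.real_smul,
      Complex.ofReal_inv]
  have h3 : ∫ y', G y' = ∫ η, weylInner h b φ z η := by
    simp only [hG, weylInner]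
    simp_rw [← integral_const_mul]
    obtain ⟨C', hC0', hC'⟩ := exists_norm_schwartz_snd_le φ
    rw [integral_integral_swap]
    · refine integral_congr_ae (Eventually.of_forall fun η => ?_)
      refine integral_congr_ae (Eventually.of_forall fun y' => ?_)
      simp only [mul_comm Complex.I]
      ring
    · have hm : Integrable (fun p : ℝ × ℝ => (C' * (1 + p.1 ^ 2)⁻¹) * (C * (1 + p.2 ^ 2)⁻¹))
          (volume.prod volume) :=
        Integrable.mul_prod (f := fun y : ℝ => C' * (1 + y ^ 2)⁻¹)
          (g := fun y : ℝ => C * (1 + y ^ 2)⁻¹) (integrable_inv_one_add_sq.const_mul C')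
          (integrable_inv_one_add_sq.const_mul C)
      refine hm.mono' (Continuous.aestronglyMeasurable ?_) (Eventually.of_forall fun p => ?_)
      · refine (φ.continuous.comp (by fun_prop)).mul ((b.continuous.comp ?_).mul ?_) <;> fun_prop
      · simp only [Function.uncurry]
        rw [norm_mul, norm_mul, Complex.norm_exp_ofReal_mul_I, mul_one]
        exact mul_le_mul (hC' _ _) (hC _ _) (norm_nonneg _) (by positivity)
  rw [h1, h2, h3, weylIntegral_eq]

lemma inner_opS_toL2 {h ε : ℝ} (hh : 0 < h) (hε : ε ^ 2 = h) (b φ ψ : 𝓢(ℝ × ℝ, ℂ)) :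
    ⟪toL2 ψ, opS ε 0 b (toL2 φ)⟫_ℂ = ∫ z, (starRingEnd ℂ) (ψ z) * weylIntegral h b φ z := by
  rw [inner_opS]
  simp_rw [weylU_toL2, inner_toL2_toL2, ← integral_const_mul]
  rw [integral_integral_swap]
  · refine integral_congr_ae (Eventually.of_forall fun z => ?_)
    simp only
    rw [← integral_ftC_mul_weylS hh hε, ← integral_const_mul]
    refine integral_congr_ae (Eventually.of_forall fun ζ => ?_)
    simp only
    ring
  · have hm : Integrable (fun p : ℂ × (ℝ × ℝ) => ‖ftC b p.1‖ *
        (‖ψ p.2‖ * SchwartzMap.seminorm ℝ 0 0 φ)) (volume.prod volume) :=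
      Integrable.mul_prod (f := fun ζ => ‖ftC b ζ‖)
        (g := fun z => ‖ψ z‖ * SchwartzMap.seminorm ℝ 0 0 φ) (ftC b).integrable.norm
        (ψ.integrable.norm.mul_const _)
    refine hm.mono' (Continuous.aestronglyMeasurable ?_) (Eventually.of_forall fun p => ?_)
    · refine ((ftC b).continuous.comp continuous_fst).mul
        ((Complex.continuous_conj.comp (ψ.continuous.comp continuous_snd)).mul ?_)
      simp only [weylS_apply]
      have h1 : Continuous fun p : ℂ × (ℝ × ℝ) => p.1.re :=
        Complex.continuous_re.comp continuous_fst
      have h2 : Continuous fun p : ℂ × (ℝ × ℝ) => p.1.im :=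
        Complex.continuous_im.comp continuous_fst
      exact (by fun_prop : Continuous fun p : ℂ × (ℝ × ℝ) => _).mul
        (φ.continuous.comp (by fun_prop))
    · simp only [Function.uncurry, norm_mul, RCLike.norm_conj]
      exact mul_le_mul_of_nonneg_left (mul_le_mul_of_nonneg_left
        (norm_weylS_apply_le _ _ _ _ _) (norm_nonneg _)) (norm_nonneg _)

lemma ae_eq_of_integral_conj_mul {f g : ℝ × ℝ → ℂ} (hf : LocallyIntegrable f)
    (hg : LocallyIntegrable g)
    (h : ∀ ψ : 𝓢(ℝ × ℝ, ℂ), ∫ z, (starRingEnd ℂ) (ψ z) * f z = ∫ z, (starRingEnd ℂ) (ψ z) * g z) :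
    f =ᵐ[volume] g := by
  refine ae_eq_of_integral_contDiff_smul_eq hf hg fun r hr hrs => ?_
  have hs : HasCompactSupport fun z => (r z : ℂ) := hrs.comp_left Complex.ofReal_zero
  have := h (hs.toSchwartzMap (Complex.ofRealCLM.contDiff.comp hr))
  have e : ∀ z, (hs.toSchwartzMap (Complex.ofRealCLM.contDiff.comp hr)) z = (r z : ℂ) :=
    fun z => rfl
  simpa [e, Complex.conj_ofReal, Complex.real_smul] using this

/-- Symbols have a Weyl quantization, which is the weak limit of the quantizations of cutoffs. -/
lemma exists_isWeyl_tendsto {h : ℝ} (hh : 0 < h) {K : ℕ → ℝ} {c : ℝ × ℝ → ℂ}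
    (hc : ContDiff ℝ ∞ c) (hK : SymbolBound K c) {b : ℕ → 𝓢(ℝ × ℝ, ℂ)} {K' : ℕ → ℝ}
    (hb : ∀ n, SymbolBound K' (b n))
    (hbc : ∀ z, ∀ᶠ n in atTop, (b n : ℝ × ℝ → ℂ) =ᶠ[𝓝 z] c) :
    ∃ A, IsWeyl h c A ∧ ∀ v u, Tendsto (fun n => ⟪v, opS (√h) 0 (b n) u⟫_ℂ) atTop
      (𝓝 ⟪v, A u⟫_ℂ) := by
  have hε : √h ^ 2 = h := Real.sq_sqrt hh.le
  obtain ⟨C, hC0, hC⟩ := exists_norm_opS_le (√h)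
  have hCn : ∀ n u, ‖opS (√h) 0 (b n) u‖ ≤ C * (∑ i ∈ Finset.range 4, K' i) * ‖u‖ := fun n u =>
    hC _ 0 (abs_of_nonneg (Real.sqrt_nonneg h)).le ⟨le_rfl, zero_le_one⟩ K' (b n) (hb n) u
  have hlim : ∀ ψ φ, Tendsto (fun n => ⟪toL2 ψ, opS (√h) 0 (b n) (toL2 φ)⟫_ℂ) atTop
      (𝓝 (∫ z, (starRingEnd ℂ) (ψ z) * weylIntegral h c φ z)) := by
    intro ψ φ
    simp_rw [inner_opS_toL2 hh hε]
    obtain ⟨C', hC0', hC'⟩ := exists_norm_weylIntegral_le hh φ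
    refine tendsto_integral_of_dominated_convergence
      (fun z => ‖ψ z‖ * (C' * ∑ i ∈ Finset.range 3, K' i)) (fun n => ?_)
      (ψ.integrable.norm.mul_const _) (fun n => Eventually.of_forall fun z => ?_)
      (Eventually.of_forall fun z => ?_)
    · exact (Complex.continuous_conj.comp ψ.continuous).aestronglyMeasurable.mul
        (stronglyMeasurable_weylIntegral h (b n).continuous φ).aestronglyMeasurable
    · rw [norm_mul, RCLike.norm_conj]
      exact mul_le_mul_of_nonneg_left (hC' K' _ ((b n).smooth ⊤) (hb n) z) (norm_nonneg _)
    · exact (tendsto_weylIntegral hh (fun n => (b n).smooth ⊤) hb hbc φ z).const_mul _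
  have hS : 0 ≤ ∑ i ∈ Finset.range 4, K' i := Finset.sum_nonneg fun i _ => (hb 0).nonneg i
  obtain ⟨A, hA⟩ := exists_weak_limit (mul_nonneg hC0 hS) hCn _ hlim
  refine ⟨A, fun φ => ?_, tendsto_inner_of_schwartz hCn fun ψ φ => by rw [hA]; exact hlim ψ φ⟩
  obtain ⟨C', hC0', hC'⟩ := exists_norm_weylIntegral_le hh φ
  -- The limit operator and the Weyl integral have the same pairings with Schwartz functions; the
  -- Weyl integral is bounded, so both sides are locally integrable.
  refine ae_eq_of_integral_conj_mul ((Lp.memLp _).locallyIntegrable (by norm_num)) ?_ fun ψ => ?_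
  · refine MemLp.locallyIntegrable (p := ⊤) ?_ le_top
    exact memLp_top_of_bound (stronglyMeasurable_weylIntegral h hc.continuous φ).aestronglyMeasurable
      _ (Eventually.of_forall (hC' K c hc hK))
  · rw [← hA, inner_toL2]
    rfl

lemma IsSymbol.exists_symbolBound {a : ℝ × ℝ → ℂ} (ha : IsSymbol a) : ∃ K, SymbolBound K a :=
  ⟨fun n => (ha.2 n).choose, fun n => (ha.2 n).choose_spec⟩

lemma IsSymbol.exists_isWeyl {c : ℝ × ℝ → ℂ} (hc : IsSymbol c) {h : ℝ} (hh : 0 < h) :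
    ∃ A, IsWeyl h c A := by
  obtain ⟨K, hK⟩ := hc.exists_symbolBound
  obtain ⟨D, -, hD⟩ := exists_cutoff
  obtain ⟨b, hb, hbc⟩ := hD K c hc.1 hK
  obtain ⟨A, hA, -⟩ := exists_isWeyl_tendsto hh hc.1 hK hb hbc
  exact ⟨A, hA⟩

lemma isWeyl_opWeyl {h : ℝ} {c : ℝ × ℝ → ℂ} (hA : ∃ A, IsWeyl h c A) :
    IsWeyl h c (opWeyl h c) := by
  rw [opWeyl, dif_pos hA]
  exact hA.choose_spec

lemma tendsto_inner_opS_opWeyl {h : ℝ} (hh : 0 < h) {c : ℝ × ℝ → ℂ}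
    (hc : IsSymbol c) {b : ℕ → 𝓢(ℝ × ℝ, ℂ)} {K' : ℕ → ℝ}
    (hb : ∀ n, SymbolBound K' (b n))
    (hbc : ∀ z, ∀ᶠ n in atTop, (b n : ℝ × ℝ → ℂ) =ᶠ[𝓝 z] c) (v u : L2Plane) :
    Tendsto (fun n => ⟪v, opS (√h) 0 (b n) u⟫_ℂ) atTop (𝓝 ⟪v, opWeyl h c u⟫_ℂ) := by
  obtain ⟨K, hK⟩ := hc.exists_symbolBound
  obtain ⟨A, hA, hlim⟩ := exists_isWeyl_tendsto hh hc.1 hK hb hbc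
  rw [(isWeyl_opWeyl ⟨A, hA⟩).unique hA]
  exact hlim v u

end WeylExistence

/-! ### An explicit unitary that diagonalizes P_1 and Q_1. -/

section Diagonalization

open scoped FourierTransform

/-- Multiplication by `y` on Schwartz functions. -/
noncomputable def yS : 𝓢(ℝ × ℝ, ℂ) →L[ℂ] 𝓢(ℝ × ℝ, ℂ) :=
  SchwartzMap.smulLeftCLM ℂ (fun z : ℝ × ℝ => (z.2 : ℂ))

lemma hasTemperateGrowth_ofReal_snd : (fun z : ℝ × ℝ => (z.2 : ℂ)).HasTemperateGrowth := by
  have := hasTemperateGrowth_snd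
  fun_prop

lemma yS_apply (φ : 𝓢(ℝ × ℝ, ℂ)) (z : ℝ × ℝ) : yS φ z = z.2 * φ z := by
  simp [yS, SchwartzMap.smulLeftCLM_apply_apply hasTemperateGrowth_ofReal_snd]

lemma partialS_apply (v : ℝ × ℝ) (φ : 𝓢(ℝ × ℝ, ℂ)) (z : ℝ × ℝ) :
    partialS v φ z = fderiv ℝ φ z v :=
  SchwartzMap.lineDerivOp_apply_eq_fderiv v φ z

/-- Schwartz functions on `ℝ × ℝ` and on `ℂ`. -/
noncomputable def toCEquiv : 𝓢(ℝ × ℝ, ℂ) ≃ₗ[ℂ] 𝓢(ℂ, ℂ) where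
  __ := toC.toLinearMap
  invFun := SchwartzMap.compCLMOfContinuousLinearEquiv ℂ Complex.equivRealProdCLM.symm
  left_inv φ := by ext z; rfl
  right_inv φ := by ext z; rfl

/-- The Fourier transform on `ℝ × ℝ`. -/
noncomputable def fourierE : 𝓢(ℝ × ℝ, ℂ) ≃ₗ[ℂ] 𝓢(ℝ × ℝ, ℂ) :=
  (toCEquiv.trans (FourierTransform.fourierEquiv ℂ 𝓢(ℂ, ℂ))).trans toCEquiv.symm

lemma fourierE_apply (φ : 𝓢(ℝ × ℝ, ℂ)) (w : ℝ × ℝ) : fourierE φ w = ftC φ ⟨w.1, w.2⟩ := rfl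

lemma fourierE_apply_eq_integral (φ : 𝓢(ℝ × ℝ, ℂ)) (w : ℝ × ℝ) : fourierE φ w =
    ∫ v : ℝ × ℝ, Complex.exp (((-(2 * Real.pi * (v.1 * w.1 + v.2 * w.2)) : ℝ) : ℂ) * Complex.I) *
      φ v := by
  rw [fourierE_apply, ftC, SchwartzMap.fourier_coe, Real.fourier_eq',
    ← Complex.volume_preserving_equiv_real_prod.symm.integral_comp
      Complex.measurableEquivRealProd.symm.measurableEmbedding]
  refine integral_congr_ae (Eventually.of_forall fun v => ?_)
  simp only [Complex.measurableEquivRealProd_symm_apply, toC_apply, Complex.inner, smul_eq_mul]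
  congr 3
  simp
  ring

lemma fourierE_rhoS (θ : ℝ) (l c : ℝ × ℝ) (φ : 𝓢(ℝ × ℝ, ℂ)) :
    fourierE (rhoS θ l c φ) = rhoS (θ - (l.1 * c.1 + l.2 * c.2)) (2 * Real.pi * c.1,
      2 * Real.pi * c.2) (-(l.1 / (2 * Real.pi)), -(l.2 / (2 * Real.pi))) (fourierE φ) := by
  ext w
  rw [rhoS_apply, fourierE_apply_eq_integral, fourierE_apply_eq_integral, ← integral_const_mul,
    ← integral_add_right_eq_self _ (-c)]
  refine integral_congr_ae (Eventually.of_forall fun v => ?_)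
  simp only [rhoS_apply, neg_add_cancel_right, phaseFun]
  rw [← mul_assoc, ← mul_assoc, ← Complex.exp_add, ← Complex.exp_add, ← add_mul, ← add_mul,
    ← Complex.ofReal_add, ← Complex.ofReal_add]
  congr 4
  simp only [Prod.fst_add, Prod.snd_add, Prod.fst_neg, Prod.snd_neg]
  have := Real.pi_ne_zero
  field_simp
  ring

lemma fourierE_partialS_fst (φ : 𝓢(ℝ × ℝ, ℂ)) :
    fourierE (partialS (1, 0) φ) = (2 * Real.pi * Complex.I) • xS (fourierE φ) := by
  ext w
  rw [smul_apply, xS_apply, fourierE_apply, fourierE_apply]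
  exact ftC_lineDeriv_fst φ _

lemma fourierE_partialS_snd (φ : 𝓢(ℝ × ℝ, ℂ)) :
    fourierE (partialS (0, 1) φ) = (2 * Real.pi * Complex.I) • yS (fourierE φ) := by
  ext w
  rw [smul_apply, yS_apply, fourierE_apply, fourierE_apply]
  exact ftC_lineDeriv_snd φ _

lemma lineDeriv_ftC (φ : 𝓢(ℝ × ℝ, ℂ)) (m : ℂ) {g : 𝓢(ℝ × ℝ, ℂ) →L[ℂ] 𝓢(ℝ × ℝ, ℂ)}
    (hg : ∀ φ z, g φ z = (z.1 * m.re + z.2 * m.im : ℝ) * φ z) :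
    ∂_{m} (ftC φ) = (-(2 * Real.pi * Complex.I)) • ftC (g φ) := by
  rw [ftC, SchwartzMap.lineDerivOp_fourier_eq, FourierTransform.fourier_smul, ftC]
  congr 2
  ext ζ
  have : (fun x : ℂ => inner ℝ x m).HasTemperateGrowth := by fun_prop
  rw [SchwartzMap.smulLeftCLM_apply_apply this, toC_apply, toC_apply, hg, Complex.real_smul]
  congr 2
  simp [Complex.inner]
  ring

lemma partialS_fourierE_fst (φ : 𝓢(ℝ × ℝ, ℂ)) :
    partialS (1, 0) (fourierE φ) = (-(2 * Real.pi * Complex.I)) • fourierE (xS φ) := by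
  have h := lineDeriv_ftC φ 1 (g := xS) fun φ z => by simp [xS_apply]
  have h' : toC (partialS (1, 0) (fourierE φ)) = ∂_{(1 : ℂ)} (toC (fourierE φ)) := by
    rw [lineDeriv_toC]; rfl
  apply toCEquiv.injective
  exact h'.trans h

lemma partialS_fourierE_snd (φ : 𝓢(ℝ × ℝ, ℂ)) :
    partialS (0, 1) (fourierE φ) = (-(2 * Real.pi * Complex.I)) • fourierE (yS φ) := by
  have h := lineDeriv_ftC φ Complex.I (g := yS) fun φ z => by simp [yS_apply]
  have h' : toC (partialS (0, 1) (fourierE φ)) = ∂_{Complex.I} (toC (fourierE φ)) := by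
    rw [lineDeriv_toC]; simp [partialS]
  apply toCEquiv.injective
  exact h'.trans h

lemma norm_toL2_sq (φ : 𝓢(ℝ × ℝ, ℂ)) : ‖toL2 φ‖ ^ 2 = ∫ z, ‖φ z‖ ^ 2 := by
  have h := inner_toL2_toL2 φ φ
  rw [inner_self_eq_norm_sq_to_K] at h
  have h1 : ∀ z, (starRingEnd ℂ) (φ z) * φ z = ((‖φ z‖ ^ 2 : ℝ) : ℂ) := fun z => by
    rw [mul_comm, Complex.mul_conj, Complex.normSq_eq_norm_sq]
  simp_rw [h1] at h
  have h2 : ∫ z, ((‖φ z‖ ^ 2 : ℝ) : ℂ) = ((∫ z, ‖φ z‖ ^ 2 : ℝ) : ℂ) := integral_ofReal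
  rw [h2] at h
  refine Complex.ofReal_injective ?_
  rw [← h]
  push_cast
  rfl

lemma norm_toL2_eq {φ ψ : 𝓢(ℝ × ℝ, ℂ)} (h : ∫ z, ‖φ z‖ ^ 2 = ∫ z, ‖ψ z‖ ^ 2) :
    ‖toL2 φ‖ = ‖toL2 ψ‖ := by
  rw [← norm_toL2_sq, ← norm_toL2_sq] at h
  exact (pow_left_inj₀ (norm_nonneg _) (norm_nonneg _) two_ne_zero).1 h

lemma norm_toL2_fourierE (φ : 𝓢(ℝ × ℝ, ℂ)) : ‖toL2 (fourierE φ)‖ = ‖toL2 φ‖ := by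
  refine norm_toL2_eq ?_
  have e : ∀ f : 𝓢(ℂ, ℂ), ∫ z : ℝ × ℝ, ‖f ⟨z.1, z.2⟩‖ ^ 2 = ∫ ζ, ‖f ζ‖ ^ 2 := fun f =>
    Complex.volume_preserving_equiv_real_prod.symm.integral_comp
      Complex.measurableEquivRealProd.symm.measurableEmbedding fun ζ => ‖f ζ‖ ^ 2
  exact ((e (ftC φ)).trans (SchwartzMap.integral_norm_sq_fourier (toC φ))).trans (e (toC φ)).symm

/-- The chirp `exp (i π s y²)`. -/
noncomputable def chirpFun (s : ℝ) (z : ℝ × ℝ) : ℂ :=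
  Complex.exp (((s * (Real.pi * z.2 ^ 2) : ℝ) : ℂ) * Complex.I)

lemma hasTemperateGrowth_chirpFun (s : ℝ) : (chirpFun s).HasTemperateGrowth := by
  have h2 := hasTemperateGrowth_snd
  have h : (fun z : ℝ × ℝ => s * (Real.pi * z.2 ^ 2)).HasTemperateGrowth := by fun_prop
  exact hasTemperateGrowth_cexp_ofReal_mul_I.comp h

lemma chirpFun_neg_mul (s : ℝ) (z : ℝ × ℝ) : chirpFun (-s) z * chirpFun s z = 1 := by
  rw [chirpFun, chirpFun, ← Complex.exp_add, ← Complex.exp_zero]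
  congr 1
  push_cast
  ring

lemma smulLeftCLM_chirpFun_apply (s : ℝ) (φ : 𝓢(ℝ × ℝ, ℂ)) (z : ℝ × ℝ) :
    SchwartzMap.smulLeftCLM ℂ (chirpFun s) φ z = chirpFun s z * φ z := by
  simp [SchwartzMap.smulLeftCLM_apply_apply (hasTemperateGrowth_chirpFun s)]

/-- Multiplication by the chirp `exp (i π y²)`. -/
noncomputable def chirpE : 𝓢(ℝ × ℝ, ℂ) ≃ₗ[ℂ] 𝓢(ℝ × ℝ, ℂ) where
  __ := (SchwartzMap.smulLeftCLM ℂ (chirpFun 1)).toLinearMap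
  invFun := SchwartzMap.smulLeftCLM ℂ (chirpFun (-1))
  left_inv φ := by
    ext z
    change SchwartzMap.smulLeftCLM ℂ (chirpFun (-1)) (SchwartzMap.smulLeftCLM ℂ (chirpFun 1) φ) z = _
    rw [smulLeftCLM_chirpFun_apply, smulLeftCLM_chirpFun_apply, ← mul_assoc, chirpFun_neg_mul,
      one_mul]
  right_inv φ := by
    ext z
    change SchwartzMap.smulLeftCLM ℂ (chirpFun 1) (SchwartzMap.smulLeftCLM ℂ (chirpFun (-1)) φ) z = _
    rw [smulLeftCLM_chirpFun_apply, smulLeftCLM_chirpFun_apply, ← mul_assoc,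
      mul_comm (chirpFun 1 z), chirpFun_neg_mul, one_mul]

lemma chirpE_apply (φ : 𝓢(ℝ × ℝ, ℂ)) (z : ℝ × ℝ) :
    chirpE φ z = Complex.exp (((Real.pi * z.2 ^ 2 : ℝ) : ℂ) * Complex.I) * φ z := by
  have := smulLeftCLM_chirpFun_apply 1 φ z
  rw [chirpFun, one_mul] at this
  exact this

lemma norm_toL2_chirpE (φ : 𝓢(ℝ × ℝ, ℂ)) : ‖toL2 (chirpE φ)‖ = ‖toL2 φ‖ := by
  refine norm_toL2_eq (integral_congr_ae (Eventually.of_forall fun z => ?_))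
  simp only [chirpE_apply, norm_mul, Complex.norm_exp_ofReal_mul_I, one_mul]

lemma chirpE_xS (φ : 𝓢(ℝ × ℝ, ℂ)) : chirpE (xS φ) = xS (chirpE φ) := by
  ext z; simp only [chirpE_apply, xS_apply]; ring

lemma chirpE_yS (φ : 𝓢(ℝ × ℝ, ℂ)) : chirpE (yS φ) = yS (chirpE φ) := by
  ext z; simp only [chirpE_apply, yS_apply]; ring

lemma fderiv_chirpE (φ : 𝓢(ℝ × ℝ, ℂ)) (z v : ℝ × ℝ) : fderiv ℝ (chirpE φ) z v =
    chirpE (partialS v φ) z + 2 * Real.pi * Complex.I * v.2 * (z.2 * chirpE φ z) := by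
  have h1 : (chirpE φ : ℝ × ℝ → ℂ) = fun z =>
      Complex.exp (((Real.pi * z.2 ^ 2 : ℝ) : ℂ) * Complex.I) * φ z :=
    funext fun z => chirpE_apply φ z
  have h3 : HasFDerivAt (fun z : ℝ × ℝ => ((Real.pi * z.2 ^ 2 : ℝ) : ℂ))
      (Complex.ofRealCLM.comp (Real.pi • ((2 * z.2) • ContinuousLinearMap.snd ℝ ℝ ℝ))) z := by
    refine Complex.ofRealCLM.hasFDerivAt.comp z (HasFDerivAt.const_mul ?_ Real.pi)
    have h := (hasDerivAt_pow 2 z.2).comp_hasFDerivAt z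
      (hasFDerivAt_snd (𝕜 := ℝ) (E := ℝ) (F := ℝ) (p := z))
    rw [Nat.cast_ofNat, pow_one] at h
    exact h
  have h5 : HasFDerivAt (fun z : ℝ × ℝ =>
      Complex.exp (((Real.pi * z.2 ^ 2 : ℝ) : ℂ) * Complex.I) * φ z) _ z :=
    ((h3.mul_const Complex.I).cexp).mul (φ.hasFDerivAt z)
  rw [chirpE_apply, chirpE_apply, partialS_apply, h1, h5.fderiv]
  simp
  ring

lemma partialS_chirpE_fst (φ : 𝓢(ℝ × ℝ, ℂ)) :
    partialS (1, 0) (chirpE φ) = chirpE (partialS (1, 0) φ) := by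
  ext z
  rw [partialS_apply, fderiv_chirpE]
  simp

lemma partialS_chirpE_snd (φ : 𝓢(ℝ × ℝ, ℂ)) : partialS (0, 1) (chirpE φ) =
    chirpE (partialS (0, 1) φ) + (2 * Real.pi * Complex.I) • yS (chirpE φ) := by
  ext z
  rw [partialS_apply, fderiv_chirpE, add_apply, smul_apply, yS_apply]
  simp

lemma chirpE_rhoS (θ : ℝ) (l c : ℝ × ℝ) (φ : 𝓢(ℝ × ℝ, ℂ)) : chirpE (rhoS θ l c φ) =
    rhoS (θ - Real.pi * c.2 ^ 2) (l.1, l.2 - 2 * Real.pi * c.2) c (chirpE φ) := by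
  ext z
  simp only [chirpE_apply, rhoS_apply, phaseFun]
  rw [← mul_assoc, ← mul_assoc, ← Complex.exp_add, ← Complex.exp_add, ← add_mul, ← add_mul,
    ← Complex.ofReal_add, ← Complex.ofReal_add]
  congr 4
  simp only [Prod.snd_add]
  ring

/-- The coordinate change `(p, m) ↦ (-m, p + ε m)`. -/
noncomputable def shearL (ε : ℝ) : (ℝ × ℝ) ≃L[ℝ] (ℝ × ℝ) :=
  LinearEquiv.toContinuousLinearEquiv
    { toFun := fun z => (-z.2, z.1 + ε * z.2)
      invFun := fun z => (ε * z.1 + z.2, -z.1)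
      map_add' := fun z w => by ext <;> simp <;> ring
      map_smul' := fun c z => by ext <;> simp; ring
      left_inv := fun z => by ext <;> simp
      right_inv := fun z => by ext <;> simp }

lemma measurePreserving_shearL (ε : ℝ) : MeasurePreserving (shearL ε) := by
  have h := MeasurePreserving.skew_product (μa := (volume : Measure ℝ))
    (μb := (volume : Measure ℝ)) (μc := (volume : Measure ℝ)) (μd := (volume : Measure ℝ))
    (f := fun m : ℝ => -m) (g := fun m p => p + ε * m)
    (Measure.measurePreserving_neg volume) (by fun_prop)
    (Eventually.of_forall fun m => (measurePreserving_add_right volume (ε * m)).map_eq)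
  exact h.comp Measure.measurePreserving_swap

/-- The coordinate change `(p, m) ↦ (-m, p + ε m)` acting on Schwartz functions. -/
noncomputable def shearE (ε : ℝ) : 𝓢(ℝ × ℝ, ℂ) ≃ₗ[ℂ] 𝓢(ℝ × ℝ, ℂ) where
  __ := (SchwartzMap.compCLMOfContinuousLinearEquiv ℂ (shearL ε)).toLinearMap
  invFun := SchwartzMap.compCLMOfContinuousLinearEquiv ℂ (shearL ε).symm
  left_inv φ := by
    ext z
    change φ (shearL ε ((shearL ε).symm z)) = φ z
    rw [ContinuousLinearEquiv.apply_symm_apply]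
  right_inv φ := by
    ext z
    change φ ((shearL ε).symm (shearL ε z)) = φ z
    rw [ContinuousLinearEquiv.symm_apply_apply]

lemma shearE_apply (ε : ℝ) (φ : 𝓢(ℝ × ℝ, ℂ)) (z : ℝ × ℝ) :
    shearE ε φ z = φ (-z.2, z.1 + ε * z.2) := rfl

lemma norm_toL2_shearE (ε : ℝ) (φ : 𝓢(ℝ × ℝ, ℂ)) : ‖toL2 (shearE ε φ)‖ = ‖toL2 φ‖ :=
  norm_toL2_eq ((measurePreserving_shearL ε).integral_comp
    (shearL ε).toHomeomorph.measurableEmbedding fun z => ‖φ z‖ ^ 2)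

lemma shearE_rhoS (ε θ : ℝ) (l c : ℝ × ℝ) (φ : 𝓢(ℝ × ℝ, ℂ)) : shearE ε (rhoS θ l c φ) =
    rhoS θ (l.2, ε * l.2 - l.1) (ε * c.1 + c.2, -c.1) (shearE ε φ) := by
  ext z
  simp only [shearE_apply, rhoS_apply, phaseFun]
  congr 2
  · congr 2
    ring
  · ext
    · simp; ring
    · simp; ring

/-- The operator `ε x + y` on Schwartz functions. -/
noncomputable def pS (ε : ℝ) : 𝓢(ℝ × ℝ, ℂ) →L[ℂ] 𝓢(ℝ × ℝ, ℂ) := (ε : ℂ) • xS + yS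

/-- The operator `ε² D_y - ε D_x` on Schwartz functions. -/
noncomputable def qS (ε : ℝ) : 𝓢(ℝ × ℝ, ℂ) →L[ℂ] 𝓢(ℝ × ℝ, ℂ) :=
  (-Complex.I * ε) • ((ε : ℂ) • partialS (0, 1) - partialS (1, 0))

/-- With x = −m and y = p + εm one has εx + y = p and ∂_m = ε∂_y − ∂_x. After the shear P_1 is
multiplication by the first variable and Q_1 a derivative in the second. -/
lemma shearE_pS (ε : ℝ) (φ : 𝓢(ℝ × ℝ, ℂ)) : shearE ε (pS ε φ) = xS (shearE ε φ) := by
  ext z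
  simp only [shearE_apply, pS, add_apply, smul_apply, xS_apply, yS_apply, smul_eq_mul]
  push_cast
  ring

lemma shearE_qS (ε : ℝ) (φ : 𝓢(ℝ × ℝ, ℂ)) :
    shearE ε (qS ε φ) = (-Complex.I * ε) • partialS (0, 1) (shearE ε φ) := by
  ext z
  have h : HasFDerivAt (shearE ε φ) ((fderiv ℝ φ (shearL ε z)).comp
      (shearL ε : (ℝ × ℝ) →L[ℝ] (ℝ × ℝ))) z :=
    (φ.hasFDerivAt (shearL ε z)).comp z (shearL ε).hasFDerivAt
  have e : ((-1, ε) : ℝ × ℝ) = ε • (0, 1) - (1, 0) := by ext <;> simp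
  rw [smul_apply, partialS_apply, h.fderiv]
  change _ = (-Complex.I * ε) • fderiv ℝ φ (shearL ε z) (-1, 0 + ε * 1)
  rw [zero_add, mul_one, e, map_sub, map_smul, shearE_apply, qS, smul_apply, sub_apply, smul_apply,
    smul_apply, sub_apply, smul_apply, partialS_apply, partialS_apply]
  rfl

/-- The unitary that diagonalizes `ε x + y` and `ε² D_y - ε D_x`, on Schwartz functions. -/
noncomputable def diagE (ε : ℝ) : 𝓢(ℝ × ℝ, ℂ) ≃ₗ[ℂ] 𝓢(ℝ × ℝ, ℂ) :=
  ((((shearE ε).trans chirpE).trans fourierE).trans chirpE).trans fourierE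

lemma diagE_apply (ε : ℝ) (φ : 𝓢(ℝ × ℝ, ℂ)) :
    diagE ε φ = fourierE (chirpE (fourierE (chirpE (shearE ε φ)))) := rfl

lemma norm_toL2_diagE (ε : ℝ) (φ : 𝓢(ℝ × ℝ, ℂ)) : ‖toL2 (diagE ε φ)‖ = ‖toL2 φ‖ := by
  rw [diagE_apply, norm_toL2_fourierE, norm_toL2_chirpE, norm_toL2_fourierE, norm_toL2_chirpE,
    norm_toL2_shearE]

lemma fourierE_xS (φ : 𝓢(ℝ × ℝ, ℂ)) :
    fourierE (xS φ) = (-(2 * Real.pi * Complex.I))⁻¹ • partialS (1, 0) (fourierE φ) := by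
  rw [partialS_fourierE_fst, smul_smul, inv_mul_cancel₀ (neg_ne_zero.2 Complex.two_pi_I_ne_zero),
    one_smul]

lemma fourierE_yS (φ : 𝓢(ℝ × ℝ, ℂ)) :
    fourierE (yS φ) = (-(2 * Real.pi * Complex.I))⁻¹ • partialS (0, 1) (fourierE φ) := by
  rw [partialS_fourierE_snd, smul_smul, inv_mul_cancel₀ (neg_ne_zero.2 Complex.two_pi_I_ne_zero),
    one_smul]

/-- The chirps involve only the second variable; in the first the two Fourier transforms compose to
a reflection, hence the sign. -/
lemma diagE_pS (ε : ℝ) (φ : 𝓢(ℝ × ℝ, ℂ)) : diagE ε (pS ε φ) = (-1 : ℂ) • xS (diagE ε φ) := by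
  rw [diagE_apply, diagE_apply, shearE_pS, chirpE_xS, fourierE_xS, map_smul, map_smul,
    ← partialS_chirpE_fst, fourierE_partialS_fst, smul_smul, inv_neg, neg_mul,
    inv_mul_cancel₀ Complex.two_pi_I_ne_zero]

/-- In the second variable the successive factors take ∂ to ∂ − 2πiy, then to ∂ + 2πiy, then to ∂,
then to 2πiy. The chirps make two full Fourier transforms act like a single one in this variable. -/
lemma diagE_qS (ε : ℝ) (φ : 𝓢(ℝ × ℝ, ℂ)) :
    diagE ε (qS ε φ) = (2 * Real.pi * ε : ℂ) • yS (diagE ε φ) := by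
  rw [diagE_apply, diagE_apply, shearE_qS]
  generalize shearE ε φ = G
  simp only [map_smul]
  have h1 : chirpE (partialS (0, 1) G) =
      partialS (0, 1) (chirpE G) - (2 * Real.pi * Complex.I) • yS (chirpE G) := by
    rw [partialS_chirpE_snd, add_sub_cancel_right]
  rw [h1]
  generalize chirpE G = G
  have h2 : fourierE (partialS (0, 1) G - (2 * Real.pi * Complex.I) • yS G) =
      (2 * Real.pi * Complex.I) • yS (fourierE G) + partialS (0, 1) (fourierE G) := by
    rw [map_sub, map_smul, fourierE_partialS_snd, fourierE_yS, smul_smul, inv_neg, mul_neg,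
      mul_inv_cancel₀ Complex.two_pi_I_ne_zero, neg_one_smul, sub_neg_eq_add]
  rw [h2]
  generalize fourierE G = G
  have h3 : chirpE ((2 * Real.pi * Complex.I) • yS G + partialS (0, 1) G) =
      partialS (0, 1) (chirpE G) := by
    rw [map_add, map_smul, chirpE_yS, partialS_chirpE_snd, add_comm]
  rw [h3, fourierE_partialS_snd, smul_smul]
  congr 1
  linear_combination (-(2 * Real.pi * ε : ℂ)) * Complex.I_sq

lemma diagE_weylS (ε : ℝ) (ζ : ℂ) (φ : 𝓢(ℝ × ℝ, ℂ)) : diagE ε (weylS ε 1 ζ φ) =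
    rhoS 0 (-(2 * Real.pi * ζ.re), 4 * Real.pi ^ 2 * ε * ζ.im) 0 (diagE ε φ) := by
  rw [diagE_apply, diagE_apply, weylS, shearE_rhoS, chirpE_rhoS, fourierE_rhoS, chirpE_rhoS,
    fourierE_rhoS]
  have := Real.pi_ne_zero
  congr 2
  · simp; field_simp; ring
  · ext
    · simp
    · simp; field_simp; ring
  · ext
    · simp; ring
    · simp; field_simp; ring

end Diagonalization

/-! ### The joint functional calculus and its agreement with Op_1. -/

section JointSpectrum

lemma locallyIntegrable_mul {r : ℝ × ℝ → ℂ} (hr : Continuous r) (u : L2Plane) :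
    LocallyIntegrable fun z => r z * u z := by
  have hu : LocallyIntegrable u := (Lp.memLp u).locallyIntegrable (by norm_num)
  rw [← locallyIntegrableOn_univ] at hu ⊢
  exact hu.continuousOn_mul hr.continuousOn isOpen_univ.isLocallyClosed

/-- Multiplication operators, tested on Schwartz functions. -/
lemma ae_eq_mul_iff {r : ℝ × ℝ → ℝ} (hr : Continuous r) {R : 𝓢(ℝ × ℝ, ℂ) → 𝓢(ℝ × ℝ, ℂ)}
    (hR : ∀ φ z, R φ z = r z * φ z) (u w : L2Plane) :
    (w =ᵐ[volume] fun z => (r z : ℂ) * u z) ↔ ∀ φ, ⟪toL2 φ, w⟫_ℂ = ⟪toL2 (R φ), u⟫_ℂ := by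
  have h1 : ∀ φ, ⟪toL2 (R φ), u⟫_ℂ = ∫ z, (starRingEnd ℂ) (φ z) * ((r z : ℂ) * u z) := by
    intro φ
    rw [inner_toL2]
    refine integral_congr_ae (Eventually.of_forall fun z => ?_)
    simp only [hR, map_mul, Complex.conj_ofReal]
    ring
  simp_rw [h1, inner_toL2]
  constructor
  · intro h φ
    refine integral_congr_ae ?_
    filter_upwards [h] with z hz
    rw [hz]
  · intro h
    exact ae_eq_of_integral_conj_mul ((Lp.memLp w).locallyIntegrable (by norm_num))
      (locallyIntegrable_mul (Complex.continuous_ofReal.comp hr) u) h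

lemma mem_opP_iff {h : ℝ} {u w : L2Plane} :
    (u, w) ∈ opP h ↔ ∀ φ, ⟪toL2 φ, w⟫_ℂ = ⟪toL2 (pS (√h) φ), u⟫_ℂ := by
  refine ae_eq_mul_iff (r := fun z => √h * z.1 + z.2) (by fun_prop) (fun φ z => ?_) u w
  simp only [pS, add_apply, smul_apply, xS_apply, yS_apply, smul_eq_mul]
  push_cast
  ring

lemma conjS_partialS (v : ℝ × ℝ) (φ : 𝓢(ℝ × ℝ, ℂ)) :
    conjS (partialS v φ) = ∂_{v} (conjS φ) := (lineDeriv_conjS v φ).symm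

lemma mem_opQ_iff {h : ℝ} (hh : 0 ≤ h) {u w : L2Plane} :
    (u, w) ∈ opQ h ↔ ∀ φ, ⟪toL2 φ, w⟫_ℂ = ⟪toL2 (qS (√h) φ), u⟫_ℂ := by
  have key : ∀ φ, ((h : ℂ) • distDy (u : 𝓢'(ℝ × ℝ, ℂ)) - ((√h : ℝ) : ℂ) •
      distDx (u : 𝓢'(ℝ × ℝ, ℂ))) (conjS φ) = ⟪toL2 (qS (√h) φ), u⟫_ℂ := by
    intro φ
    have e1 : distDy (u : 𝓢'(ℝ × ℝ, ℂ)) (conjS φ) =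
        (-Complex.I) * (∂_{((0, 1) : ℝ × ℝ)} (u : 𝓢'(ℝ × ℝ, ℂ))) (conjS φ) := rfl
    have e2 : distDx (u : 𝓢'(ℝ × ℝ, ℂ)) (conjS φ) =
        (-Complex.I) * (∂_{((1, 0) : ℝ × ℝ)} (u : 𝓢'(ℝ × ℝ, ℂ))) (conjS φ) := rfl
    have e3 : ((h : ℂ) • distDy (u : 𝓢'(ℝ × ℝ, ℂ)) - ((√h : ℝ) : ℂ) •
        distDx (u : 𝓢'(ℝ × ℝ, ℂ))) (conjS φ) = (h : ℂ) * distDy (u : 𝓢'(ℝ × ℝ, ℂ)) (conjS φ) -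
          ((√h : ℝ) : ℂ) * distDx (u : 𝓢'(ℝ × ℝ, ℂ)) (conjS φ) := rfl
    have e4 : ∀ v : ℝ × ℝ, (∂_{v} (u : 𝓢'(ℝ × ℝ, ℂ))) (conjS φ) =
        -⟪toL2 (partialS v φ), u⟫_ℂ := by
      intro v
      rw [TemperedDistribution.lineDerivOp_apply_apply, map_neg, ← conjS_partialS,
        distribution_apply, conjS_conjS]
    have e5 : (h : ℂ) = ((√h : ℝ) : ℂ) * ((√h : ℝ) : ℂ) := by
      rw [← Complex.ofReal_mul, Real.mul_self_sqrt hh]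
    rw [e3, e1, e2, e4, e4, qS, smul_apply, sub_apply, smul_apply, map_smul, map_sub, map_smul,
      inner_smul_left, inner_sub_left, inner_smul_left, e5]
    simp
    ring
  constructor
  · intro hw φ
    have hw' : (w : 𝓢'(ℝ × ℝ, ℂ)) = (h : ℂ) • distDy (u : 𝓢'(ℝ × ℝ, ℂ)) - ((√h : ℝ) : ℂ) •
      distDx (u : 𝓢'(ℝ × ℝ, ℂ)) := hw
    rw [← key, ← hw', distribution_apply, conjS_conjS]
  · intro hw
    refine DFunLike.ext _ _ fun φ => ?_
    rw [← conjS_conjS φ, key, distribution_apply, conjS_conjS, hw]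

/-- The unitary that diagonalizes `ε x + y` and `ε² D_y - ε D_x`. -/
noncomputable def diagU (ε : ℝ) : L2Plane ≃ₗᵢ[ℂ] L2Plane :=
  (diagE ε).extendOfIsometry toL2.toLinearMap toL2.toLinearMap denseRange_toL2 denseRange_toL2
    (norm_toL2_diagE ε)

lemma diagU_toL2 (ε : ℝ) (φ : 𝓢(ℝ × ℝ, ℂ)) : diagU ε (toL2 φ) = toL2 (diagE ε φ) :=
  LinearEquiv.extendOfIsometry_eq (diagE ε) toL2.toLinearMap toL2.toLinearMap denseRange_toL2
    denseRange_toL2 (norm_toL2_diagE ε) φ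

attribute [irreducible] diagU

/-- The joint spectral parameters of `ε x + y` and `ε² D_y - ε D_x`. -/
noncomputable def specFun (ε : ℝ) (v : ℝ × ℝ) : ℝ × ℝ := (-v.1, 2 * Real.pi * ε * v.2)

lemma continuous_specFun (ε : ℝ) : Continuous (specFun ε) := by
  unfold specFun; fun_prop

/-- The unitary maps Schwartz space onto itself, so weak identities transfer in both directions and
maximal domains correspond exactly. -/
lemma inner_diagU_iff {ε : ℝ} {A R : 𝓢(ℝ × ℝ, ℂ) → 𝓢(ℝ × ℝ, ℂ)}
    (hAR : ∀ φ, diagE ε (A φ) = R (diagE ε φ)) (u w : L2Plane) :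
    (∀ φ, ⟪toL2 φ, w⟫_ℂ = ⟪toL2 (A φ), u⟫_ℂ) ↔
      ∀ ψ, ⟪toL2 ψ, diagU ε w⟫_ℂ = ⟪toL2 (R ψ), diagU ε u⟫_ℂ := by
  have h1 : ∀ φ v, ⟪toL2 φ, v⟫_ℂ = ⟪toL2 (diagE ε φ), diagU ε v⟫_ℂ := fun φ v => by
    rw [← diagU_toL2, LinearIsometryEquiv.inner_map_map]
  constructor
  · intro h ψ
    have := h ((diagE ε).symm ψ)
    rwa [h1, h1 (A _), hAR, LinearEquiv.apply_symm_apply] at this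
  · intro h φ
    rw [h1, h1 (A _), hAR, h]

lemma mem_opP_iff_diagU {h : ℝ} {u w : L2Plane} : (u, w) ∈ opP h ↔
    diagU (√h) w =ᵐ[volume] fun v => ((specFun (√h) v).1 : ℂ) * diagU (√h) u v := by
  rw [mem_opP_iff, inner_diagU_iff (A := fun φ => pS (√h) φ) (R := fun ψ => (-1 : ℂ) • xS ψ) (diagE_pS (√h))]
  refine (ae_eq_mul_iff (r := fun v => (specFun (√h) v).1)
    (continuous_fst.comp (continuous_specFun _)) (fun φ z => ?_) _ _).symm
  simp [specFun, xS_apply]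

lemma mem_opQ_iff_diagU {h : ℝ} (hh : 0 ≤ h) {u w : L2Plane} : (u, w) ∈ opQ h ↔
    diagU (√h) w =ᵐ[volume] fun v => ((specFun (√h) v).2 : ℂ) * diagU (√h) u v := by
  rw [mem_opQ_iff hh, inner_diagU_iff (A := fun φ => qS (√h) φ)
    (R := fun ψ => (2 * Real.pi * (√h : ℝ) : ℂ) • yS ψ) (diagE_qS (√h))]
  refine (ae_eq_mul_iff (r := fun v => (specFun (√h) v).2)
    (continuous_snd.comp (continuous_specFun _)) (fun φ z => ?_) _ _).symm
  simp [specFun, yS_apply, mul_assoc]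

lemma inner_diagU_weylU (ε : ℝ) (ζ : ℂ) (ψ : 𝓢(ℝ × ℝ, ℂ)) (u : L2Plane) :
    ⟪toL2 ψ, diagU ε (weylU ε 1 ζ u)⟫_ℂ = ∫ v, (starRingEnd ℂ) (ψ v) *
      (phaseFun 0 (-(2 * Real.pi * ζ.re), 4 * Real.pi ^ 2 * ε * ζ.im) v * diagU ε u v) := by
  obtain ⟨φ, rfl⟩ := (diagE ε).surjective ψ
  rw [← diagU_toL2, LinearIsometryEquiv.inner_map_map, inner_weylU_left,
    ← LinearIsometryEquiv.inner_map_map (diagU ε), diagU_toL2, diagE_weylS, inner_toL2]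
  refine integral_congr_ae (Eventually.of_forall fun v => ?_)
  simp only [rhoS_apply, add_zero, map_mul]
  rw [mul_comm ((starRingEnd ℂ) _) ((starRingEnd ℂ) (diagE ε φ v)), mul_assoc]
  congr 2
  rw [phaseFun, phaseFun, ← Complex.exp_conj, map_mul, Complex.conj_ofReal, Complex.conj_I]
  congr 1
  simp only [Complex.neg_re, Complex.neg_im]
  push_cast
  ring

lemma integrable_conj_mul (ψ : 𝓢(ℝ × ℝ, ℂ)) (u : L2Plane) :
    Integrable fun v => (starRingEnd ℂ) (ψ v) * u v := by
  have h := L2.integrable_inner (𝕜 := ℂ) (toL2 ψ) u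
  refine h.congr ?_
  filter_upwards [ψ.coeFn_toLp 2 volume] with z hz
  rw [SchwartzMap.toLpCLM_apply, hz, RCLike.inner_apply']

lemma integral_ftC_mul_phaseFun (ε : ℝ) (b : 𝓢(ℝ × ℝ, ℂ)) (v : ℝ × ℝ) :
    ∫ ζ, ftC b ζ * phaseFun 0 (-(2 * Real.pi * ζ.re), 4 * Real.pi ^ 2 * ε * ζ.im) v =
      b (specFun ε v) := by
  have h1 : b (specFun ε v) = toC b ⟨(specFun ε v).1, (specFun ε v).2⟩ := rfl
  have h2 : toC b = FourierTransformInv.fourierInv (ftC b) :=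
    (FourierTransform.fourierInv_fourier_eq (toC b)).symm
  rw [h1, h2, SchwartzMap.fourierInv_coe, Real.fourierInv_eq']
  refine integral_congr_ae (Eventually.of_forall fun ζ => ?_)
  simp only [smul_eq_mul, phaseFun, specFun]
  rw [mul_comm]
  congr 3
  simp [Complex.inner]
  ring

/-- At t = 1 the unitary turns the Weyl system into pure modulations, and Fourier inversion sums
them to multiplication by b at the joint spectral parameters. -/
lemma inner_diagU_opS (ε : ℝ) (b ψ : 𝓢(ℝ × ℝ, ℂ)) (u : L2Plane) :
    ⟪toL2 ψ, diagU ε (opS ε 1 b u)⟫_ℂ =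
      ∫ v, (starRingEnd ℂ) (ψ v) * (b (specFun ε v) * diagU ε u v) := by
  have h0 : ∀ w, ⟪toL2 ψ, diagU ε w⟫_ℂ = ⟪(diagU ε).symm (toL2 ψ), w⟫_ℂ := fun w => by
    have := (diagU ε).inner_map_map ((diagU ε).symm (toL2 ψ)) w
    rwa [LinearIsometryEquiv.apply_symm_apply] at this
  rw [h0, inner_opS]
  simp_rw [← h0, inner_diagU_weylU, ← integral_const_mul]
  rw [integral_integral_swap]
  · refine integral_congr_ae (Eventually.of_forall fun v => ?_)
    simp only
    rw [← integral_ftC_mul_phaseFun, ← integral_mul_const, ← integral_const_mul]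
    refine integral_congr_ae (Eventually.of_forall fun ζ => ?_)
    simp only
    ring
  · have hm : Integrable (fun p : ℂ × (ℝ × ℝ) => ftC b p.1 *
        ((starRingEnd ℂ) (ψ p.2) * diagU ε u p.2)) (volume.prod volume) :=
      (ftC b).integrable.mul_prod (integrable_conj_mul ψ (diagU ε u))
    have hc : Continuous fun p : ℂ × (ℝ × ℝ) =>
        phaseFun 0 (-(2 * Real.pi * p.1.re), 4 * Real.pi ^ 2 * ε * p.1.im) p.2 := by
      have h1 : Continuous fun p : ℂ × (ℝ × ℝ) => p.1.re :=
        Complex.continuous_re.comp continuous_fst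
      have h2 : Continuous fun p : ℂ × (ℝ × ℝ) => p.1.im :=
        Complex.continuous_im.comp continuous_fst
      unfold phaseFun
      fun_prop
    have := hm.bdd_mul (c := 1) hc.aestronglyMeasurable
      (Eventually.of_forall fun p => (norm_phaseFun _ _ _).le)
    refine this.congr (Eventually.of_forall fun p => ?_)
    simp only [Function.uncurry]
    ring

/-- Bounded continuous functions of `h^{1/2} x + y` and `h D_y - h^{1/2} D_x` exist. -/
lemma exists_jointFunction {h : ℝ} (hh : 0 ≤ h) {a : ℝ × ℝ → ℂ} (ha : Continuous a) {C : ℝ}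
    (hC : ∀ z, ‖a z‖ ≤ C) : ∃ T : L2Plane →L[ℂ] L2Plane, IsJointFunction (opP h) (opQ h) a T ∧
      ∀ u, diagU (√h) (T u) =ᵐ[volume] fun v => a (specFun (√h) v) * diagU (√h) u v := by
  have hs := continuous_specFun (√h)
  have hex : ∀ u : L2Plane, ∃ w : L2Plane,
      diagU (√h) w =ᵐ[volume] fun v => a (specFun (√h) v) * diagU (√h) u v := by
    intro u
    obtain ⟨w, hw⟩ := exists_Lp_mul (μ := volume) (g := fun v => a (specFun (√h) v))
      (ha.comp hs).measurable (fun v => hC _) (diagU (√h) u)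
    exact ⟨(diagU (√h)).symm w, by rwa [LinearIsometryEquiv.apply_symm_apply]⟩
  choose T hT using hex
  have hTadd : ∀ u u', T (u + u') = T u + T u' := by
    intro u u'
    refine (diagU (√h)).injective (Lp.ext ?_)
    rw [map_add]
    have h1 := hT (u + u')
    rw [map_add] at h1
    filter_upwards [h1, hT u, hT u', Lp.coeFn_add (diagU (√h) u) (diagU (√h) u'),
      Lp.coeFn_add (diagU (√h) (T u)) (diagU (√h) (T u'))] with v e1 e2 e3 e4 e5
    rw [e1, e5, e4, Pi.add_apply, Pi.add_apply, e2, e3, mul_add]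
  have hTsmul : ∀ (c : ℂ) u, T (c • u) = c • T u := by
    intro c u
    refine (diagU (√h)).injective (Lp.ext ?_)
    rw [map_smul]
    have h1 := hT (c • u)
    rw [map_smul] at h1
    filter_upwards [h1, hT u, Lp.coeFn_smul c (diagU (√h) u),
      Lp.coeFn_smul c (diagU (√h) (T u))] with v e1 e2 e4 e5
    rw [e1, e5, e4, Pi.smul_apply, Pi.smul_apply, e2, smul_eq_mul, smul_eq_mul]
    ring
  have hTn : ∀ u, ‖T u‖ ≤ C * ‖u‖ := by
    intro u
    rw [← (diagU (√h)).norm_map (T u), ← (diagU (√h)).norm_map u]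
    refine Lp.norm_le_mul_norm_of_ae_le_mul ?_
    filter_upwards [hT u] with v hv
    rw [hv, norm_mul]
    exact mul_le_mul_of_nonneg_right (hC _) (norm_nonneg _)
  refine ⟨LinearMap.mkContinuous ⟨⟨T, hTadd⟩, hTsmul⟩ C hTn, ?_, hT⟩
  exact ⟨ℝ × ℝ, inferInstance, volume, diagU (√h), fun v => (specFun (√h) v).1,
    fun v => (specFun (√h) v).2, (continuous_fst.comp hs).measurable,
    (continuous_snd.comp hs).measurable, fun u w => mem_opP_iff_diagU,
    fun u w => mem_opQ_iff_diagU hh, hT⟩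

/-- The operator `a(h^{1/2} x + y, h D_y - h^{1/2} D_x)` is the weak limit of the quantizations of
cutoffs of `a`. -/
lemma tendsto_inner_opS_opA {h : ℝ} (hh : 0 ≤ h) {a : ℝ × ℝ → ℂ} (ha : Continuous a) {C : ℝ}
    (hC : ∀ z, ‖a z‖ ≤ C) {b : ℕ → 𝓢(ℝ × ℝ, ℂ)} {C' : ℝ} (hb : ∀ n z, ‖b n z‖ ≤ C')
    (hba : ∀ z, ∀ᶠ n in atTop, (b n : ℝ × ℝ → ℂ) =ᶠ[𝓝 z] a) (φ : 𝓢(ℝ × ℝ, ℂ)) (u : L2Plane) :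
    Tendsto (fun n => ⟪toL2 φ, opS (√h) 1 (b n) u⟫_ℂ) atTop (𝓝 ⟪toL2 φ, opA h a u⟫_ℂ) := by
  obtain ⟨T, hT, hTU⟩ := exists_jointFunction hh ha hC
  -- Uniqueness of the joint function identifies the chosen operator with the diagonalized one.
  have hA : opA h a = T := by
    have hex : ∃ T, IsJointFunction (opP h) (opQ h) a T := ⟨T, hT⟩
    rw [opA, jointFunction, dif_pos hex]
    exact hex.choose_spec.unique ha.measurable hT
  rw [hA]
  have h1 : ∀ w, ⟪toL2 φ, w⟫_ℂ = ⟪toL2 (diagE (√h) φ), diagU (√h) w⟫_ℂ := fun w => by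
    rw [← diagU_toL2, LinearIsometryEquiv.inner_map_map]
  have h2 : ⟪toL2 (diagE (√h) φ), diagU (√h) (T u)⟫_ℂ =
      ∫ v, (starRingEnd ℂ) (diagE (√h) φ v) * (a (specFun (√h) v) * diagU (√h) u v) := by
    rw [inner_toL2]
    refine integral_congr_ae ?_
    filter_upwards [hTU u] with v hv
    rw [hv]
  simp_rw [h1, inner_diagU_opS, h2]
  have hs := continuous_specFun (√h)
  refine tendsto_integral_of_dominated_convergence
    (fun v => ‖(starRingEnd ℂ) (diagE (√h) φ v) * diagU (√h) u v‖ * C') (fun n => ?_)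
    ((integrable_conj_mul _ _).norm.mul_const _) (fun n => Eventually.of_forall fun v => ?_)
    (Eventually.of_forall fun v => ?_)
  · exact (Complex.continuous_conj.comp (SchwartzMap.continuous _)).aestronglyMeasurable.mul
      (((b n).continuous.comp hs).aestronglyMeasurable.mul (Lp.aestronglyMeasurable _))
  · rw [norm_mul, norm_mul, norm_mul, mul_assoc, mul_comm ‖b n _‖]
    exact mul_le_mul_of_nonneg_left (mul_le_mul_of_nonneg_left (hb n _) (norm_nonneg _))
      (norm_nonneg _)
  · refine tendsto_const_nhds.congr' ?_
    filter_upwards [hba (specFun (√h) v)] with n hn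
    rw [hn.eq_of_nhds]

end JointSpectrum

/-! ### The coefficient symbols for general S(1) symbols. -/

section ExpansionSymbols

lemma isSymbol_zero : IsSymbol 0 :=
  ⟨contDiff_const, fun n => ⟨0, fun z => by
    rw [show (0 : ℝ × ℝ → ℂ) = fun _ => 0 from rfl, iteratedFDeriv_fun_zero]; simp⟩⟩

lemma IsSymbol.add {f g : ℝ × ℝ → ℂ} (hf : IsSymbol f) (hg : IsSymbol g) : IsSymbol (f + g) := by
  refine ⟨hf.1.add hg.1, fun n => ?_⟩
  obtain ⟨C, hC⟩ := hf.2 n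
  obtain ⟨C', hC'⟩ := hg.2 n
  refine ⟨C + C', fun z => ?_⟩
  rw [iteratedFDeriv_add_apply (hf.1.of_le (by exact_mod_cast le_top)).contDiffAt
    (hg.1.of_le (by exact_mod_cast le_top)).contDiffAt]
  exact (norm_add_le _ _).trans (add_le_add (hC z) (hC' z))

lemma IsSymbol.const_smul {f : ℝ × ℝ → ℂ} (hf : IsSymbol f) (r : ℂ) : IsSymbol (r • f) := by
  refine ⟨hf.1.const_smul r, fun n => ?_⟩
  obtain ⟨C, hC⟩ := hf.2 n
  refine ⟨‖r‖ * C, fun z => ?_⟩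
  rw [iteratedFDeriv_const_smul_apply (hf.1.of_le (by exact_mod_cast le_top)).contDiffAt,
    norm_smul]
  exact mul_le_mul_of_nonneg_left (hC z) (norm_nonneg _)

lemma IsSymbol.sub {f g : ℝ × ℝ → ℂ} (hf : IsSymbol f) (hg : IsSymbol g) : IsSymbol (f - g) := by
  simpa [sub_eq_add_neg] using hf.add (hg.const_smul (-1))

lemma IsSymbol.sum {ι : Type*} (s : Finset ι) {f : ι → ℝ × ℝ → ℂ} (hf : ∀ i ∈ s, IsSymbol (f i)) :
    IsSymbol (∑ i ∈ s, f i) :=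
  Finset.sum_induction _ _ (fun _ _ => IsSymbol.add) isSymbol_zero hf

lemma IsSymbol.fderiv_apply {f : ℝ × ℝ → ℂ} (hf : IsSymbol f) (v : ℝ × ℝ) :
    IsSymbol fun z => fderiv ℝ f z v := by
  have h1 : (fun z => fderiv ℝ f z v) = (ContinuousLinearMap.apply ℝ ℂ v) ∘ (fderiv ℝ f) := rfl
  have h2 : ContDiff ℝ ∞ (fderiv ℝ f) := hf.1.fderiv_right (by exact_mod_cast le_top)
  refine ⟨h2.clm_apply contDiff_const, fun n => ?_⟩
  obtain ⟨C, hC⟩ := hf.2 (n + 1)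
  refine ⟨‖ContinuousLinearMap.apply ℝ ℂ v‖ * C, fun z => ?_⟩
  rw [h1, ContinuousLinearMap.iteratedFDeriv_comp_left _ h2.contDiffAt
    (by exact_mod_cast le_top)]
  refine (ContinuousLinearMap.norm_compContinuousMultilinearMap_le _ _).trans ?_
  rw [norm_iteratedFDeriv_fderiv]
  exact mul_le_mul_of_nonneg_left (hC z) (norm_nonneg _)

lemma partialS_eventuallyEq {b : 𝓢(ℝ × ℝ, ℂ)} {f : ℝ × ℝ → ℂ} {z : ℝ × ℝ}
    (h : (b : ℝ × ℝ → ℂ) =ᶠ[𝓝 z] f) (v : ℝ × ℝ) :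
    (partialS v b : ℝ × ℝ → ℂ) =ᶠ[𝓝 z] fun z => fderiv ℝ f z v := by
  filter_upwards [h.fderiv (𝕜 := ℝ)] with w hw
  rw [← hw]
  exact SchwartzMap.lineDerivOp_apply_eq_fderiv v b w

/-- The symbols `termS j k₁ k₂ b` make sense for `b ∈ S(1)`. -/
lemma IsSymbol.exists_termS_eventuallyEq {f : ℝ × ℝ → ℂ} (hf : IsSymbol f) (j k₁ k₂ : ℕ) :
    ∃ c, IsSymbol c ∧ ∀ (b : 𝓢(ℝ × ℝ, ℂ)) z, (b : ℝ × ℝ → ℂ) =ᶠ[𝓝 z] f →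
      (termS j k₁ k₂ b : ℝ × ℝ → ℂ) =ᶠ[𝓝 z] c := by
  induction j generalizing f k₁ k₂ with
  | zero =>
    by_cases h : k₁ = 0 ∧ k₂ = 0
    · exact ⟨f, hf, fun b z hb => by rw [termS, if_pos h]; exact hb⟩
    · exact ⟨0, isSymbol_zero, fun b z _ => by rw [termS, if_neg h]; exact EventuallyEq.rfl⟩
  | succ j ih =>
    have h1 := hf.fderiv_apply (1, 0)
    have h2 := hf.fderiv_apply (0, 1)
    have key : ∀ (p : Prop) [Decidable p] (l₁ l₂ : ℕ) (v : ℝ × ℝ),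
        ∃ c, IsSymbol c ∧ ∀ (b : 𝓢(ℝ × ℝ, ℂ)) z, (b : ℝ × ℝ → ℂ) =ᶠ[𝓝 z] f →
          ((if p then 0 else termS j l₁ l₂ ∘L partialS v) b : ℝ × ℝ → ℂ) =ᶠ[𝓝 z] c := by
      intro p _ l₁ l₂ v
      by_cases hp : p
      · exact ⟨0, isSymbol_zero, fun b z _ => by rw [if_pos hp]; exact EventuallyEq.rfl⟩
      · obtain ⟨c, hc, h⟩ := ih (hf.fderiv_apply v) l₁ l₂
        refine ⟨c, hc, fun b z hb => ?_⟩
        rw [if_neg hp]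
        exact h _ z (partialS_eventuallyEq hb v)
    obtain ⟨c₁, hc₁, e₁⟩ := key (k₁ = 0) (k₁ - 1) k₂ (1, 0)
    obtain ⟨c₂, hc₂, e₂⟩ := ih h1 k₁ (k₂ + 1)
    obtain ⟨c₃, hc₃, e₃⟩ := key (k₂ = 0) k₁ (k₂ - 1) (0, 1)
    refine ⟨((j : ℂ) + 1)⁻¹ • (c₁ - (Complex.I * (k₂ + 1)) • c₂ - c₃),
      ((hc₁.sub (hc₂.const_smul _)).sub hc₃).const_smul _, fun b z hb => ?_⟩
    rw [termS]
    exact (((e₁ b z hb).sub ((e₂ _ z (partialS_eventuallyEq hb _)).const_smul _)).sub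
      (e₃ b z hb)).const_smul _

lemma SymbolBound.sum {ι : Type*} (s : Finset ι) {K : ι → ℕ → ℝ} {b : ι → 𝓢(ℝ × ℝ, ℂ)}
    (hb : ∀ i ∈ s, SymbolBound (K i) (b i)) :
    SymbolBound (fun n => ∑ i ∈ s, K i n) (∑ i ∈ s, b i : 𝓢(ℝ × ℝ, ℂ)) := by
  classical
  induction s using Finset.induction_on with
  | empty =>
    intro n z
    simp only [Finset.sum_empty]
    rw [show ((0 : 𝓢(ℝ × ℝ, ℂ)) : ℝ × ℝ → ℂ) = fun _ => 0 from rfl, iteratedFDeriv_fun_zero]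
    simp
  | insert i s hi ih =>
    simp only [Finset.sum_insert hi]
    exact (hb i (Finset.mem_insert_self _ _)).add
      (ih fun j hj => hb j (Finset.mem_insert_of_mem hj))

/-- The symbols `termS j k₁ k₂ b` are bounded uniformly in terms of bounds on `b`. -/
lemma exists_symbolBound_termS (j k₁ k₂ : ℕ) (K : ℕ → ℝ) : ∃ K' : ℕ → ℝ,
    ∀ b : 𝓢(ℝ × ℝ, ℂ), SymbolBound K b → SymbolBound K' (termS j k₁ k₂ b) := by
  have h0 : SymbolBound (fun _ => 0) (0 : 𝓢(ℝ × ℝ, ℂ)) := by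
    simpa using SymbolBound.sum (∅ : Finset ℕ) (K := fun _ _ => 0) (b := fun _ => 0) (by simp)
  induction j generalizing K k₁ k₂ with
  | zero =>
    by_cases h : k₁ = 0 ∧ k₂ = 0
    · exact ⟨K, fun b hb => by rw [termS, if_pos h]; exact hb⟩
    · exact ⟨fun _ => 0, fun b _ => by rw [termS, if_neg h]; exact h0⟩
  | succ j ih =>
    have hv1 : ‖((1, 0) : ℝ × ℝ)‖ ≤ 1 := by simp [Prod.norm_def]
    have hv2 : ‖((0, 1) : ℝ × ℝ)‖ ≤ 1 := by simp [Prod.norm_def]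
    have key : ∀ (p : Prop) [Decidable p] (l₁ l₂ : ℕ) (v : ℝ × ℝ), ‖v‖ ≤ 1 →
        ∃ K' : ℕ → ℝ, ∀ b : 𝓢(ℝ × ℝ, ℂ), SymbolBound K b →
          SymbolBound K' ((if p then 0 else termS j l₁ l₂ ∘L partialS v) b) := by
      intro p _ l₁ l₂ v hv
      by_cases hp : p
      · exact ⟨fun _ => 0, fun b _ => by rw [if_pos hp]; exact h0⟩
      · obtain ⟨K', h⟩ := ih l₁ l₂ fun n => K (n + 1)
        refine ⟨K', fun b hb => ?_⟩
        rw [if_neg hp]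
        exact h _ (hb.lineDeriv hv)
    obtain ⟨K₁, e₁⟩ := key (k₁ = 0) (k₁ - 1) k₂ (1, 0) hv1
    obtain ⟨K₂, e₂⟩ := ih k₁ (k₂ + 1) fun n => K (n + 1)
    obtain ⟨K₃, e₃⟩ := key (k₂ = 0) k₁ (k₂ - 1) (0, 1) hv2
    refine ⟨fun n => ‖((j : ℂ) + 1)⁻¹‖ * (K₁ n + ‖-(Complex.I * ((k₂ : ℂ) + 1))‖ * K₂ n +
      ‖(-1 : ℂ)‖ * K₃ n), fun b hb => ?_⟩
    rw [termS]
    have := (((e₁ b hb).add ((e₂ _ (hb.lineDeriv hv1)).smul (-(Complex.I * (k₂ + 1))))).add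
      ((e₃ b hb).smul (-1))).smul ((j : ℂ) + 1)⁻¹
    convert this using 2
    simp only [smul_apply, neg_smul, one_smul, sub_eq_add_neg]
    rfl

end ExpansionSymbols

/-! ### Combining the powers of h with the Taylor expansion. -/

section Expansion

lemma opS_sum {ι : Type*} (s : Finset ι) (ε t : ℝ) (b : ι → 𝓢(ℝ × ℝ, ℂ)) (u : L2Plane) :
    opS ε t (∑ i ∈ s, b i) u = ∑ i ∈ s, opS ε t (b i) u := by
  classical
  induction s using Finset.induction_on with
  | empty => simp [opS_zero]
  | insert i s hi ih => rw [Finset.sum_insert hi, Finset.sum_insert hi, opS_add, ih]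

/-- Regrouping by j = 2l + m: h^l contributes ε^{2l}, the m-th Taylor term contributes ε^m. -/
lemma sum_range_half {E : Type*} [AddCommMonoid E] (F : ℕ → ℕ → E) (N : ℕ) :
    ∑ j ∈ Finset.range (N + 1), ∑ l ∈ Finset.range (j / 2 + 1), F l (j - 2 * l) =
      ∑ l ∈ Finset.range (N + 1), ∑ m ∈ Finset.range (N + 1 - 2 * l), F l m := by
  rw [Finset.sum_sigma', Finset.sum_sigma']
  refine Finset.sum_nbij' (fun p => ⟨p.2, p.1 - 2 * p.2⟩) (fun p => ⟨p.2 + 2 * p.1, p.1⟩)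
    ?_ ?_ ?_ ?_ ?_
  · rintro ⟨j, l⟩ h
    simp only [Finset.mem_sigma, Finset.mem_range] at h ⊢
    omega
  · rintro ⟨l, m⟩ h
    simp only [Finset.mem_sigma, Finset.mem_range] at h ⊢
    omega
  · rintro ⟨j, l⟩ h
    simp only [Finset.mem_sigma, Finset.mem_range] at h
    simp only [Sigma.mk.injEq, heq_eq_eq, and_true]
    omega
  · rintro ⟨l, m⟩ h
    simp
  · rintro ⟨j, l⟩ h
    rfl

/-- The symbol that multiplies `x ^ k₁ D_x ^ k₂` at order `ε ^ j`, for Schwartz symbols. -/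
noncomputable def coeffS (a : ℕ → 𝓢(ℝ × ℝ, ℂ)) (k₁ k₂ j : ℕ) : 𝓢(ℝ × ℝ, ℂ) :=
  ∑ l ∈ Finset.range (j / 2 + 1), termS (j - 2 * l) k₁ k₂ (a l)

/-- The remainder of the expansion for `∑_{l ≤ N} ε ^ (2 l) a l + r`, with Schwartz symbols. -/
noncomputable def remS (ε : ℝ) (N : ℕ) (a : ℕ → 𝓢(ℝ × ℝ, ℂ)) (r : 𝓢(ℝ × ℝ, ℂ)) (u : L2Plane) :
    L2Plane :=
  opS ε 1 (∑ l ∈ Finset.range (N + 1), (((ε ^ 2) ^ l : ℝ) : ℂ) • a l + r) u -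
    ∑ j ∈ Finset.range (N + 1), ((ε ^ j : ℝ) : ℂ) •
      ∑ k ∈ pairsLE j, opS ε 0 (coeffS a k.1 k.2 j) (opXD k.1 k.2 u)

lemma sum_opS_coeffS (ε : ℝ) (a : ℕ → 𝓢(ℝ × ℝ, ℂ)) (j : ℕ) (u : L2Plane) :
    ∑ k ∈ pairsLE j, opS ε 0 (coeffS a k.1 k.2 j) (opXD k.1 k.2 u) =
      ∑ l ∈ Finset.range (j / 2 + 1), taylorS ε (j - 2 * l) (a l) u := by
  simp only [coeffS, opS_sum]
  rw [Finset.sum_comm]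
  refine Finset.sum_congr rfl fun l _ => ?_
  refine (Finset.sum_subset (fun k hk => ?_) fun k _ hk => ?_).symm
  · have := mem_pairsLE.1 hk
    exact mem_pairsLE.2 (by omega)
  · rw [termS_eq_zero (not_le.1 fun h => hk (mem_pairsLE.2 h))]
    exact opS_zero _ _ _

/-- Since a_l already carries ε^{2l}, only N + 1 − 2l Taylor terms are removed from it. When 2l > N
the truncated difference is 0 and the whole quantization of a_l belongs to the remainder. -/
lemma remS_eq (ε : ℝ) (N : ℕ) (a : ℕ → 𝓢(ℝ × ℝ, ℂ)) (r : 𝓢(ℝ × ℝ, ℂ)) (u : L2Plane) :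
    remS ε N a r u = ∑ l ∈ Finset.range (N + 1), (((ε ^ 2) ^ l : ℝ) : ℂ) •
      taylorRem ε 1 (N + 1 - 2 * l) (a l) u + opS ε 1 r u := by
  have h1 : ∑ j ∈ Finset.range (N + 1), ((ε ^ j : ℝ) : ℂ) •
      ∑ k ∈ pairsLE j, opS ε 0 (coeffS a k.1 k.2 j) (opXD k.1 k.2 u) =
      ∑ l ∈ Finset.range (N + 1), ∑ m ∈ Finset.range (N + 1 - 2 * l),
        ((ε ^ (m + 2 * l) : ℝ) : ℂ) • taylorS ε m (a l) u := by
    rw [← sum_range_half]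
    refine Finset.sum_congr rfl fun j _ => ?_
    rw [sum_opS_coeffS, Finset.smul_sum]
    refine Finset.sum_congr rfl fun l hl => ?_
    have := Finset.mem_range.1 hl
    rw [show j - 2 * l + 2 * l = j by omega]
  rw [remS, h1, opS_add, opS_sum, add_sub_right_comm, ← Finset.sum_sub_distrib]
  congr 1
  refine Finset.sum_congr rfl fun l _ => ?_
  rw [opS_smul, taylorRem, smul_sub, Finset.smul_sum]
  congr 1
  refine Finset.sum_congr rfl fun m _ => ?_
  rw [smul_smul, ← Complex.ofReal_mul, one_mul, pow_add, pow_mul, mul_comm (ε ^ m)]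

lemma exists_Bd_remS (N s : ℕ) (K : ℕ → ℕ → ℝ) (K' : ℕ → ℝ) : ∃ C : ℝ, ∀ ε ∈ Icc (0 : ℝ) 1,
    ∀ (a : ℕ → 𝓢(ℝ × ℝ, ℂ)) (r : 𝓢(ℝ × ℝ, ℂ)), (∀ l, SymbolBound (K l) (a l)) →
      SymbolBound (fun n => K' n * (ε ^ 2) ^ (N + 1)) r → ∀ (u : L2Plane) (κ : ℝ), 0 ≤ κ →
        Bd (s + N + 1) κ u → Bd s (C * ε ^ (N + 1) * κ) (remS ε N a r u) := by
  choose T hT0 hT using exists_Bd_taylorRem 1 s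
  obtain ⟨R, hR0, hR⟩ := exists_Bd_opS 1 s
  refine ⟨∑ l ∈ Finset.range (N + 1), T (N + 1 - 2 * l) *
    (∑ n ∈ Finset.range (s + 4 + (N + 1 - 2 * l)), K l n) +
    R * ∑ n ∈ Finset.range (s + 4), |K' n|, fun ε hε a r ha hr u κ hκ hu => ?_⟩
  have hε' : |ε| ≤ 1 := by rw [abs_of_nonneg hε.1]; exact hε.2
  have h1 : (1 : ℝ) ∈ Icc (0 : ℝ) 1 := ⟨zero_le_one, le_rfl⟩
  rw [remS_eq, add_mul, add_mul, Finset.sum_mul, Finset.sum_mul]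
  refine Bd.add (Bd.sum _ fun l _ => ?_) ?_
  · have := (hT (N + 1 - 2 * l) ε 1 hε' h1 (K l) (a l) (ha l) u κ
      (hu.mono (by omega) le_rfl)).smul (((ε ^ 2) ^ l : ℝ) : ℂ)
    refine this.mono le_rfl ?_
    have hK : 0 ≤ ∑ n ∈ Finset.range (s + 4 + (N + 1 - 2 * l)), K l n :=
      Finset.sum_nonneg fun n _ => (ha l).nonneg n
    -- The truncated subtraction may leave an exponent larger than N + 1; this is where ε ≤ 1 is
    -- needed.
    have he : (ε ^ 2) ^ l * ε ^ (N + 1 - 2 * l) ≤ ε ^ (N + 1) := by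
      rw [← pow_mul, ← pow_add]
      exact pow_le_pow_of_le_one hε.1 hε.2 (by omega)
    rw [Complex.norm_real, Real.norm_of_nonneg (pow_nonneg (sq_nonneg _) _), abs_of_nonneg hε.1]
    calc _ = (T (N + 1 - 2 * l) * (∑ n ∈ Finset.range (s + 4 + (N + 1 - 2 * l)), K l n)) *
          ((ε ^ 2) ^ l * ε ^ (N + 1 - 2 * l)) * κ := by ring
      _ ≤ _ := mul_le_mul_of_nonneg_right
          (mul_le_mul_of_nonneg_left he (mul_nonneg (hT0 _) hK)) hκ
  · refine (hR ε 1 hε' h1 _ r hr u κ (hu.mono (by omega) le_rfl)).mono le_rfl ?_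
    have he : (ε ^ 2) ^ (N + 1) ≤ ε ^ (N + 1) := by
      rw [← pow_mul]
      exact pow_le_pow_of_le_one hε.1 hε.2 (by omega)
    refine mul_le_mul_of_nonneg_right ?_ hκ
    rw [← Finset.sum_mul, mul_assoc]
    refine mul_le_mul_of_nonneg_left ?_ hR0
    exact mul_le_mul (Finset.sum_le_sum fun n _ => le_abs_self _) he
      (pow_nonneg (sq_nonneg _) _) (Finset.sum_nonneg fun n _ => abs_nonneg _)

end Expansion

/-! ### Passage to S(1) symbols and conclusion. -/

section MainTheorem

lemma schwartz_sum_apply {ι : Type*} (s : Finset ι) (b : ι → 𝓢(ℝ × ℝ, ℂ)) (z : ℝ × ℝ) :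
    (∑ i ∈ s, b i) z = ∑ i ∈ s, b i z := by
  classical
  induction s using Finset.induction_on with
  | empty => simp
  | insert i s hi ih => rw [Finset.sum_insert hi, Finset.sum_insert hi, add_apply, ih]

lemma IsSemiclassicalSymbol.exists_norm_le {h₁ : ℝ} {a : ℝ → ℝ × ℝ → ℂ} {a' : ℕ → ℝ × ℝ → ℂ}
    (ha : IsSemiclassicalSymbol h₁ a a') {h : ℝ} (hh : h ∈ Ioc 0 h₁) :
    ∃ C, ∀ z, ‖a h z‖ ≤ C := by
  obtain ⟨C, hC⟩ := ha.asymp 0 0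
  obtain ⟨C', hC'⟩ := (ha.coeff 0).2 0
  refine ⟨C * h ^ (0 + 1) + C', fun z => ?_⟩
  have h1 := hC h hh z
  have h2 := hC' z
  simp only [norm_iteratedFDeriv_zero, zero_add, Finset.sum_range_one, pow_zero, one_mul] at h1 h2 ⊢
  calc ‖a h z‖ = ‖(a h z - a' 0 z) + a' 0 z‖ := by rw [sub_add_cancel]
    _ ≤ _ := (norm_add_le _ _).trans (add_le_add h1 h2)

/-- The symbols of the expansion. -/
lemma exists_coeff_symbols {a' : ℕ → ℝ × ℝ → ℂ} (ha : ∀ l, IsSymbol (a' l)) :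
    ∃ c : ℕ → ℕ → ℕ → ℝ × ℝ → ℂ, (∀ k₁ k₂ j, IsSymbol (c k₁ k₂ j)) ∧ c 0 0 0 = a' 0 ∧
      ∀ k₁ k₂ j (b : ℕ → 𝓢(ℝ × ℝ, ℂ)) z,
        (∀ l ∈ Finset.range (j / 2 + 1), (b l : ℝ × ℝ → ℂ) =ᶠ[𝓝 z] a' l) →
          (coeffS b k₁ k₂ j : ℝ × ℝ → ℂ) =ᶠ[𝓝 z] c k₁ k₂ j := by
  choose t ht1 ht2 using fun l m k₁ k₂ => (ha l).exists_termS_eventuallyEq m k₁ k₂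
  have hc : ∀ k₁ k₂ j (b : ℕ → 𝓢(ℝ × ℝ, ℂ)) z,
      (∀ l ∈ Finset.range (j / 2 + 1), (b l : ℝ × ℝ → ℂ) =ᶠ[𝓝 z] a' l) →
        (coeffS b k₁ k₂ j : ℝ × ℝ → ℂ) =ᶠ[𝓝 z]
          ∑ l ∈ Finset.range (j / 2 + 1), t l (j - 2 * l) k₁ k₂ := by
    intro k₁ k₂ j b z hb
    have h1 : ∀ᶠ w in 𝓝 z, ∀ l ∈ Finset.range (j / 2 + 1),
        termS (j - 2 * l) k₁ k₂ (b l) w = t l (j - 2 * l) k₁ k₂ w :=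
      (Filter.eventually_all_finset _).2 fun l hl => ht2 l (j - 2 * l) k₁ k₂ (b l) z (hb l hl)
    filter_upwards [h1] with w hw
    rw [coeffS, schwartz_sum_apply, Finset.sum_apply]
    exact Finset.sum_congr rfl hw
  refine ⟨fun k₁ k₂ j => ∑ l ∈ Finset.range (j / 2 + 1), t l (j - 2 * l) k₁ k₂,
    fun k₁ k₂ j => IsSymbol.sum _ fun l _ => ht1 _ _ _ _, ?_, hc⟩
  obtain ⟨K, hK⟩ := (ha 0).exists_symbolBound
  obtain ⟨D, -, hD⟩ := exists_cutoff
  obtain ⟨b, -, hb⟩ := hD K _ (ha 0).1 hK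
  funext z
  -- The coefficient is characterized only through Schwartz functions that agree with the symbols
  -- near a point, so a cutoff of a' 0 is evaluated at z.
  obtain ⟨n, hn⟩ := (hb z).exists
  have h1 := (ht2 0 0 0 0 (b n) z hn).eq_of_nhds
  rw [termS, if_pos ⟨rfl, rfl⟩, ContinuousLinearMap.id_apply, hn.eq_of_nhds] at h1
  simpa using h1.symm

/-- The remainder is the weak limit of the remainders for cutoffs of the symbols. -/
lemma tendsto_inner_remS {h : ℝ} (hh : 0 < h) {N : ℕ} {f : ℝ × ℝ → ℂ} (hf : Continuous f) {C : ℝ}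
    (hC : ∀ z, ‖f z‖ ≤ C) {a' : ℕ → ℝ × ℝ → ℂ} {c : ℕ → ℕ → ℕ → ℝ × ℝ → ℂ}
    (hcs : ∀ k₁ k₂ j, IsSymbol (c k₁ k₂ j))
    (hc : ∀ k₁ k₂ j (b : ℕ → 𝓢(ℝ × ℝ, ℂ)) z,
      (∀ l ∈ Finset.range (j / 2 + 1), (b l : ℝ × ℝ → ℂ) =ᶠ[𝓝 z] a' l) →
        (coeffS b k₁ k₂ j : ℝ × ℝ → ℂ) =ᶠ[𝓝 z] c k₁ k₂ j)
    {b : ℕ → ℕ → 𝓢(ℝ × ℝ, ℂ)} {r : ℕ → 𝓢(ℝ × ℝ, ℂ)} {K : ℕ → ℕ → ℝ} {K' : ℕ → ℝ}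
    (hb : ∀ n l, SymbolBound (K l) (b n l)) (hr : ∀ n, SymbolBound K' (r n))
    (hba : ∀ l z, ∀ᶠ n in atTop, (b n l : ℝ × ℝ → ℂ) =ᶠ[𝓝 z] a' l)
    (hrf : ∀ z, ∀ᶠ n in atTop, (r n : ℝ × ℝ → ℂ) =ᶠ[𝓝 z]
      fun w => f w - ∑ l ∈ Finset.range (N + 1), (h : ℂ) ^ l * a' l w)
    (φ : 𝓢(ℝ × ℝ, ℂ)) (u : L2Plane) :
    Tendsto (fun n => ⟪toL2 φ, remS (√h) N (b n) (r n) u⟫_ℂ) atTop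
      (𝓝 ⟪toL2 φ, remainder h f c N u⟫_ℂ) := by
  have hall : ∀ (s : Finset ℕ) z, ∀ᶠ n in atTop, ∀ l ∈ s, (b n l : ℝ × ℝ → ℂ) =ᶠ[𝓝 z] a' l :=
    fun s z => (Filter.eventually_all_finset _).2 fun l _ => hba l z
  have hcoe : ∀ n w, (∑ l ∈ Finset.range (N + 1), ((((√h) ^ 2) ^ l : ℝ) : ℂ) • b n l + r n) w =
      ∑ l ∈ Finset.range (N + 1), (h : ℂ) ^ l * b n l w + r n w := by
    intro n w
    rw [add_apply, schwartz_sum_apply, Real.sq_sqrt hh.le]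
    simp
  have hmain : Tendsto (fun n => ⟪toL2 φ, opS (√h) 1
      (∑ l ∈ Finset.range (N + 1), ((((√h) ^ 2) ^ l : ℝ) : ℂ) • b n l + r n) u⟫_ℂ) atTop
      (𝓝 ⟪toL2 φ, opA h f u⟫_ℂ) := by
    refine tendsto_inner_opS_opA hh.le hf hC
      (C' := ∑ l ∈ Finset.range (N + 1), ‖(h : ℂ) ^ l‖ * K l 0 + K' 0) (fun n z => ?_)
      (fun z => ?_) φ u
    · rw [hcoe]
      refine (norm_add_le _ _).trans (add_le_add ((norm_sum_le _ _).trans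
        (Finset.sum_le_sum fun l _ => ?_)) ((hr n).norm_le z))
      rw [norm_mul]
      exact mul_le_mul_of_nonneg_left ((hb n l).norm_le z) (norm_nonneg _)
    · filter_upwards [hall (Finset.range (N + 1)) z, hrf z] with n h1 h2
      filter_upwards [(Filter.eventually_all_finset _).2 h1, h2] with w e1 e2
      rw [hcoe, e2, Finset.sum_congr rfl fun l hl => by rw [e1 l hl]]
      ring
  have hterm : ∀ k₁ k₂ j, Tendsto (fun n => ⟪toL2 φ, opS (√h) 0 (coeffS (b n) k₁ k₂ j)
      (opXD k₁ k₂ u)⟫_ℂ) atTop (𝓝 ⟪toL2 φ, opWeyl h (c k₁ k₂ j) (opXD k₁ k₂ u)⟫_ℂ) := by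
    intro k₁ k₂ j
    choose B hB using fun l => exists_symbolBound_termS (j - 2 * l) k₁ k₂ (K l)
    refine tendsto_inner_opS_opWeyl hh (hcs _ _ _)
      (fun n => SymbolBound.sum _ fun l _ => hB l _ (hb n l)) (fun z => ?_) _ _
    filter_upwards [hall (Finset.range (j / 2 + 1)) z] with n hn
    exact hc k₁ k₂ j (b n) z hn
  simp only [remS, remainder, inner_sub_right, inner_sum, inner_smul_right]
  refine hmain.sub (tendsto_finsetSum _ fun j _ => ?_)
  have hp : h ^ ((j : ℝ) / 2) = (√h) ^ j := by
    rw [Real.sqrt_eq_rpow, ← Real.rpow_natCast, ← Real.rpow_mul hh.le]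
    congr 1
    ring
  rw [hp]
  exact (tendsto_finsetSum _ fun k _ => hterm _ _ _).const_mul _

/-- Cutoffs of the coefficients do not depend on h, and cutoffs of the symbol remainder inherit
bounds of size h^{N+1}. The estimate for Schwartz symbols therefore holds with one constant along
the whole sequence and survives the weak limit. -/
lemma IsSemiclassicalSymbol.exists_Bd_remainder {h₁ : ℝ} {a : ℝ → ℝ × ℝ → ℂ}
    {a' : ℕ → ℝ × ℝ → ℂ} (ha : IsSemiclassicalSymbol h₁ a a') {c : ℕ → ℕ → ℕ → ℝ × ℝ → ℂ}
    (hcs : ∀ k₁ k₂ j, IsSymbol (c k₁ k₂ j))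
    (hc : ∀ k₁ k₂ j (b : ℕ → 𝓢(ℝ × ℝ, ℂ)) z,
      (∀ l ∈ Finset.range (j / 2 + 1), (b l : ℝ × ℝ → ℂ) =ᶠ[𝓝 z] a' l) →
        (coeffS b k₁ k₂ j : ℝ × ℝ → ℂ) =ᶠ[𝓝 z] c k₁ k₂ j) (N s : ℕ) :
    ∃ C : ℝ, ∀ h ∈ Ioc 0 h₁, h ≤ 1 → ∀ (u : L2Plane) (κ : ℝ), 0 ≤ κ → Bd (s + N + 1) κ u →
      Bd s (C * (√h) ^ (N + 1) * κ) (remainder h (a h) c N u) := by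
  choose K hK using fun l => (ha.coeff l).exists_symbolBound
  obtain ⟨D, -, hD⟩ := exists_cutoff
  choose b hb hba using fun l => hD (K l) (a' l) (ha.coeff l).1 (hK l)
  choose R hR using ha.asymp N
  obtain ⟨C, hC⟩ := exists_Bd_remS N s (fun l m => D m * ∑ i ∈ Finset.range (m + 1), K l i)
    fun m => D m * ∑ i ∈ Finset.range (m + 1), R i
  refine ⟨C, fun h hh hh1 u κ hκ hu => ?_⟩
  have hr0 : ContDiff ℝ ∞ fun w => a h w - ∑ l ∈ Finset.range (N + 1), (h : ℂ) ^ l * a' l w :=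
    (ha.contDiff h hh).sub (ContDiff.sum fun l _ => contDiff_const.mul (ha.coeff l).1)
  obtain ⟨r, hr, hrf⟩ := hD (fun n => R n * h ^ (N + 1)) _ hr0 fun n z => hR n h hh z
  obtain ⟨C', hC'⟩ := ha.exists_norm_le hh
  refine Bd.of_tendsto (v := fun n => remS (√h) N (fun l => b l n) (r n) u) (fun n => ?_)
    fun φ => tendsto_inner_remS hh.1 (ha.contDiff h hh).continuous hC' hcs hc
      (fun n l => hb l n) hr hba hrf φ u
  refine hC (√h) ⟨Real.sqrt_nonneg _, Real.sqrt_le_one.2 hh1⟩ _ _ (fun l => hb l n) ?_ u κ hκ hu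
  convert hr n using 2
  rw [Real.sq_sqrt hh.1.le, ← Finset.sum_mul, mul_assoc]

end MainTheorem

theorem proposition3p1 (h₁ : ℝ) (a : ℝ → ℝ × ℝ → ℂ) (a' : ℕ → ℝ × ℝ → ℂ)
    (ha : IsSemiclassicalSymbol h₁ a a') :
    (∀ h ∈ Set.Ioc 0 h₁, ∃ T, IsJointFunction (opP h) (opQ h) (a h) T) ∧
    ∃ c : ℕ → ℕ → ℕ → ℝ × ℝ → ℂ,
      (∀ k₁ k₂ j, IsSymbol (c k₁ k₂ j)) ∧
      c 0 0 0 = a' 0 ∧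
      (∀ k₁ k₂ j, ∀ h : ℝ, 0 < h → ∃ A, IsWeyl h (c k₁ k₂ j) A) ∧
      ∀ N : ℕ, ∃ h₀ : ℝ, 0 < h₀ ∧ h₀ ≤ h₁ ∧
        ∀ s : ℕ, ∃ C : ℝ, ∀ h ∈ Set.Ioc 0 h₀, ∀ u : L2Plane, MemB (s + N + 1) u →
          MemB s (remainder h (a h) c N u) ∧
          normB s (remainder h (a h) c N u) ≤
            C * h ^ (((N : ℝ) + 1) / 2) * normB (s + N + 1) u := by
  refine ⟨fun h hh => ?_, ?_⟩
  · obtain ⟨C, hC⟩ := ha.exists_norm_le hh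
    obtain ⟨T, hT, -⟩ := exists_jointFunction hh.1.le (ha.contDiff h hh).continuous hC
    exact ⟨T, hT⟩
  obtain ⟨c, hcs, hc0, hc⟩ := exists_coeff_symbols ha.coeff
  refine ⟨c, hcs, hc0, fun k₁ k₂ j h hh => (hcs k₁ k₂ j).exists_isWeyl hh, fun N =>
    -- The threshold is independent of N and s: only √h ≤ 1 is used.
    ⟨min 1 h₁, lt_min one_pos ha.pos, min_le_right _ _, fun s => ?_⟩⟩
  obtain ⟨C, hC⟩ := ha.exists_Bd_remainder hcs hc N s
  obtain ⟨B, hB0, hB⟩ := MemB.exists_Bd (s + N + 1)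
  -- B passes from `normB` to `Bd` on the source side, the square root from `Bd` back to `normB` on
  -- the target side.
  refine ⟨√((pairsLE s).card) * (C * B), fun h hh u hu => ?_⟩
  have h0 : 0 ≤ normB (s + N + 1) u := Real.sqrt_nonneg _
  have h1 := hC h ⟨hh.1, hh.2.trans (min_le_right _ _)⟩ (hh.2.trans (min_le_left _ _)) u _
    (mul_nonneg hB0 h0) (hB u hu)
  refine ⟨h1.memB, h1.normB_le.trans (le_of_eq ?_)⟩
  have hp : h ^ (((N : ℝ) + 1) / 2) = (√h) ^ (N + 1) := by
    rw [Real.sqrt_eq_rpow, ← Real.rpow_natCast, ← Real.rpow_mul hh.1.le]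
    congr 1
    push_cast
    ring
  rw [hp]
  ring
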